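/- Let $m\ge 1$, let $\Omega\subset\mathbb R^d$ be a Lipschitz domain (a connected open set that is either the region above a Lipschitz graph, or a set whose nonempty boundary is covered by finitely many balls near which it coincides, in suitable rotated coordinates, with the region above a Lipschitz graph). Let $\mathbf A=(A^{jk}_{\alpha\beta})$ and $\mathbf B$ be measurable complex coefficients on $\mathbb R^d$, indexed by $1\le j,k\le N$ and multiindices $|\alpha|=|\beta|=m$, acting on arrays by $(\mathbf A\dot H)_{j,\alpha}=\sum_{k,\beta}A^{jk}_{\alpha\beta}H_{k,\beta}$, with $\mathbf A$ bounded, and let $\varepsilon=\|\mathbf A-\mathbf B\|_{L^\infty(\mathbb R^d)}<\infty$ (pointwise operator norm). No ellipticity is required. For $0<p\le\infty$ and $s\in\mathbb R$, write $\delta(x)=\operatorname{dist}(x,\partial\Omega)$, $B_x=B(x,\delta(x)/2)$ and $$\|\dot H\|_{L^{p,s}_{av}(\Omega)}=\Bigl(\int_\Omega\Bigl(\frac1{|B_x|}\int_{B_x}|\dot H|^2\Bigr)^{p/2}\delta(x)^{p-1-ps}\,dx\Bigr)^{1/p},\qquad \|\dot H\|_{L^{\infty,s}_{av}(\Omega)}=\operatorname*{ess\,sup}_{x\in\Omega}\Bigl(\frac1{|B_x|}\int_{B_x}|\dot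 H|^2\Bigr)^{1/2}\delta(x)^{1-s},$$ and $\|\vec u\|_{\dot W^{p,s}_{m,av}(\Omega)}=\|\nabla^m\vec u\|_{L^{p,s}_{av}(\Omega)}$ for $\vec u:\Omega\to\mathbb C^N$ with locally integrable weak derivatives up to order $m$; functions in $\dot W^{p,s}_{m,av}(\Omega)$ are identified if their $m$-th order gradients agree a.e. For $\dot H\in L^{p,s}_{av}(\Omega)$, a solution in $\dot W^{p,s}_{m,av}(\Omega)$ of the homogeneous Dirichlet problem for $\mathbf A$ with data $\dot H$ is a function $\vec u\in\dot W^{p,s}_{m,av}(\Omega)$ with $\langle\nabla^m\vec\varphi,\mathbf A\nabla^m\vec u\rangle_\Omega=\langle\nabla^m\vec\varphi,\dot H\rangle_\Omega$ for all $\vec\varphi\in C^\infty_0(\Omega)$ (that is, $L\vec u=\operatorname{div}_m\dot H$ in $\Omega$, where $L$ is the operator with coefficients $\mathbf A$), and such that the Sobolev trace of $\nabla^{m-1}\vec u$ on $\partial\Omega$ is zero. A solution of the homogeneous Neumann problem is one satisfying, instead of the trace condition, $\langle\nabla^m\vec\varphi,\mathbf A\nabla^m\vec u-\dot H\rangle_\Omega=0$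 for all $\vec\varphi\in C^\infty_0(\mathbb R^d)$ (zero Neumann boundary values). Similarly for $\mathbf B$, whose operator is denoted $M$. Set $$C(c,p,\varepsilon)=\frac{c}{1-c\varepsilon}\ \text{ if }p\ge1,\qquad C(c,p,\varepsilon)=\Bigl(\frac{c^p}{1-c^p\varepsilon^p}\Bigr)^{1/p}\ \text{ if }p\le1 .$$ In each of (1) and (2), "the problem" is throughout either the homogeneous Dirichlet problem or throughout the homogeneous Neumann problem. (1) Let $0<s<1$, $\frac{d-1}{d-1+s}<p\le\infty$ and $C_0>0$. Suppose that for every $\dot\Phi\in L^{p,s}_{av}(\Omega)$ the problem for $\mathbf A$ with data $\dot\Phi$ has a solution $\vec u$ with $\|\vec u\|_{\dot W^{p,s}_{m,av}(\Omega)}\le C_0\|\dot\Phi\|_{L^{p,s}_{av}(\Omega)}$. If $\varepsilon<1/C_0$, then for every $\dot H\in L^{p,s}_{av}(\Omega)$ the problem for $\mathbf B$ with data $\dot H$ has a solution $\vec u$ with $\|\vec u\|_{\dot W^{p,s}_{m,av}(\Omega)}\le C(C_0,p,\varepsilon)\|\dot H\|_{L^{p,s}_{av}(\Omega)}$. (2)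 For $j=0,1$ let $0<s_j<1$, $\frac{d-1}{d-1+s_j}<p_j\le\infty$ and $C_j>0$. Suppose that the problems for $\mathbf A$ are compatibly well posed: for each $j$ and each $\dot\Phi\in L^{p_j,s_j}_{av}(\Omega)$ there is exactly one solution in $\dot W^{p_j,s_j}_{m,av}(\Omega)$, its norm is at most $C_j\|\dot\Phi\|_{L^{p_j,s_j}_{av}(\Omega)}$, and if $\dot\Phi\in L^{p_0,s_0}_{av}(\Omega)\cap L^{p_1,s_1}_{av}(\Omega)$ then a single function $\vec u\in\dot W^{p_0,s_0}_{m,av}(\Omega)\cap\dot W^{p_1,s_1}_{m,av}(\Omega)$ is a solution for both pairs. If $\varepsilon<\min(1/C_0,1/C_1)$, then for every $\dot H\in L^{p_0,s_0}_{av}(\Omega)\cap L^{p_1,s_1}_{av}(\Omega)$ there is a single function $\vec u$ that solves the problem for $\mathbf B$ with data $\dot H$ and satisfies $\|\vec u\|_{\dot W^{p_j,s_j}_{m,av}(\Omega)}\le C(C_j,p_j,\varepsilon)\|\dot H\|_{L^{p_j,s_j}_{av}(\Omega)}$ for both $j=0$ and $j=1$. -/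

import Mathlib

open MeasureTheory Filter Topology Set
open scoped ENNReal NNReal ContDiff

noncomputable section

namespace EllipticBVP

/-- The space `ℝ^d` with its Euclidean norm. -/
abbrev Rd (d : ℕ) := EuclideanSpace ℝ (Fin d)

/-- Multiindices `α ∈ ℕ^d` of length `|α| = k`. -/
abbrev MultiIndex (d k : ℕ) := {α : Fin d → ℕ // α ∈ Finset.piAntidiag Finset.univ k}

/-- Arrays `(H_{j,α})`, indexed by `1 ≤ j ≤ N` and `|α| = m`, with
`⟨F, G⟩ = ∑_{j,α} conj (F_{j,α}) G_{j,α}` and the corresponding Euclidean norm. -/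
abbrev Arr (d N m : ℕ) := EuclideanSpace ℂ (Fin N × MultiIndex d m)

/-- Coefficients `A^{jk}_{αβ}(x)` defined on `ℝ^d`. -/
abbrev Coeff (d N m : ℕ) :=
  Rd d → Matrix (Fin N × MultiIndex d m) (Fin N × MultiIndex d m) ℂ

variable {d N m : ℕ}

/-! ### Lipschitz domains -/

/-- The component of `x` orthogonal to the axis `e`: the coordinate `x'` of `x = (x', t)`. -/
def horiz (e x : Rd d) : (ℝ ∙ e)ᗮ := (ℝ ∙ e)ᗮ.orthogonalProjectionOnto x

/-- `V = {(x', t) : t > ψ(x')}` in the orthonormal coordinates whose `t`-axis is spanned by the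
unit vector `e`, for some function `ψ` with Lipschitz constant at most `M`. -/
def IsLipschitzGraphDomain (M : ℝ≥0) (e : Rd d) (V : Set (Rd d)) : Prop :=
  ‖e‖ = 1 ∧ ∃ ψ : (ℝ ∙ e)ᗮ → ℝ, LipschitzWith M ψ ∧ V = {x | ψ (horiz e x) < inner ℝ e x}

/-- The open cylinder with center `c`, axis parallel to `e`, the given radius and height. -/
def cylinder (e c : Rd d) (radius height : ℝ) : Set (Rd d) :=
  {x | ‖horiz e (x - c)‖ < radius ∧ |inner ℝ e (x - c)| < height / 2}

/-- A Lipschitz domain: a connected open set that is either the domain above a Lipschitz graph, or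
whose boundary is covered by finitely many balls `B(x_j, r_j)` centered at boundary points, such
that in a cylinder around `x_j` of size comparable to `r_j` the set is a Lipschitz graph domain. -/
def IsLipschitzDomain (Ω : Set (Rd d)) : Prop :=
  IsOpen Ω ∧ IsConnected Ω ∧
    ((∃ M e, IsLipschitzGraphDomain M e Ω) ∨
      ∃ (M : ℝ≥0) (n : ℕ) (x : Fin n → Rd d) (r : Fin n → ℝ),
        0 < n ∧ (∀ j, x j ∈ frontier Ω) ∧ (∀ j, 0 < r j) ∧
        frontier Ω ⊆ ⋃ j, Metric.ball (x j) (r j) ∧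
        ∀ j, ∃ e V, IsLipschitzGraphDomain M e V ∧ x j ∈ frontier V ∧
          cylinder e (x j) (2 * r j) ((8 + 8 * M) * r j) ∩ Ω =
            cylinder e (x j) (2 * r j) ((8 + 8 * M) * r j) ∩ V)

/-! ### Classical and weak derivatives -/

/-- The partial derivative `∂_i f`. -/
def pderiv (i : Fin d) (f : Rd d → ℂ) : Rd d → ℂ :=
  fun x => fderiv ℝ f x (EuclideanSpace.single i 1)

/-- The iterated partial derivative `∂^α f` of a smooth function. -/
def mderiv (α : Fin d → ℕ) (f : Rd d → ℂ) : Rd d → ℂ :=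
  (List.finRange d).foldr (fun i g => (pderiv i)^[α i] g) f

/-- The array `∇^m φ` of a smooth `ℂ^N`-valued function. -/
def mgrad (m : ℕ) (φ : Rd d → Fin N → ℂ) (x : Rd d) : Arr d N m :=
  WithLp.toLp 2 fun i => mderiv i.2.1 (fun y => φ y i.1) x

/-- `g` is the weak derivative `∂^α f` in the open set `Ω`. -/
def IsWeakDeriv (Ω : Set (Rd d)) (α : Fin d → ℕ) (f g : Rd d → ℂ) : Prop :=
  LocallyIntegrableOn f Ω ∧ LocallyIntegrableOn g Ω ∧
    ∀ φ : Rd d → ℂ, ContDiff ℝ ∞ φ → HasCompactSupport φ → tsupport φ ⊆ Ω →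
      ∫ x in Ω, f x * mderiv α φ x = (-1) ^ (∑ i, α i) * ∫ x in Ω, g x * φ x

open Classical in
/-- The weak derivative `∂^α f` in `Ω` (determined almost everywhere in `Ω`), and zero if there
is none. -/
def weakDeriv (Ω : Set (Rd d)) (α : Fin d → ℕ) (f : Rd d → ℂ) : Rd d → ℂ :=
  if h : ∃ g, IsWeakDeriv Ω α f g then h.choose else 0

/-- `u` belongs to the local Sobolev space `W^{m,1}_loc(Ω; ℂ^N)`: all its weak derivatives of order
at most `m` exist as locally integrable functions. -/
def MemSobolevLoc (m : ℕ) (Ω : Set (Rd d)) (u : Rd d → Fin N → ℂ) : Prop :=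
  ∀ (j : Fin N) (α : Fin d → ℕ), ∑ i, α i ≤ m → ∃ g, IsWeakDeriv Ω α (fun x => u x j) g

/-- The array `∇^m u` of weak derivatives of order `m` in `Ω`. -/
def weakGrad (m : ℕ) (Ω : Set (Rd d)) (u : Rd d → Fin N → ℂ) (x : Rd d) : Arr d N m :=
  WithLp.toLp 2 fun i => weakDeriv Ω i.2.1 (fun y => u y i.1) x

/-! ### The spaces `L^{p,s}_av(Ω)` and `Ẇ^{p,s}_{m,av}(Ω)` -/

/-- The distance `dist(x, ∂Ω)`. -/
def bdist (Ω : Set (Rd d)) (x : Rd d) : ℝ := Metric.infDist x (frontier Ω)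

/-- The average of `|H|^2` over the ball `B(x, dist(x, ∂Ω) / 2)`. -/
def whitneyAvg (Ω : Set (Rd d)) (H : Rd d → Arr d N m) (x : Rd d) : ℝ≥0∞ :=
  ⨍⁻ y in Metric.ball x (bdist Ω x / 2), ‖H y‖ₑ ^ 2 ∂volume

open Classical in
/-- The (quasi-)norm of `L^{p,s}_av(Ω)`: the `L^p(Ω)` quasinorm, with weight
`dist(x, ∂Ω)^{p-1-ps}`, of the `L^2` averages of `H`; for `p = ∞`, the essential supremum of these
averages times `dist(x, ∂Ω)^{1-s}`. -/
def LavNorm (p : ℝ≥0∞) (s : ℝ) (Ω : Set (Rd d)) (H : Rd d → Arr d N m) : ℝ≥0∞ :=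
  if p = ⊤ then
    essSup (fun x => whitneyAvg Ω H x ^ (1 / 2 : ℝ) * ENNReal.ofReal (bdist Ω x) ^ (1 - s))
      (volume.restrict Ω)
  else
    (∫⁻ x in Ω, whitneyAvg Ω H x ^ (p.toReal / 2) *
      ENNReal.ofReal (bdist Ω x) ^ (p.toReal - 1 - p.toReal * s)) ^ (1 / p.toReal)

/-- `H ∈ L^{p,s}_av(Ω)`. -/
def MemLav (p : ℝ≥0∞) (s : ℝ) (Ω : Set (Rd d)) (H : Rd d → Arr d N m) : Prop :=
  AEStronglyMeasurable H (volume.restrict Ω) ∧ LavNorm p s Ω H < ⊤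

/-- `u ∈ Ẇ^{p,s}_{m,av}(Ω)`. -/
def MemWav (m : ℕ) (p : ℝ≥0∞) (s : ℝ) (Ω : Set (Rd d)) (u : Rd d → Fin N → ℂ) : Prop :=
  MemSobolevLoc m Ω u ∧ MemLav p s Ω (weakGrad m Ω u)

/-- The norm of `u` in `Ẇ^{p,s}_{m,av}(Ω)`. -/
def WavNorm (m : ℕ) (p : ℝ≥0∞) (s : ℝ) (Ω : Set (Rd d)) (u : Rd d → Fin N → ℂ) : ℝ≥0∞ :=
  LavNorm p s Ω (weakGrad m Ω u)

/-- The lower endpoint `(d-1)/(d-1+s)` of the range of exponents `p`. -/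
def pmin (d : ℕ) (s : ℝ) : ℝ≥0∞ := ENNReal.ofReal (((d : ℝ) - 1) / ((d : ℝ) - 1 + s))

/-! ### Boundary values -/

/-- `f` is the Sobolev trace on `∂Ω` of `v`, a function that is locally `W^{1,1}` up to the
boundary. The trace is the continuous extension of the restriction `φ ↦ φ|_{∂Ω}`, from smooth
functions to a map from `W^{1,1}_loc` of the closure of `Ω` to `L^1_loc(∂Ω, σ)`; that is, `f` is the
`L^1_loc(∂Ω, σ)` limit of restrictions of smooth functions that converge to `v`. The surface measure
`σ` is, up to a constant factor, the `(d-1)`-dimensional Hausdorff measure. -/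
def HasTrace (Ω : Set (Rd d)) (v f : Rd d → ℂ) : Prop :=
  (∀ i, ∃ g, IsWeakDeriv Ω (Pi.single i 1) v g) ∧
  ∃ φ : ℕ → Rd d → ℂ, (∀ k, ContDiff ℝ ∞ (φ k)) ∧ ∀ R : ℝ,
    Tendsto (fun k => ∫⁻ x in Ω ∩ Metric.ball 0 R, ‖φ k x - v x‖ₑ) atTop (𝓝 0) ∧
    (∀ i, Tendsto (fun k => ∫⁻ x in Ω ∩ Metric.ball 0 R,
      ‖pderiv i (φ k) x - weakDeriv Ω (Pi.single i 1) v x‖ₑ) atTop (𝓝 0)) ∧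
    Tendsto (fun k => ∫⁻ x in frontier Ω ∩ Metric.ball 0 R, ‖φ k x - f x‖ₑ
      ∂(Measure.hausdorffMeasure ((d : ℝ) - 1))) atTop (𝓝 0)

/-- The Dirichlet boundary values `Tr_{m-1} u = Tr (∇^{m-1} u)` vanish. -/
def DirichletZero (m : ℕ) (Ω : Set (Rd d)) (u : Rd d → Fin N → ℂ) : Prop :=
  ∀ (j : Fin N) (γ : Fin d → ℕ), ∑ i, γ i + 1 = m →
    HasTrace Ω (weakDeriv Ω γ fun x => u x j) 0

/-- The pairing `⟨∇^m φ, A ∇^m u⟩_Ω`. -/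
def energy (Ω : Set (Rd d)) (A : Coeff d N m) (φ u : Rd d → Fin N → ℂ) : ℂ :=
  ∫ x in Ω, inner ℂ (mgrad m φ x) (Matrix.toEuclideanCLM (𝕜 := ℂ) (A x) (weakGrad m Ω u x))

/-- The pairing `⟨∇^m φ, H⟩_Ω`. -/
def pairing (Ω : Set (Rd d)) (φ : Rd d → Fin N → ℂ) (H : Rd d → Arr d N m) : ℂ :=
  ∫ x in Ω, inner ℂ (mgrad m φ x) (H x)

/-- `L u = div_m H` in `Ω` in the weak sense, where `L` is the operator with coefficients `A`. -/
def WeakEq (Ω : Set (Rd d)) (A : Coeff d N m) (H : Rd d → Arr d N m)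
    (u : Rd d → Fin N → ℂ) : Prop :=
  ∀ φ : Rd d → Fin N → ℂ, ContDiff ℝ ∞ φ → HasCompactSupport φ → tsupport φ ⊆ Ω →
    energy Ω A φ u = pairing Ω φ H

/-- The Neumann boundary values of a solution `u` of `L u = div_m H`, that is, the linear functional
`φ ↦ ⟨∇^m φ, A ∇^m u - H⟩_Ω` on smooth compactly supported functions in `ℝ^d`, vanish. -/
def NeumannZero (Ω : Set (Rd d)) (A : Coeff d N m) (H : Rd d → Arr d N m)
    (u : Rd d → Fin N → ℂ) : Prop :=
  ∀ φ : Rd d → Fin N → ℂ, ContDiff ℝ ∞ φ → HasCompactSupport φ →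
    ∫ x in Ω, inner ℂ (mgrad m φ x)
      (Matrix.toEuclideanCLM (𝕜 := ℂ) (A x) (weakGrad m Ω u x) - H x) = 0

/-! ### Boundary value problems -/

/-- The two kinds of boundary value problems. -/
inductive BVP where
  | dirichlet
  | neumann

/-- The homogeneous boundary condition: `Tr_{m-1} u = 0`, respectively `M_{A,H} u = 0`. -/
def ZeroBoundary (b : BVP) (Ω : Set (Rd d)) (A : Coeff d N m) (H : Rd d → Arr d N m)
    (u : Rd d → Fin N → ℂ) : Prop :=
  match b with
  | BVP.dirichlet => DirichletZero m Ω u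
  | BVP.neumann => NeumannZero Ω A H u

/-- `u ∈ Ẇ^{p,s}_{m,av}(Ω)`, `L u = div_m H` in `Ω`, and `u` has zero boundary values. -/
def Solves (b : BVP) (Ω : Set (Rd d)) (A : Coeff d N m) (p : ℝ≥0∞) (s : ℝ)
    (H : Rd d → Arr d N m) (u : Rd d → Fin N → ℂ) : Prop :=
  MemWav m p s Ω u ∧ WeakEq Ω A H u ∧ ZeroBoundary b Ω A H u

/-- The bound `‖u‖ ≤ C ‖H‖`, in `Ẇ^{p,s}_{m,av}(Ω)` and `L^{p,s}_av(Ω)`. -/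
def NormBound (Ω : Set (Rd d)) (p : ℝ≥0∞) (s C : ℝ) (H : Rd d → Arr d N m)
    (u : Rd d → Fin N → ℂ) : Prop :=
  WavNorm m p s Ω u ≤ ENNReal.ofReal C * LavNorm p s Ω H

/-- For every `H ∈ L^{p,s}_av(Ω)` there is a solution that satisfies the bound with constant `C`. -/
def Solvable (b : BVP) (Ω : Set (Rd d)) (A : Coeff d N m) (p : ℝ≥0∞) (s C : ℝ) : Prop :=
  ∀ H : Rd d → Arr d N m, MemLav p s Ω H →
    ∃ u : Rd d → Fin N → ℂ, Solves b Ω A p s H u ∧ NormBound Ω p s C H u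

/-- The problem is well posed: for every `H ∈ L^{p,s}_av(Ω)` there is exactly one solution in
`Ẇ^{p,s}_{m,av}(Ω)`, and it satisfies the bound with constant `C`. Two functions are the same
element of `Ẇ^{p,s}_{m,av}(Ω)` if their difference has norm zero, that is, if their gradients of
order `m` agree almost everywhere in `Ω`. -/
def WellPosed (b : BVP) (Ω : Set (Rd d)) (A : Coeff d N m) (p : ℝ≥0∞) (s C : ℝ) : Prop :=
  ∀ H : Rd d → Arr d N m, MemLav p s Ω H →
    (∃ u : Rd d → Fin N → ℂ, Solves b Ω A p s H u) ∧
    (∀ u : Rd d → Fin N → ℂ, Solves b Ω A p s H u → NormBound Ω p s C H u) ∧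
    ∀ u w : Rd d → Fin N → ℂ, Solves b Ω A p s H u → Solves b Ω A p s H w →
      weakGrad m Ω u =ᵐ[volume.restrict Ω] weakGrad m Ω w

/-- The problems for `(p₀, s₀)` and `(p₁, s₁)` are both well posed, and for data in the intersection
of the two data spaces there is a single function that solves both. -/
def CompatiblyWellPosed (b : BVP) (Ω : Set (Rd d)) (A : Coeff d N m)
    (p₀ : ℝ≥0∞) (s₀ C₀ : ℝ) (p₁ : ℝ≥0∞) (s₁ C₁ : ℝ) : Prop :=
  WellPosed b Ω A p₀ s₀ C₀ ∧ WellPosed b Ω A p₁ s₁ C₁ ∧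
    ∀ H : Rd d → Arr d N m, MemLav p₀ s₀ Ω H → MemLav p₁ s₁ Ω H →
      ∃ u : Rd d → Fin N → ℂ, Solves b Ω A p₀ s₀ H u ∧ Solves b Ω A p₁ s₁ H u

/-! ### Coefficients and constants -/

/-- The coefficients are Lebesgue measurable functions on `ℝ^d`. -/
def MeasurableCoeff (A : Coeff d N m) : Prop :=
  ∀ i j, AEMeasurable (fun x => A x i j) volume

/-- The norm `‖A‖_{L^∞(ℝ^d)}`, where `|A(x)|` is the operator norm on arrays. -/
def coeffNorm (A : Coeff d N m) : ℝ≥0∞ :=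
  essSup (fun x => ‖Matrix.toEuclideanCLM (𝕜 := ℂ) (A x)‖ₑ) volume

open Classical in
/-- The constant `c / (1 - c ε)` if `p ≥ 1`, and `(c^p / (1 - c^p ε^p))^{1/p}` if `p ≤ 1` (the two
agree for `p = 1`). -/
def perturbConst (c : ℝ) (p : ℝ≥0∞) (ε : ℝ) : ℝ :=
  if 1 ≤ p then c / (1 - c * ε)
  else (c ^ p.toReal / (1 - c ^ p.toReal * ε ^ p.toReal)) ^ (1 / p.toReal)

end EllipticBVP

end

open EllipticBVP

/-!
The solution for `B` is a Neumann series. Let `u 0` solve the problem for `A` with data `H`, and let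
`u (n + 1)` solve the problem for `A` with data `(A - B) ∇^m (u n)`. The norms of `u n` decay like
`(C ε) ^ n`, and the residuals telescope, so the sum of the series solves the problem for `B`
(`exists_solves_perturbed`). The triangle inequality, or the `p`-triangle inequality if `p ≤ 1`,
gives the constant `perturbConst` (`LavNorm_le_perturbConst`). The argument is carried out for a
family of pairs `(p i, s i)` at the same time; one pair gives part (1), two pairs give part (2), where
compatible well posedness is what allows each `u n` to be chosen in both spaces.

What has to be proved is that the sum exists, is a weak solution, and has zero boundary values.

* A series of arrays that converges absolutely in `L^{p,s}_av(Ω)` converges absolutely in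
  `L^1(Ω ∩ B(0, R))` for every `R` (`exists_lintegral_le_LavNorm`). For `p > 1` this is Hölder's
  inequality and the integrability of the powers `bdist ^ (-a)`, `a < 1`, near the boundary of a
  Lipschitz domain. For `p ≤ 1` the quasinorm bounds the averages over Whitney balls pointwise, and
  the lower bound on `p` is what makes the remaining power of the distance nonnegative. This
  embedding lets all pairings with test functions, including those that do not vanish on the boundary,
  be summed term by term.
* A locally convergent series of gradients is the gradient of a function (`exists_weakDeriv_eq_tsum`).
  By the Poincaré inequality on balls (`poincare_ball`) and connectedness, the functions `u n` form
  locally convergent series after subtraction of polynomials of degree less than `m`; the sums are the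
  required function.
* Under Dirichlet conditions the derivatives of order `m - 1` must not be changed. By a Poincaré
  inequality near the boundary (`IsGraphChart.lintegral_le_boundary`), functions with zero trace are
  controlled by their gradients, so these derivatives converge without correction
  (`IsLipschitzDomain.ballSummable_of_hasTrace`), and only polynomials of degree less than `m - 1` are
  subtracted. Zero traces are stable under such limits (`HasTrace.tsum`).
-/

noncomputable section

namespace EllipticBVP

variable {d N m : ℕ}

/-! ### Iterated derivatives of smooth functions -/

lemma contDiff_pderiv (i : Fin d) {f : Rd d → ℂ} (hf : ContDiff ℝ ∞ f) :
    ContDiff ℝ ∞ (pderiv i f) := by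
  have h : ContDiff ℝ ∞ (fderiv ℝ f) := hf.fderiv_right (by simp)
  exact h.clm_apply contDiff_const

lemma pderiv_comm (i j : Fin d) {f : Rd d → ℂ} (hf : ContDiff ℝ ∞ f) :
    pderiv i (pderiv j f) = pderiv j (pderiv i f) := by
  ext x
  have h : ContDiff ℝ ∞ (fderiv ℝ f) := hf.fderiv_right (by simp)
  have hd : DifferentiableAt ℝ (fderiv ℝ f) x := (h.differentiable (by simp)).differentiableAt
  have hs : IsSymmSndFDerivAt ℝ f x :=
    hf.contDiffAt.isSymmSndFDerivAt (by simpa using ENat.LEInfty.out)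
  have key : ∀ v w : Rd d, fderiv ℝ (fun y => fderiv ℝ f y v) x w = fderiv ℝ (fderiv ℝ f) x w v := by
    intro v w
    rw [fderiv_clm_apply hd (differentiableAt_const v)]
    simp
  exact (key _ _).trans ((hs _ _).trans (key _ _).symm)

lemma contDiff_pderiv_iterate (i : Fin d) (a : ℕ) {f : Rd d → ℂ} (hf : ContDiff ℝ ∞ f) :
    ContDiff ℝ ∞ ((pderiv i)^[a] f) := by
  induction a with
  | zero => exact hf
  | succ a ih => rw [Function.iterate_succ_apply']; exact contDiff_pderiv i ih

lemma pderiv_iterate_comm (i j : Fin d) (a : ℕ) {f : Rd d → ℂ} (hf : ContDiff ℝ ∞ f) :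
    (pderiv i)^[a] (pderiv j f) = pderiv j ((pderiv i)^[a] f) := by
  induction a with
  | zero => rfl
  | succ a ih =>
    rw [Function.iterate_succ_apply', Function.iterate_succ_apply', ih,
      pderiv_comm i j (contDiff_pderiv_iterate i a hf)]

lemma contDiff_foldr_pderiv (l : List (Fin d)) (α : Fin d → ℕ) {f : Rd d → ℂ}
    (hf : ContDiff ℝ ∞ f) :
    ContDiff ℝ ∞ (l.foldr (fun i g => (pderiv i)^[α i] g) f) := by
  induction l with
  | nil => exact hf
  | cons i l ih => exact contDiff_pderiv_iterate i _ ih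

lemma foldr_pderiv_comm (l : List (Fin d)) (α : Fin d → ℕ) (j : Fin d) {f : Rd d → ℂ}
    (hf : ContDiff ℝ ∞ f) :
    l.foldr (fun i g => (pderiv i)^[α i] g) (pderiv j f) =
      pderiv j (l.foldr (fun i g => (pderiv i)^[α i] g) f) := by
  induction l with
  | nil => rfl
  | cons i l ih =>
    simp only [List.foldr_cons, ih]
    exact pderiv_iterate_comm i j _ (contDiff_foldr_pderiv l α hf)

lemma contDiff_mderiv (α : Fin d → ℕ) {f : Rd d → ℂ} (hf : ContDiff ℝ ∞ f) :
    ContDiff ℝ ∞ (mderiv α f) := contDiff_foldr_pderiv _ α hf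

lemma foldr_pderiv_congr (l : List (Fin d)) {α β : Fin d → ℕ} (h : ∀ i ∈ l, α i = β i)
    (f : Rd d → ℂ) :
    l.foldr (fun i g => (pderiv i)^[α i] g) f = l.foldr (fun i g => (pderiv i)^[β i] g) f := by
  induction l with
  | nil => rfl
  | cons i l ih =>
    simp only [List.foldr_cons]
    rw [ih fun j hj => h j (List.mem_cons_of_mem _ hj), h i List.mem_cons_self]

lemma foldr_pderiv_add_single (l : List (Fin d)) (hl : l.Nodup) (α : Fin d → ℕ) (j : Fin d)
    (hj : j ∈ l) {f : Rd d → ℂ} (hf : ContDiff ℝ ∞ f) :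
    l.foldr (fun i g => (pderiv i)^[(α + Pi.single j 1 : Fin d → ℕ) i] g) f =
      pderiv j (l.foldr (fun i g => (pderiv i)^[α i] g) f) := by
  induction l with
  | nil => simp at hj
  | cons i l ih =>
    rw [List.nodup_cons] at hl
    simp only [List.foldr_cons]
    by_cases hij : i = j
    · subst hij
      rw [foldr_pderiv_congr l (β := α)]
      · simp only [Pi.add_apply, Pi.single_eq_same]
        rw [Function.iterate_succ_apply']
      · intro k hk
        have : k ≠ i := fun h => hl.1 (h ▸ hk)
        simp [this]
    · have hjl : j ∈ l := by
        rcases List.mem_cons.1 hj with h | h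
        · exact absurd h.symm hij
        · exact h
      rw [ih hl.2 hjl]
      have : (α + Pi.single j 1 : Fin d → ℕ) i = α i := by simp [hij]
      rw [this, pderiv_iterate_comm i j _ (contDiff_foldr_pderiv l α hf)]

lemma mderiv_add_single (α : Fin d → ℕ) (j : Fin d) {f : Rd d → ℂ} (hf : ContDiff ℝ ∞ f) :
    mderiv (α + Pi.single j 1) f = pderiv j (mderiv α f) :=
  foldr_pderiv_add_single _ (List.nodup_finRange d) α j (List.mem_finRange j) hf

lemma mderiv_pderiv (α : Fin d → ℕ) (j : Fin d) {f : Rd d → ℂ} (hf : ContDiff ℝ ∞ f) :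
    mderiv α (pderiv j f) = mderiv (α + Pi.single j 1) f := by
  rw [mderiv_add_single α j hf]
  exact foldr_pderiv_comm _ α j hf

@[simp] lemma mderiv_zero (f : Rd d → ℂ) : mderiv 0 f = f := by
  unfold mderiv
  induction List.finRange d with
  | nil => rfl
  | cons i l ih => simp only [List.foldr_cons, ih]; rfl

lemma mderiv_single (j : Fin d) {f : Rd d → ℂ} (hf : ContDiff ℝ ∞ f) :
    mderiv (Pi.single j 1) f = pderiv j f := by
  have := mderiv_add_single 0 j hf
  simpa using this

/-- A multiindex of positive length is of the form `β + e_j`. -/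
lemma exists_eq_add_single {n : ℕ} (α : Fin d → ℕ) (h : ∑ i, α i = n + 1) :
    ∃ (β : Fin d → ℕ) (j : Fin d), α = β + Pi.single j 1 ∧ ∑ i, β i = n := by
  obtain ⟨j, hj⟩ : ∃ j, α j ≠ 0 := by
    by_contra! hc
    simp [hc] at h
  have hα : α = (α - Pi.single j 1) + Pi.single j 1 := by
    ext i
    by_cases hij : i = j
    · subst hij; simp; omega
    · simp [hij]
  refine ⟨α - Pi.single j 1, j, hα, ?_⟩
  rw [hα] at h
  simp only [Pi.add_apply, Finset.sum_add_distrib, Finset.sum_pi_single', Finset.mem_univ,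
    if_true] at h
  omega

lemma sum_add_single (α : Fin d → ℕ) (j : Fin d) :
    ∑ i, (α + Pi.single j 1 : Fin d → ℕ) i = ∑ i, α i + 1 := by
  simp [Finset.sum_add_distrib]

/-- Induction on multiindices, adding one unit vector at a time. -/
lemma multiindex_induction {P : (Fin d → ℕ) → Prop} (h0 : P 0)
    (h1 : ∀ α j, P α → P (α + Pi.single j 1)) (α : Fin d → ℕ) : P α := by
  obtain ⟨n, hn⟩ : ∃ n, ∑ i, α i = n := ⟨_, rfl⟩
  induction n generalizing α with
  | zero =>
    have : α = 0 := by
      ext i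
      simpa using (Finset.sum_eq_zero_iff.1 hn) i (Finset.mem_univ i)
    rwa [this]
  | succ n ih =>
    obtain ⟨β, j, rfl, hβ⟩ := exists_eq_add_single α hn
    exact h1 _ _ (ih β hβ)

lemma tsupport_pderiv_subset (i : Fin d) (f : Rd d → ℂ) :
    tsupport (pderiv i f) ⊆ tsupport f := by
  refine closure_minimal ?_ (isClosed_tsupport f)
  intro x hx
  by_contra hc
  apply hx
  have : fderiv ℝ f x = 0 := by
    by_contra h
    exact hc (support_fderiv_subset ℝ h)
  simp [pderiv, this]

lemma tsupport_mderiv_subset (α : Fin d → ℕ) {f : Rd d → ℂ} (hf : ContDiff ℝ ∞ f) :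
    tsupport (mderiv α f) ⊆ tsupport f := by
  induction α using multiindex_induction with
  | h0 => simp
  | h1 α j ih =>
    rw [mderiv_add_single α j hf]
    exact (tsupport_pderiv_subset j _).trans ih

lemma hasCompactSupport_mderiv (α : Fin d → ℕ) {f : Rd d → ℂ} (hf : ContDiff ℝ ∞ f)
    (hc : HasCompactSupport f) : HasCompactSupport (mderiv α f) :=
  hc.of_isClosed_subset (isClosed_tsupport _) (tsupport_mderiv_subset α hf)

lemma pderiv_add (i : Fin d) {f g : Rd d → ℂ} (hf : ContDiff ℝ ∞ f) (hg : ContDiff ℝ ∞ g) :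
    pderiv i (f + g) = pderiv i f + pderiv i g := by
  ext x
  simp only [pderiv, Pi.add_apply]
  rw [fderiv_add (hf.differentiable (by simp)).differentiableAt
    (hg.differentiable (by simp)).differentiableAt]
  rfl

lemma pderiv_const_mul (i : Fin d) (c : ℂ) {f : Rd d → ℂ} (hf : ContDiff ℝ ∞ f) :
    pderiv i (fun x => c * f x) = fun x => c * pderiv i f x := by
  ext x
  simp only [pderiv]
  rw [fderiv_const_mul (hf.differentiable (by simp)).differentiableAt]
  rfl

lemma mderiv_add (α : Fin d → ℕ) {f g : Rd d → ℂ} (hf : ContDiff ℝ ∞ f) (hg : ContDiff ℝ ∞ g) :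
    mderiv α (f + g) = mderiv α f + mderiv α g := by
  induction α using multiindex_induction with
  | h0 => simp
  | h1 α j ih =>
    rw [mderiv_add_single α j hf, mderiv_add_single α j hg, mderiv_add_single α j (f := f + g) (hf.add hg), ih,
      pderiv_add j (contDiff_mderiv α hf) (contDiff_mderiv α hg)]

lemma mderiv_const_mul (α : Fin d → ℕ) (c : ℂ) {f : Rd d → ℂ} (hf : ContDiff ℝ ∞ f) :
    mderiv α (fun x => c * f x) = fun x => c * mderiv α f x := by
  induction α using multiindex_induction with
  | h0 => simp
  | h1 α j ih =>
    rw [mderiv_add_single α j hf, mderiv_add_single α j (contDiff_const.mul hf), ih,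
      pderiv_const_mul j c (contDiff_mderiv α hf)]

/-- The monomial `x^γ / γ!`. -/
def monom (γ : Fin d → ℕ) (x : Rd d) : ℂ := ∏ j, ((x j : ℂ) ^ γ j / (γ j).factorial)

lemma contDiff_coord (j : Fin d) : ContDiff ℝ ∞ (fun x : Rd d => (x j : ℂ)) :=
  Complex.ofRealCLM.contDiff.comp
    ((EuclideanSpace.proj j : Rd d →L[ℝ] ℝ).contDiff)

lemma contDiff_monom (γ : Fin d → ℕ) : ContDiff ℝ ∞ (monom γ) := by
  unfold monom
  refine contDiff_prod fun j _ => ?_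
  exact ((contDiff_coord j).pow _).div_const _

lemma pderiv_monom (i : Fin d) (γ : Fin d → ℕ) :
    pderiv i (monom γ) = if γ i = 0 then 0 else monom (γ - Pi.single i 1) := by
  ext x
  have hd : DifferentiableAt ℝ (monom γ) x :=
    ((contDiff_monom γ).differentiable (by simp)).differentiableAt
  have h1 : pderiv i (monom γ) x =
      deriv (fun t : ℝ => monom γ (x + t • EuclideanSpace.single i 1)) 0 := by
    rw [pderiv, ← hd.lineDeriv_eq_fderiv]
    rfl
  have h2 : ∀ (γ : Fin d → ℕ) (t : ℝ), monom γ (x + t • EuclideanSpace.single i 1) =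
      ((x i : ℂ) + t) ^ γ i / (γ i).factorial *
        ∏ j ∈ Finset.univ.erase i, ((x j : ℂ) ^ γ j / (γ j).factorial) := by
    intro γ t
    unfold monom
    rw [← Finset.mul_prod_erase Finset.univ _ (Finset.mem_univ i)]
    congr 1
    · simp
    · refine Finset.prod_congr rfl fun j hj => ?_
      simp [(Finset.mem_erase.1 hj).1]
  have h3 : HasDerivAt (fun t : ℝ => monom γ (x + t • EuclideanSpace.single i 1))
      ((γ i : ℂ) * (x i : ℂ) ^ (γ i - 1) / (γ i).factorial *
        ∏ j ∈ Finset.univ.erase i, ((x j : ℂ) ^ γ j / (γ j).factorial)) 0 := by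
    have ht : HasDerivAt (fun t : ℝ => (x i : ℂ) + (t : ℂ)) 1 0 := by
      simpa using (Complex.ofRealCLM.hasDerivAt (x := (0 : ℝ))).const_add (x i : ℂ)
    have hp := (((ht.pow (γ i)).div_const ((γ i).factorial : ℂ)).mul_const
      (∏ j ∈ Finset.univ.erase i, ((x j : ℂ) ^ γ j / (γ j).factorial)))
    simp only [Complex.ofReal_zero, add_zero, mul_one] at hp
    refine hp.congr_of_eventuallyEq (Eventually.of_forall fun t => ?_)
    simpa using h2 γ t
  rw [h1, h3.deriv]
  by_cases h0 : γ i = 0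
  · simp [h0]
  · rw [if_neg h0]
    have h4 := h2 (γ - Pi.single i 1) 0
    simp only [zero_smul, add_zero, Complex.ofReal_zero] at h4
    rw [h4]
    congr 1
    · obtain ⟨n, hn⟩ := Nat.exists_eq_succ_of_ne_zero h0
      simp only [Pi.sub_apply, Pi.single_eq_same, hn, Nat.succ_eq_add_one, Nat.add_sub_cancel,
        Nat.factorial_succ]
      have : ((n : ℂ) + 1) ≠ 0 := by exact_mod_cast Nat.succ_ne_zero n
      have h5 : (n.factorial : ℂ) ≠ 0 := by exact_mod_cast n.factorial_ne_zero
      push_cast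
      field_simp
    · refine Finset.prod_congr rfl fun j hj => ?_
      simp [(Finset.mem_erase.1 hj).1]

lemma mderiv_zero_fun (α : Fin d → ℕ) : mderiv α (0 : Rd d → ℂ) = 0 := by
  have := mderiv_const_mul α 0 (contDiff_const (c := (0 : ℂ)) : ContDiff ℝ ∞ fun _ : Rd d => (0 : ℂ))
  simp only [zero_mul] at this
  exact this

lemma mderiv_monom_of_lt {α γ : Fin d → ℕ} (h : ∑ i, γ i < ∑ i, α i) :
    mderiv α (monom γ) = 0 := by
  obtain ⟨n, hn⟩ : ∃ n, ∑ i, α i = n := ⟨_, rfl⟩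
  induction n generalizing α γ with
  | zero => omega
  | succ n ih =>
    obtain ⟨β, j, rfl, hβ⟩ := exists_eq_add_single α hn
    rw [← mderiv_pderiv β j (contDiff_monom γ), pderiv_monom]
    split_ifs with h0
    · exact mderiv_zero_fun β
    · obtain ⟨k, hk⟩ := Nat.exists_eq_succ_of_ne_zero h0
      have hγ : γ = (γ - Pi.single j 1) + Pi.single j 1 := by
        ext i
        by_cases hij : i = j
        · subst hij; simp; omega
        · simp [hij]
      have := sum_add_single (γ - Pi.single j 1) j
      rw [← hγ] at this
      refine ih ?_ hβ
      omega

lemma mderiv_monom_of_eq {α γ : Fin d → ℕ} (h : ∑ i, γ i = ∑ i, α i) (x : Rd d) :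
    mderiv α (monom γ) x = if α = γ then 1 else 0 := by
  obtain ⟨n, hn⟩ : ∃ n, ∑ i, α i = n := ⟨_, rfl⟩
  induction n generalizing α γ with
  | zero =>
    have key : ∀ β : Fin d → ℕ, ∑ i, β i = 0 → β = 0 := fun β hβ => by
      ext i
      simpa using (Finset.sum_eq_zero_iff.1 hβ) i (Finset.mem_univ i)
    rw [key α hn, key γ (by omega)]
    simp [monom]
  | succ n ih =>
    obtain ⟨β, j, rfl, hβ⟩ := exists_eq_add_single α hn
    rw [← mderiv_pderiv β j (contDiff_monom γ), pderiv_monom]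
    split_ifs with h0 h1 h1
    · have := congrFun h1 j
      simp [h0] at this
    · rw [mderiv_zero_fun]; rfl
    · subst h1
      rw [ih _ hβ, if_pos]
      · ext i; simp
      · simp
    · have hγ : γ = (γ - Pi.single j 1) + Pi.single j 1 := by
        ext i
        by_cases hij : i = j
        · subst hij; simp; omega
        · simp [hij]
      have := sum_add_single (γ - Pi.single j 1) j
      rw [← hγ] at this
      rw [ih (by omega) hβ, if_neg]
      intro hc
      exact h1 (by rw [hc]; exact hγ.symm)

/-! ### Weak derivatives -/

lemma integrable_mul_of_tsupport_subset {Ω : Set (Rd d)} {f φ : Rd d → ℂ}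
    (hf : LocallyIntegrableOn f Ω) (hφ : Continuous φ) (hc : HasCompactSupport φ)
    (hs : tsupport φ ⊆ Ω) : Integrable (fun x => f x * φ x) := by
  have h1 : IntegrableOn f (tsupport φ) := hf.integrableOn_compact_subset hs hc
  have h2 : IntegrableOn (fun x => f x * φ x) (tsupport φ) :=
    h1.mul_continuousOn hφ.continuousOn hc
  refine (integrableOn_iff_integrable_of_support_subset ?_).1 h2
  intro x hx
  by_contra hc'
  exact hx (by simp [image_eq_zero_of_notMem_tsupport hc'])

lemma IsWeakDeriv.integrable_left {Ω : Set (Rd d)} {α : Fin d → ℕ} {f g φ : Rd d → ℂ}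
    (h : IsWeakDeriv Ω α f g) (hφ : ContDiff ℝ ∞ φ) (hc : HasCompactSupport φ)
    (hs : tsupport φ ⊆ Ω) (β : Fin d → ℕ) : Integrable (fun x => f x * mderiv β φ x) :=
  integrable_mul_of_tsupport_subset h.1 (contDiff_mderiv β hφ).continuous
    (hasCompactSupport_mderiv β hφ hc) ((tsupport_mderiv_subset β hφ).trans hs)

lemma IsWeakDeriv.integrable_right {Ω : Set (Rd d)} {α : Fin d → ℕ} {f g φ : Rd d → ℂ}
    (h : IsWeakDeriv Ω α f g) (hφ : ContDiff ℝ ∞ φ) (hc : HasCompactSupport φ)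
    (hs : tsupport φ ⊆ Ω) : Integrable (fun x => g x * φ x) :=
  integrable_mul_of_tsupport_subset h.2.1 hφ.continuous hc hs

lemma setIntegral_mul_of_tsupport_subset {Ω : Set (Rd d)} {f φ : Rd d → ℂ}
    (hs : tsupport φ ⊆ Ω) : ∫ x in Ω, f x * φ x = ∫ x, f x * φ x := by
  refine setIntegral_eq_integral_of_forall_compl_eq_zero fun x hx => ?_
  rw [image_eq_zero_of_notMem_tsupport fun h => hx (hs h), mul_zero]

lemma isWeakDeriv_weakDeriv {Ω : Set (Rd d)} {α : Fin d → ℕ} {f : Rd d → ℂ}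
    (h : ∃ g, IsWeakDeriv Ω α f g) : IsWeakDeriv Ω α f (weakDeriv Ω α f) := by
  unfold weakDeriv
  rw [dif_pos h]
  exact h.choose_spec

lemma IsWeakDeriv.congr_left {Ω : Set (Rd d)} {α : Fin d → ℕ} {f f' g : Rd d → ℂ}
    (h : IsWeakDeriv Ω α f g) (hf : f =ᵐ[volume.restrict Ω] f') : IsWeakDeriv Ω α f' g := by
  refine ⟨h.1.congr hf, h.2.1, fun φ h1 h2 h3 => ?_⟩
  rw [← h.2.2 φ h1 h2 h3]
  refine integral_congr_ae ?_
  filter_upwards [hf] with x hx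
  rw [hx]

/-- Weak derivatives are unique almost everywhere. -/
lemma IsWeakDeriv.ae_eq {Ω : Set (Rd d)} (hΩ : IsOpen Ω) {α : Fin d → ℕ} {f g g' : Rd d → ℂ}
    (h : IsWeakDeriv Ω α f g) (h' : IsWeakDeriv Ω α f g') : g =ᵐ[volume.restrict Ω] g' := by
  have key := hΩ.ae_eq_zero_of_integral_contDiff_smul_eq_zero (μ := volume)
    (f := fun x => g x - g' x) (h.2.1.sub h'.2.1) ?_
  · refine (ae_restrict_iff' hΩ.measurableSet).2 ?_
    filter_upwards [key] with x hx hxΩ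
    exact sub_eq_zero.1 (hx hxΩ)
  · intro φ hφ hc hs
    have hts : tsupport (fun x => (φ x : ℂ)) = tsupport φ := by
      unfold tsupport
      congr 1
      ext x; simp
    have hφ' : ContDiff ℝ ∞ (fun x => (φ x : ℂ)) := Complex.ofRealCLM.contDiff.comp hφ
    have hc' : HasCompactSupport (fun x => (φ x : ℂ)) := by
      unfold HasCompactSupport; rw [hts]; exact hc
    have e1 := h.2.2 _ hφ' hc' (hts ▸ hs)
    have e2 := h'.2.2 _ hφ' hc' (hts ▸ hs)
    rw [e1] at e2
    have e3 := mul_left_cancel₀ (pow_ne_zero _ (by norm_num)) e2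
    rw [setIntegral_mul_of_tsupport_subset (hts ▸ hs),
      setIntegral_mul_of_tsupport_subset (hts ▸ hs)] at e3
    have e4 := integral_sub (h.integrable_right hφ' hc' (hts ▸ hs))
      (h'.integrable_right hφ' hc' (hts ▸ hs))
    rw [e3, sub_self] at e4
    rw [← e4]
    refine integral_congr_ae (Eventually.of_forall fun x => ?_)
    simp only [Complex.real_smul]
    ring

lemma IsWeakDeriv.weakDeriv_ae_eq {Ω : Set (Rd d)} (hΩ : IsOpen Ω) {α : Fin d → ℕ}
    {f g : Rd d → ℂ} (h : IsWeakDeriv Ω α f g) : weakDeriv Ω α f =ᵐ[volume.restrict Ω] g :=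
  (isWeakDeriv_weakDeriv ⟨g, h⟩).ae_eq hΩ h

lemma IsWeakDeriv.sub {Ω : Set (Rd d)} {α : Fin d → ℕ} {f f' g g' : Rd d → ℂ}
    (h : IsWeakDeriv Ω α f g) (h' : IsWeakDeriv Ω α f' g') :
    IsWeakDeriv Ω α (fun x => f x - f' x) (fun x => g x - g' x) := by
  refine ⟨h.1.sub h'.1, h.2.1.sub h'.2.1, fun φ h1 h2 h3 => ?_⟩
  simp only [sub_mul]
  rw [integral_sub (h.integrable_left h1 h2 h3 α).integrableOn
    (h'.integrable_left h1 h2 h3 α).integrableOn,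
    integral_sub (h.integrable_right h1 h2 h3).integrableOn
    (h'.integrable_right h1 h2 h3).integrableOn, h.2.2 φ h1 h2 h3, h'.2.2 φ h1 h2 h3, mul_sub]

/-- If `h = ∂^γ u` and `g = ∂^{γ + e_i} u`, then `g = ∂_i h`. -/
lemma IsWeakDeriv.single_of_add_single {Ω : Set (Rd d)} {γ : Fin d → ℕ} {i : Fin d}
    {u h g : Rd d → ℂ} (hh : IsWeakDeriv Ω γ u h) (hg : IsWeakDeriv Ω (γ + Pi.single i 1) u g) :
    IsWeakDeriv Ω (Pi.single i 1) h g := by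
  refine ⟨hh.2.1, hg.2.1, fun φ h1 h2 h3 => ?_⟩
  have e1 := hg.2.2 φ h1 h2 h3
  have e2 := hh.2.2 (pderiv i φ) (contDiff_pderiv i h1)
    (h2.of_isClosed_subset (isClosed_tsupport _) (tsupport_pderiv_subset i φ))
    ((tsupport_pderiv_subset i φ).trans h3)
  rw [mderiv_pderiv γ i h1, e1, sum_add_single, pow_succ, mul_assoc] at e2
  have e3 := mul_left_cancel₀ (pow_ne_zero _ (by norm_num)) e2
  rw [mderiv_single i h1, ← e3]
  simp

lemma integral_mul_mderiv {f φ : Rd d → ℂ} (hf : ContDiff ℝ ∞ f) (hφ : ContDiff ℝ ∞ φ)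
    (hc : HasCompactSupport φ) (α : Fin d → ℕ) :
    ∫ x, f x * mderiv α φ x = (-1) ^ (∑ i, α i) * ∫ x, mderiv α f x * φ x := by
  induction α using multiindex_induction generalizing f with
  | h0 => simp
  | h1 α j ih =>
    have hφα := contDiff_mderiv α hφ
    have hcα := hasCompactSupport_mderiv α hφ hc
    have e1 : ∫ x, f x * pderiv j (mderiv α φ) x = - ∫ x, pderiv j f x * mderiv α φ x := by
      refine integral_mul_fderiv_eq_neg_fderiv_mul_of_integrable ?_ ?_ ?_ ?_ ?_
      · exact ((contDiff_pderiv j hf).continuous.mul hφα.continuous).integrable_of_hasCompactSupport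
          hcα.mul_left
      · refine (hf.continuous.mul (contDiff_pderiv j hφα).continuous).integrable_of_hasCompactSupport
          (HasCompactSupport.mul_left ?_)
        exact hcα.of_isClosed_subset (isClosed_tsupport _) (tsupport_pderiv_subset j _)
      · exact (hf.continuous.mul hφα.continuous).integrable_of_hasCompactSupport hcα.mul_left
      · exact fun x _ => (hf.differentiable (by simp)).differentiableAt
      · exact fun x _ => (hφα.differentiable (by simp)).differentiableAt
    rw [mderiv_add_single α j hφ, e1, ih (contDiff_pderiv j hf), mderiv_pderiv α j hf,
      sum_add_single, pow_succ]
    ring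

lemma isWeakDeriv_mderiv {Ω : Set (Rd d)} (α : Fin d → ℕ) {f : Rd d → ℂ} (hf : ContDiff ℝ ∞ f) :
    IsWeakDeriv Ω α f (mderiv α f) := by
  refine ⟨hf.continuous.locallyIntegrable.locallyIntegrableOn Ω,
    (contDiff_mderiv α hf).continuous.locallyIntegrable.locallyIntegrableOn Ω,
    fun φ h1 h2 h3 => ?_⟩
  rw [setIntegral_mul_of_tsupport_subset h3, setIntegral_mul_of_tsupport_subset
    ((tsupport_mderiv_subset α h1).trans h3), integral_mul_mderiv hf h1 h2]

lemma isWeakDeriv_zero {Ω : Set (Rd d)} {f : Rd d → ℂ} (hf : LocallyIntegrableOn f Ω) :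
    IsWeakDeriv Ω 0 f f :=
  ⟨hf, hf, fun φ _ _ _ => by simp⟩

/-! ### Locally summable series of functions -/

/-- The series `∑ f n` converges absolutely in `L^1_loc(Ω)`. Finiteness is required on a neighborhood of
each point of `Ω`, which amounts to finiteness on each compact subset of `Ω`. -/
structure LocSummable (Ω : Set (Rd d)) (f : ℕ → Rd d → ℂ) : Prop where
  meas : ∀ n, AEStronglyMeasurable (f n) (volume.restrict Ω)
  bound : ∀ x ∈ Ω, ∃ ρ > 0, ∑' n, ∫⁻ y in Ω ∩ Metric.ball x ρ, ‖f n y‖ₑ ≠ ⊤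

lemma lintegral_union_le' {μ : Measure (Rd d)} (f : Rd d → ℝ≥0∞) (s t : Set (Rd d)) :
    ∫⁻ x in s ∪ t, f x ∂μ ≤ ∫⁻ x in s, f x ∂μ + ∫⁻ x in t, f x ∂μ :=
  (lintegral_mono' (Measure.restrict_union_le s t) le_rfl).trans (lintegral_add_measure _ _ _).le

/-- Local finiteness of a sum of integrals near each point of a compact set implies finiteness on the
compact set. -/
lemma tsum_lintegral_ne_top_of_isCompact {ι : Type*} {Ω K : Set (Rd d)} {f : ι → Rd d → ℝ≥0∞}
    (hK : IsCompact K)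
    (h : ∀ x ∈ K, ∃ ρ > 0, ∑' n, ∫⁻ y in Ω ∩ Metric.ball x ρ, f n y ≠ ⊤) :
    ∑' n, ∫⁻ y in Ω ∩ K, f n y ≠ ⊤ := by
  refine hK.induction_on (p := fun s => ∑' n, ∫⁻ y in Ω ∩ s, f n y ≠ ⊤) (by simp) ?_ ?_ ?_
  · intro s t hst ht
    refine ne_top_of_le_ne_top ht (ENNReal.tsum_le_tsum fun n => ?_)
    exact lintegral_mono_set (inter_subset_inter_right _ hst)
  · intro s t hs ht
    refine ne_top_of_le_ne_top (ENNReal.add_ne_top.2 ⟨hs, ht⟩) ?_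
    rw [← ENNReal.tsum_add]
    refine ENNReal.tsum_le_tsum fun n => ?_
    rw [inter_union_distrib_left]
    exact lintegral_union_le' _ _ _
  · intro x hx
    obtain ⟨ρ, hρ, hb⟩ := h x hx
    exact ⟨Metric.ball x ρ, mem_nhdsWithin_of_mem_nhds (Metric.ball_mem_nhds x hρ), hb⟩

lemma LocSummable.compact {Ω K : Set (Rd d)} {f : ℕ → Rd d → ℂ} (h : LocSummable Ω f)
    (hK : IsCompact K) (hKΩ : K ⊆ Ω) : ∑' n, ∫⁻ y in K, ‖f n y‖ₑ ≠ ⊤ := by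
  have := tsum_lintegral_ne_top_of_isCompact (Ω := Ω) (f := fun n y => ‖f n y‖ₑ) hK
    fun x hx => h.bound x (hKΩ hx)
  rwa [inter_eq_self_of_subset_right hKΩ] at this

lemma LocSummable.congr {Ω : Set (Rd d)} {f g : ℕ → Rd d → ℂ} (h : LocSummable Ω f)
    (hfg : ∀ n, f n =ᵐ[volume.restrict Ω] g n) : LocSummable Ω g := by
  refine ⟨fun n => (h.meas n).congr (hfg n), fun x hx => ?_⟩
  obtain ⟨ρ, hρ, hb⟩ := h.bound x hx
  refine ⟨ρ, hρ, ?_⟩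
  convert hb using 3 with n
  refine lintegral_congr_ae ?_
  filter_upwards [ae_mono (Measure.restrict_mono inter_subset_left le_rfl) (hfg n)] with y hy
  rw [hy]

lemma aestronglyMeasurable_tsum {μ : Measure (Rd d)} {f : ℕ → Rd d → ℂ}
    (h : ∀ n, AEStronglyMeasurable (f n) μ) : AEStronglyMeasurable (fun x => ∑' n, f n x) μ :=
  (AEMeasurable.tsum fun n => (h n).aemeasurable).aestronglyMeasurable

lemma LocSummable.locallyIntegrableOn {Ω : Set (Rd d)} {f : ℕ → Rd d → ℂ}
    (h : LocSummable Ω f) : LocallyIntegrableOn (fun x => ∑' n, f n x) Ω := by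
  intro x hx
  obtain ⟨ρ, hρ, hb⟩ := h.bound x hx
  refine ⟨Ω ∩ Metric.ball x ρ, inter_mem self_mem_nhdsWithin
    (mem_nhdsWithin_of_mem_nhds (Metric.ball_mem_nhds x hρ)), ?_, ?_⟩
  · exact (aestronglyMeasurable_tsum h.meas).mono_measure
      (Measure.restrict_mono inter_subset_left le_rfl)
  · refine lt_of_le_of_lt (lintegral_mono fun y => enorm_tsum_le_tsum_enorm) ?_
    rw [lintegral_tsum]
    · exact hb.lt_top
    · exact fun n => ((h.meas n).mono_measure
        (Measure.restrict_mono inter_subset_left le_rfl)).enorm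

lemma LocSummable.integral_tsum_mul {Ω : Set (Rd d)} {f : ℕ → Rd d → ℂ}
    (h : LocSummable Ω f) {φ : Rd d → ℂ} (hφ : Continuous φ) (hc : HasCompactSupport φ)
    (hs : tsupport φ ⊆ Ω) :
    ∫ x in Ω, (∑' n, f n x) * φ x = ∑' n, ∫ x in Ω, f n x * φ x := by
  simp_rw [← tsum_mul_right]
  refine integral_tsum (fun n => (h.meas n).mul hφ.aestronglyMeasurable) ?_
  obtain ⟨C, hC⟩ := hc.exists_bound_of_continuous hφ
  have hK := h.compact hc hs
  have hle : ∀ n, ∫⁻ x in Ω, ‖f n x * φ x‖ₑ ≤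
      ENNReal.ofReal C * ∫⁻ y in tsupport φ, ‖f n y‖ₑ := by
    intro n
    rw [← lintegral_const_mul' _ _ ENNReal.ofReal_ne_top]
    have : ∫⁻ x in Ω, ‖f n x * φ x‖ₑ = ∫⁻ x in tsupport φ, ‖f n x * φ x‖ₑ := by
      have e : Ω = tsupport φ ∪ (Ω \ tsupport φ) := by rw [union_sdiff_cancel hs]
      refine le_antisymm ?_ (lintegral_mono_set hs)
      conv_lhs => rw [e]
      refine (lintegral_union_le' _ _ _).trans ?_
      have : ∫⁻ x in Ω \ tsupport φ, ‖f n x * φ x‖ₑ ≤ ∫⁻ x in (tsupport φ)ᶜ, ‖f n x * φ x‖ₑ :=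
        lintegral_mono_set fun x hx => hx.2
      have h0 : ∫⁻ x in (tsupport φ)ᶜ, ‖f n x * φ x‖ₑ = 0 := by
        rw [setLIntegral_congr_fun (g := fun _ => 0) hc.isClosed.measurableSet.compl]
        · simp
        · intro x hx
          simp [image_eq_zero_of_notMem_tsupport hx]
      rw [le_antisymm (this.trans h0.le) bot_le]
      simp
    rw [this]
    refine lintegral_mono fun x => ?_
    rw [enorm_mul, mul_comm]
    gcongr
    rw [← ofReal_norm]
    exact ENNReal.ofReal_le_ofReal (hC x)
  refine ne_top_of_le_ne_top ?_ (ENNReal.tsum_le_tsum hle)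
  rw [ENNReal.tsum_mul_left]
  exact ENNReal.mul_ne_top ENNReal.ofReal_ne_top hK

/-- Weak derivatives may be taken term by term in series that converge in `L^1_loc(Ω)` together with
the series of derivatives. -/
lemma IsWeakDeriv.tsum {Ω : Set (Rd d)} {α : Fin d → ℕ} {f g : ℕ → Rd d → ℂ}
    (h : ∀ n, IsWeakDeriv Ω α (f n) (g n)) (hf : LocSummable Ω f) (hg : LocSummable Ω g) :
    IsWeakDeriv Ω α (fun x => ∑' n, f n x) (fun x => ∑' n, g n x) := by
  refine ⟨hf.locallyIntegrableOn, hg.locallyIntegrableOn, fun φ h1 h2 h3 => ?_⟩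
  rw [hf.integral_tsum_mul (contDiff_mderiv α h1).continuous (hasCompactSupport_mderiv α h1 h2)
    ((tsupport_mderiv_subset α h1).trans h3), hg.integral_tsum_mul h1.continuous h2 h3,
    ← tsum_mul_left]
  exact tsum_congr fun n => (h n).2.2 φ h1 h2 h3

/-! ### A Poincaré inequality on balls -/

lemma fderiv_apply_enorm_le (f : Rd d → ℂ) (x v : Rd d) :
    ‖fderiv ℝ f x v‖ₑ ≤ ‖v‖ₑ * ∑ i, ‖pderiv i f x‖ₑ := by
  have hv : v = ∑ i, v i • EuclideanSpace.single i (1 : ℝ) := by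
    ext j
    simp [Pi.single_apply]
  have h1 : fderiv ℝ f x v = ∑ i, v i • pderiv i f x := by
    conv_lhs => rw [hv]
    simp [pderiv]
  rw [h1, Finset.mul_sum]
  refine (enorm_sum_le _ _).trans (Finset.sum_le_sum fun i _ => ?_)
  rw [enorm_smul]
  gcongr
  rw [← ofReal_norm, ← ofReal_norm]
  exact ENNReal.ofReal_le_ofReal (PiLp.norm_apply_le v i)

lemma continuous_sum_enorm_pderiv {f : Rd d → ℂ} (hf : ContDiff ℝ ∞ f) :
    Continuous (fun x => ∑ i, ‖pderiv i f x‖ₑ) :=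
  continuous_finsetSum _ fun i _ => (contDiff_pderiv i hf).continuous.enorm

/-- The increment of a smooth function along a segment is controlled by its gradient there. -/
lemma enorm_add_sub_le {f : Rd d → ℂ} (hf : ContDiff ℝ ∞ f) (x v : Rd d) :
    ‖f (x + v) - f x‖ₑ ≤ ‖v‖ₑ * ∫⁻ t in Ioc (0 : ℝ) 1, ∑ i, ‖pderiv i f (x + t • v)‖ₑ := by
  have hd : ∀ t : ℝ, HasDerivAt (fun t : ℝ => f (x + t • v)) (fderiv ℝ f (x + t • v) v) t := by
    intro t
    have h1 : HasDerivAt (fun t : ℝ => x + t • v) v t := by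
      simpa using ((hasDerivAt_id t).smul_const v).const_add x
    exact ((hf.differentiable (by simp)).differentiableAt.hasFDerivAt).comp_hasDerivAt t h1
  have hc : Continuous fun t : ℝ => fderiv ℝ f (x + t • v) v := by
    have : Continuous (fderiv ℝ f) := (hf.fderiv_right (m := ∞) (by simp)).continuous
    fun_prop
  have h2 := intervalIntegral.integral_eq_sub_of_hasDerivAt (a := 0) (b := 1)
    (fun t _ => hd t) (hc.intervalIntegrable 0 1)
  simp only [one_smul, zero_smul, add_zero] at h2
  rw [← h2, intervalIntegral.integral_of_le zero_le_one]
  refine (enorm_integral_le_lintegral_enorm _).trans ?_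
  rw [← lintegral_const_mul']
  · exact lintegral_mono fun t => fderiv_apply_enorm_le _ _ _
  · exact enorm_ne_top

/-- The constant `2 r |B(0, 2 r)|` in the Poincaré inequality on balls of radius `r`. -/
def poincareConst (d : ℕ) (r : ℝ) : ℝ≥0∞ :=
  ENNReal.ofReal (2 * r) * volume (Metric.ball (0 : Rd d) (2 * r))

lemma poincareConst_ne_top (r : ℝ) : poincareConst d r ≠ ⊤ :=
  ENNReal.mul_ne_top ENNReal.ofReal_ne_top measure_ball_lt_top.ne

/-- The Poincaré inequality for smooth functions: integrate the bound along segments, and substitute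
`y = x + h` in order to apply Tonelli's theorem. -/
lemma poincare_smooth {f : Rd d → ℂ} (hf : ContDiff ℝ ∞ f) (c : Rd d) (r : ℝ) :
    ∫⁻ x in Metric.ball c r, ∫⁻ y in Metric.ball c r, ‖f y - f x‖ₑ ≤
      poincareConst d r * ∫⁻ x in Metric.ball c r, ∑ i, ‖pderiv i f x‖ₑ := by
  set B := Metric.ball c r
  set g : Rd d → ℝ≥0∞ := B.indicator fun x => ∑ i, ‖pderiv i f x‖ₑ with hg
  have hgm : Measurable g :=
    (continuous_sum_enorm_pderiv hf).measurable.indicator Metric.isOpen_ball.measurableSet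
  have h1 : ∀ x ∈ B, ∀ y ∈ B, ‖f y - f x‖ₑ ≤
      ENNReal.ofReal (2 * r) * ∫⁻ t in Ioc (0 : ℝ) 1, g (x + t • (y - x)) := by
    intro x hx y hy
    have h := enorm_add_sub_le hf x (y - x)
    rw [add_sub_cancel] at h
    refine h.trans (mul_le_mul' ?_ ?_)
    · rw [← ofReal_norm, ← dist_eq_norm]
      refine ENNReal.ofReal_le_ofReal ?_
      have h1 := dist_triangle_right y x c
      have h2 := Metric.mem_ball.1 hx
      have h3 := Metric.mem_ball.1 hy
      linarith
    · refine setLIntegral_mono' measurableSet_Ioc fun t ht => ?_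
      have : x + t • (y - x) ∈ B :=
        (convex_ball c r).add_smul_sub_mem hx hy ⟨ht.1.le, ht.2⟩
      rw [hg, indicator_of_mem this]
  have h2 : ∀ x ∈ B, ∫⁻ y in B, ‖f y - f x‖ₑ ≤
      ∫⁻ h in Metric.ball (0 : Rd d) (2 * r), ENNReal.ofReal (2 * r) *
        ∫⁻ t in Ioc (0 : ℝ) 1, g (x + t • h) := by
    intro x hx
    refine (setLIntegral_mono' Metric.isOpen_ball.measurableSet fun y hy => h1 x hx y hy).trans ?_
    rw [← lintegral_indicator Metric.isOpen_ball.measurableSet,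
      ← lintegral_indicator Metric.isOpen_ball.measurableSet]
    rw [← lintegral_add_left_eq_self _ x]
    refine lintegral_mono fun h => ?_
    by_cases hh : x + h ∈ B
    · rw [indicator_of_mem hh, indicator_of_mem, add_sub_cancel_left]
      have h2 := Metric.mem_ball.1 hx
      have h3 := Metric.mem_ball.1 hh
      have h4 := dist_triangle_right (x + h) x c
      rw [dist_self_add_left] at h4
      rw [mem_ball_zero_iff]
      linarith
    · rw [indicator_of_notMem hh]
      exact bot_le
  refine (setLIntegral_mono' Metric.isOpen_ball.measurableSet h2).trans ?_
  refine (setLIntegral_le_lintegral _ _).trans ?_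
  have hm3 : Measurable fun q : (Rd d × Rd d) × ℝ => g (q.1.1 + q.2 • q.1.2) :=
    hgm.comp (by fun_prop)
  have hm2 : Measurable fun q : Rd d × Rd d => ∫⁻ t in Ioc (0 : ℝ) 1, g (q.1 + t • q.2) :=
    hm3.lintegral_prod_right'
  rw [lintegral_lintegral_swap (hm2.const_mul _).aemeasurable]
  have h3 : ∀ h : Rd d, ∫⁻ x, ENNReal.ofReal (2 * r) * ∫⁻ t in Ioc (0 : ℝ) 1, g (x + t • h) =
      ENNReal.ofReal (2 * r) * ∫⁻ x, g x := by
    intro h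
    rw [lintegral_const_mul' _ _ ENNReal.ofReal_ne_top, lintegral_lintegral_swap]
    · simp [lintegral_add_right_eq_self]
    · exact (hgm.comp (by fun_prop)).aemeasurable
  simp_rw [h3]
  rw [setLIntegral_const, hg, lintegral_indicator Metric.isOpen_ball.measurableSet, poincareConst]
  exact le_of_eq (by ring)

/-- A mollifier supported in the ball of radius `r / (k + 2)`. -/
def mollifier (d : ℕ) {r : ℝ} (hr : 0 < r) (k : ℕ) : ContDiffBump (0 : Rd d) where
  rIn := r / (k + 2) / 2
  rOut := r / (k + 2)
  rIn_pos := by positivity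
  rIn_lt_rOut := half_lt_self (by positivity)

/-- Well inside a ball, the derivative of a mollification of `w` is the mollification of the weak
derivative `g` of `w`, and so is bounded by the mollification of `|g|`. -/
lemma pderiv_convolution_enorm_le {Ω : Set (Rd d)} {c : Rd d} {r : ℝ}
    (hB : Metric.closedBall c (2 * r) ⊆ Ω) {w g : Rd d → ℂ} {i : Fin d}
    (hw : IsWeakDeriv Ω (Pi.single i 1) w g) (ψ : ContDiffBump (0 : Rd d)) (hψ : ψ.rOut < r)
    {x : Rd d} (hx : x ∈ Metric.ball c r) :
    ‖pderiv i (convolution (ψ.normed volume) ((Metric.ball c (2 * r)).indicator w)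
      (ContinuousLinearMap.lsmul ℝ ℝ) volume) x‖ₑ ≤
      ∫⁻ y, ENNReal.ofReal (ψ.normed volume (x - y)) *
        (Metric.ball c (2 * r)).indicator (fun y => ‖g y‖ₑ) y := by
  set B₂ := Metric.ball c (2 * r)
  set φ := ψ.normed volume
  have hφ : ContDiff ℝ ∞ φ := ψ.contDiff_normed
  have hφc : HasCompactSupport φ := ψ.hasCompactSupport_normed
  have hwi : LocallyIntegrable (B₂.indicator w) := by
    have : IntegrableOn w B₂ := (hw.1.integrableOn_compact_subset hB
      (isCompact_closedBall c (2 * r))).mono_set Metric.ball_subset_closedBall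
    exact ((integrable_indicator_iff Metric.isOpen_ball.measurableSet).2 this).locallyIntegrable
  have hd := hφc.hasFDerivAt_convolution_left (ContinuousLinearMap.lsmul ℝ ℝ) (μ := volume)
    (hφ.of_le (by simp)) hwi x
  have hex := (hφc.fderiv ℝ).convolutionExists_left (μ := volume)
    ((ContinuousLinearMap.lsmul ℝ ℝ : ℝ →L[ℝ] ℂ →L[ℝ] ℂ).precompL (Rd d))
    (hφ.continuous_fderiv (by simp)) hwi x
  have e1 : pderiv i (convolution φ (B₂.indicator w) (ContinuousLinearMap.lsmul ℝ ℝ) volume) x =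
      ∫ y, fderiv ℝ φ (x - y) (EuclideanSpace.single i 1) • B₂.indicator w y := by
    rw [pderiv, hd.fderiv, convolution_def, ContinuousLinearMap.integral_apply hex,
      ← integral_sub_left_eq_self _ volume x]
    simp [ContinuousLinearMap.precompL_apply]
  set θ : Rd d → ℂ := fun y => (φ (x - y) : ℂ) with hθ
  have hθs : ContDiff ℝ ∞ θ :=
    Complex.ofRealCLM.contDiff.comp (hφ.comp (contDiff_const.sub contDiff_id))
  have hsupp : Function.support θ ⊆ Metric.closedBall x ψ.rOut := by
    intro y hy
    have h1 : φ (x - y) ≠ 0 := by simpa [hθ] using hy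
    have h2 : x - y ∈ Function.support φ := h1
    rw [ψ.support_normed_eq, mem_ball_zero_iff] at h2
    rw [Metric.mem_closedBall, dist_comm, dist_eq_norm]
    exact h2.le
  have htsupp : tsupport θ ⊆ Metric.closedBall x ψ.rOut :=
    closure_minimal hsupp Metric.isClosed_closedBall
  have hθc : HasCompactSupport θ :=
    (isCompact_closedBall x ψ.rOut).of_isClosed_subset (isClosed_tsupport _) htsupp
  have hsub : Metric.closedBall x ψ.rOut ⊆ B₂ := by
    intro y hy
    have h1 := Metric.mem_closedBall.1 hy
    have h2 := Metric.mem_ball.1 hx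
    have h3 := dist_triangle y x c
    exact Metric.mem_ball.2 (by linarith)
  have hsΩ : tsupport θ ⊆ Ω :=
    htsupp.trans (hsub.trans (Metric.ball_subset_closedBall.trans hB))
  have e2 : ∀ y, pderiv i θ y = -(fderiv ℝ φ (x - y) (EuclideanSpace.single i 1) : ℂ) := by
    intro y
    have h1 : HasFDerivAt φ (fderiv ℝ φ (x - y)) (x - y) :=
      (hφ.differentiable (by simp)).differentiableAt.hasFDerivAt
    have h2 := h1.comp y ((hasFDerivAt_id y).const_sub x)
    have h3 := Complex.ofRealCLM.hasFDerivAt.comp y h2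
    rw [pderiv]
    have h4 : fderiv ℝ θ y = _ := h3.fderiv
    rw [h4]
    simp
  have e3 := hw.2.2 θ hθs hθc hsΩ
  rw [mderiv_single i hθs, setIntegral_mul_of_tsupport_subset
    ((tsupport_pderiv_subset i θ).trans hsΩ), setIntegral_mul_of_tsupport_subset hsΩ] at e3
  have e4 : ∫ y, fderiv ℝ φ (x - y) (EuclideanSpace.single i 1) • B₂.indicator w y =
      ∫ y, g y * θ y := by
    have : ∀ y, fderiv ℝ φ (x - y) (EuclideanSpace.single i 1) • B₂.indicator w y =
        -(w y * pderiv i θ y) := by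
      intro y
      by_cases hy : y ∈ B₂
      · rw [indicator_of_mem hy, e2, Complex.real_smul]; ring
      · rw [indicator_of_notMem hy]
        have : pderiv i θ y = 0 := by
          refine image_eq_zero_of_notMem_tsupport fun h => hy ?_
          exact hsub (htsupp (tsupport_pderiv_subset i θ h))
        simp [this]
    simp_rw [this]
    rw [integral_neg, e3]
    simp
  rw [e1, e4]
  refine (enorm_integral_le_lintegral_enorm _).trans (lintegral_mono fun y => ?_)
  have hn : ‖θ y‖ₑ = ENNReal.ofReal (φ (x - y)) := by
    rw [← ofReal_norm, hθ]
    simp only [Complex.norm_real, Real.norm_eq_abs]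
    rw [abs_of_nonneg (ψ.nonneg_normed _)]
  by_cases hy : y ∈ B₂
  · rw [indicator_of_mem hy, enorm_mul, hn, mul_comm]
  · have : θ y = 0 := by
      by_contra h
      exact hy (hsub (hsupp h))
    simp [this]

lemma lintegral_normed_mul (ψ : ContDiffBump (0 : Rd d)) {g : Rd d → ℝ≥0∞}
    (hg : AEMeasurable g) :
    ∫⁻ x, ∫⁻ y, ENNReal.ofReal (ψ.normed volume (x - y)) * g y = ∫⁻ y, g y := by
  have hm : Measurable fun x => ENNReal.ofReal (ψ.normed volume x) :=
    (ψ.continuous_normed (μ := volume)).measurable.ennreal_ofReal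
  rw [lintegral_lintegral_swap]
  · refine lintegral_congr fun y => ?_
    have hm' : Measurable fun x => ENNReal.ofReal (ψ.normed volume (x - y)) :=
      hm.comp (measurable_id.sub_const y)
    rw [lintegral_mul_const'' _ hm'.aemeasurable]
    have h1 : ∫⁻ x, ENNReal.ofReal (ψ.normed volume (x - y)) =
        ∫⁻ x, ENNReal.ofReal (ψ.normed volume x) :=
      lintegral_sub_right_eq_self (fun x => ENNReal.ofReal (ψ.normed volume x)) y
    rw [h1, ← ofReal_integral_eq_lintegral_ofReal ψ.integrable_normed
      (Eventually.of_forall fun x => ψ.nonneg_normed x), ψ.integral_normed]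
    simp
  · refine AEMeasurable.mul (hm.comp (measurable_fst.sub measurable_snd)).aemeasurable ?_
    exact hg.comp_snd

/-- The Poincaré inequality for functions with weak derivatives, in the form of a bound for the double
integral of differences. The ball on the right-hand side is larger, to leave room for mollification,
and the constant is not sharp. It follows from the smooth case by
mollification: mollified functions converge almost everywhere, and Fatou's lemma gives the
inequality in the limit. -/
lemma poincare_ball {Ω : Set (Rd d)} {c : Rd d} {r : ℝ} (hr : 0 < r)
    (hB : Metric.closedBall c (2 * r) ⊆ Ω) {w : Rd d → ℂ} {g : Fin d → Rd d → ℂ}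
    (hw : LocallyIntegrableOn w Ω) (hg : ∀ i, IsWeakDeriv Ω (Pi.single i 1) w (g i)) :
    ∫⁻ x in Metric.ball c r, ∫⁻ y in Metric.ball c r, ‖w y - w x‖ₑ ≤
      poincareConst d r * ∑ i, ∫⁻ x in Metric.ball c (2 * r), ‖g i x‖ₑ := by
  set B₁ := Metric.ball c r
  set B₂ := Metric.ball c (2 * r)
  set W := B₂.indicator w with hW
  have hwi : LocallyIntegrable W := by
    have : IntegrableOn w B₂ := (hw.integrableOn_compact_subset hB
      (isCompact_closedBall c (2 * r))).mono_set Metric.ball_subset_closedBall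
    exact ((integrable_indicator_iff Metric.isOpen_ball.measurableSet).2 this).locallyIntegrable
  set f : ℕ → Rd d → ℂ := fun k => convolution ((mollifier d hr k).normed volume) W
    (ContinuousLinearMap.lsmul ℝ ℝ) volume with hf
  have hfs : ∀ k, ContDiff ℝ ∞ (f k) := fun k =>
    (mollifier d hr k).hasCompactSupport_normed.contDiff_convolution_left (n := ⊤) _
      (mollifier d hr k).contDiff_normed hwi
  have hlim0 : ∀ᵐ x ∂(volume : Measure (Rd d)), Tendsto (fun k => f k x) atTop (𝓝 (W x)) := by
    refine ContDiffBump.ae_convolution_tendsto_right_of_locallyIntegrable (K := 2) ?_ ?_ hwi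
    · simp only [mollifier]
      have := tendsto_const_div_atTop_nhds_zero_nat r
      have h2 := (tendsto_add_atTop_iff_nat 2).2 this
      simpa using h2
    · refine Eventually.of_forall fun k => ?_
      simp only [mollifier]
      linarith
  have hlim : ∀ᵐ x ∂(volume.restrict B₁), Tendsto (fun k => f k x) atTop (𝓝 (w x)) := by
    refine (ae_restrict_iff' Metric.isOpen_ball.measurableSet).2 ?_
    filter_upwards [hlim0] with x hx hxB
    have : W x = w x := indicator_of_mem (Metric.ball_subset_ball (by linarith) hxB) _
    rwa [this] at hx
  have hgm : ∀ i, AEMeasurable (B₂.indicator fun y => ‖g i y‖ₑ) := fun i => by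
    refine (aemeasurable_indicator_iff Metric.isOpen_ball.measurableSet).2 ?_
    exact ((hg i).2.1.aestronglyMeasurable.mono_measure (Measure.restrict_mono
      (Metric.ball_subset_closedBall.trans hB) le_rfl)).enorm
  have hbound : ∀ k, ∫⁻ x in B₁, ∫⁻ y in B₁, ‖f k y - f k x‖ₑ ≤
      poincareConst d r * ∑ i, ∫⁻ x in B₂, ‖g i x‖ₑ := by
    intro k
    refine (poincare_smooth (hfs k) c r).trans (mul_le_mul_right ?_ _)
    rw [lintegral_finsetSum _ fun i _ => (contDiff_pderiv i (hfs k)).continuous.enorm.measurable]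
    refine Finset.sum_le_sum fun i _ => ?_
    have hψ : (mollifier d hr k).rOut < r := by
      simp only [mollifier]
      rw [div_lt_iff₀ (by positivity)]
      nlinarith [(Nat.cast_nonneg k : (0 : ℝ) ≤ k)]
    refine (setLIntegral_mono' Metric.isOpen_ball.measurableSet fun x hx =>
      pderiv_convolution_enorm_le hB (hg i) (mollifier d hr k) hψ hx).trans ?_
    refine (setLIntegral_le_lintegral _ _).trans ?_
    rw [lintegral_normed_mul _ (hgm i), lintegral_indicator Metric.isOpen_ball.measurableSet]
  clear_value f
  have hmeas : ∀ k, Measurable fun q : Rd d × Rd d => ‖f k q.2 - f k q.1‖ₑ := fun k => by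
    have : Continuous (f k) := (hfs k).continuous
    fun_prop
  have hpt : ∀ᵐ x ∂(volume.restrict B₁), ∫⁻ y in B₁, ‖w y - w x‖ₑ ≤
      liminf (fun k => ∫⁻ y in B₁, ‖f k y - f k x‖ₑ) atTop := by
    filter_upwards [hlim] with x hx
    refine le_trans (le_of_eq (lintegral_congr_ae ?_)) (lintegral_liminf_le fun k => ?_)
    · filter_upwards [hlim] with y hy
      exact ((hy.sub hx).enorm).liminf_eq.symm
    · exact ((hfs k).continuous.sub continuous_const).enorm.measurable
  refine (lintegral_mono_ae hpt).trans ((lintegral_liminf_le fun k => ?_).trans ?_)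
  · exact (hmeas k).lintegral_prod_right'
  · exact (liminf_le_liminf (Eventually.of_forall hbound)).trans (by simp)

/-! ### Summability in connected open sets -/

/-- On a ball, an integral bound for a function on a subset and a bound for its gradient give an
integral bound for the function. -/
lemma measure_mul_lintegral_ball_le {Ω : Set (Rd d)} {c : Rd d} {r : ℝ} (hr : 0 < r)
    (hB : Metric.closedBall c (2 * r) ⊆ Ω) {w : Rd d → ℂ} {g : Fin d → Rd d → ℂ}
    (hw : LocallyIntegrableOn w Ω) (hg : ∀ i, IsWeakDeriv Ω (Pi.single i 1) w (g i))
    {E : Set (Rd d)} (hE : E ⊆ Metric.ball c r) :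
    volume E * ∫⁻ y in Metric.ball c r, ‖w y‖ₑ ≤
      poincareConst d r * (∑ i, ∫⁻ x in Metric.ball c (2 * r), ‖g i x‖ₑ) +
        volume (Metric.ball c r) * ∫⁻ x in E, ‖w x‖ₑ := by
  have hBΩ : Metric.ball c r ⊆ Ω :=
    (Metric.ball_subset_closedBall.trans (Metric.closedBall_subset_closedBall (by linarith))).trans hB
  have hm : AEMeasurable (fun x => ‖w x‖ₑ) (volume.restrict E) :=
    (hw.aestronglyMeasurable.mono_measure
      (Measure.restrict_mono (hE.trans hBΩ) le_rfl)).enorm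
  calc volume E * ∫⁻ y in Metric.ball c r, ‖w y‖ₑ
      = ∫⁻ x in E, ∫⁻ y in Metric.ball c r, ‖w y‖ₑ := by
        rw [setLIntegral_const, mul_comm]
    _ ≤ ∫⁻ x in E, (∫⁻ y in Metric.ball c r, ‖w y - w x‖ₑ) +
          volume (Metric.ball c r) * ‖w x‖ₑ := by
        refine lintegral_mono fun x => ?_
        rw [mul_comm, ← setLIntegral_const, ← lintegral_add_right _ measurable_const]
        refine lintegral_mono fun y => ?_
        calc ‖w y‖ₑ = ‖(w y - w x) + w x‖ₑ := by rw [sub_add_cancel]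
          _ ≤ _ := enorm_add_le _ _
    _ = (∫⁻ x in E, ∫⁻ y in Metric.ball c r, ‖w y - w x‖ₑ) +
          volume (Metric.ball c r) * ∫⁻ x in E, ‖w x‖ₑ := by
        rw [lintegral_add_right' _ (hm.const_mul _), lintegral_const_mul'' _ hm]
    _ ≤ _ := by
        gcongr
        exact (lintegral_mono_set hE).trans (poincare_ball hr hB hw hg)

/-- If the gradients of `v n` are locally summable in a connected open set, then local summability of
`v n` near one point spreads to the whole set. -/
lemma LocSummable.of_gradient {Ω : Set (Rd d)} (hΩ : IsOpen Ω) (hc : IsPreconnected Ω)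
    {v : ℕ → Rd d → ℂ} {g : Fin d → ℕ → Rd d → ℂ} (hv : ∀ n, LocallyIntegrableOn (v n) Ω)
    (hvg : ∀ i n, IsWeakDeriv Ω (Pi.single i 1) (v n) (g i n)) (hg : ∀ i, LocSummable Ω (g i))
    {x₀ : Rd d} (hx₀ : x₀ ∈ Ω) {ρ₀ : ℝ} (hρ₀ : 0 < ρ₀)
    (hb : ∑' n, ∫⁻ y in Ω ∩ Metric.ball x₀ ρ₀, ‖v n y‖ₑ ≠ ⊤) : LocSummable Ω v := by
  refine ⟨fun n => (hv n).aestronglyMeasurable, ?_⟩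
  -- The points near which the series converges form an open set, which is relatively closed in `Ω`:
  -- a limit point has a ball on a part of which the series converges.
  set S : Set (Rd d) := {x | ∃ ρ > 0, ∑' n, ∫⁻ y in Ω ∩ Metric.ball x ρ, ‖v n y‖ₑ ≠ ⊤} with hS
  have hSo : IsOpen S := by
    refine Metric.isOpen_iff.2 fun x ⟨ρ, hρ, hx⟩ => ⟨ρ / 2, by positivity, fun y hy => ?_⟩
    refine ⟨ρ / 2, by positivity, ne_top_of_le_ne_top hx (ENNReal.tsum_le_tsum fun n => ?_)⟩
    refine lintegral_mono_set (inter_subset_inter_right _ fun z hz => ?_)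
    have h1 := Metric.mem_ball.1 hy
    have h2 := Metric.mem_ball.1 hz
    have h3 := dist_triangle z y x
    exact Metric.mem_ball.2 (by linarith)
  refine hc.subset_of_closure_inter_subset hSo ⟨x₀, hx₀, ρ₀, hρ₀, hb⟩ ?_
  rintro x ⟨hxS, hxΩ⟩
  obtain ⟨R, hR, hRΩ⟩ := Metric.isOpen_iff.1 hΩ x hxΩ
  have hr : 0 < R / 4 := by positivity
  have hcb : Metric.closedBall x (2 * (R / 4)) ⊆ Ω :=
    (Metric.closedBall_subset_ball (by linarith)).trans hRΩ
  obtain ⟨y, ⟨ρ, hρ, hyb⟩, hxy⟩ := Metric.mem_closure_iff.1 hxS (R / 4) hr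
  set E := Metric.ball x (R / 4) ∩ Metric.ball y ρ with hE
  have hEpos : 0 < volume E := by
    refine IsOpen.measure_pos _ (Metric.isOpen_ball.inter Metric.isOpen_ball) ⟨y, ?_, ?_⟩
    · rwa [Metric.mem_ball, dist_comm]
    · exact Metric.mem_ball_self hρ
  have hEtop : volume E ≠ ⊤ := ne_top_of_le_ne_top measure_ball_lt_top.ne
    (measure_mono inter_subset_left)
  have hBΩ : Metric.ball x (R / 4) ⊆ Ω :=
    (Metric.ball_subset_ball (by linarith)).trans hRΩ
  refine ⟨R / 4, hr, ?_⟩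
  rw [inter_eq_self_of_subset_right hBΩ]
  have key : volume E * ∑' n, ∫⁻ y in Metric.ball x (R / 4), ‖v n y‖ₑ ≤
      poincareConst d (R / 4) * (∑ i, ∑' n, ∫⁻ x in Metric.ball x (2 * (R / 4)), ‖g i n x‖ₑ) +
        volume (Metric.ball x (R / 4)) * ∑' n, ∫⁻ x in E, ‖v n x‖ₑ := by
    rw [← Summable.tsum_finsetSum fun i _ => ENNReal.summable, ← ENNReal.tsum_mul_left,
      ← ENNReal.tsum_mul_left, ← ENNReal.tsum_mul_left, ← ENNReal.tsum_add]
    exact ENNReal.tsum_le_tsum fun n =>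
      measure_mul_lintegral_ball_le hr hcb (hv n) (fun i => hvg i n) inter_subset_left
  have hfin : volume E * ∑' n, ∫⁻ y in Metric.ball x (R / 4), ‖v n y‖ₑ ≠ ⊤ := by
    refine ne_top_of_le_ne_top (ENNReal.add_ne_top.2 ⟨?_, ?_⟩) key
    · refine ENNReal.mul_ne_top (poincareConst_ne_top _) (ENNReal.sum_ne_top.2 fun i _ => ?_)
      refine ne_top_of_le_ne_top ((hg i).compact (isCompact_closedBall x (2 * (R / 4))) hcb) ?_
      exact ENNReal.tsum_le_tsum fun n => lintegral_mono_set Metric.ball_subset_closedBall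
    · refine ENNReal.mul_ne_top measure_ball_lt_top.ne (ne_top_of_le_ne_top hyb ?_)
      refine ENNReal.tsum_le_tsum fun n => lintegral_mono_set fun z hz => ⟨hBΩ hz.1, hz.2⟩
  intro htop
  rw [htop, ENNReal.mul_top hEpos.ne'] at hfin
  exact hfin rfl

lemma isWeakDeriv_const_single {Ω : Set (Rd d)} (i : Fin d) (c : ℂ) :
    IsWeakDeriv Ω (Pi.single i 1) (fun _ => c) (fun _ => 0) := by
  have h := isWeakDeriv_mderiv (Ω := Ω) (Pi.single i 1) (contDiff_const (c := c))
  rw [mderiv_single i contDiff_const] at h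
  have e : pderiv i (fun _ : Rd d => c) = fun _ => 0 := by
    ext x; simp [pderiv]
  rwa [e] at h

/-- If the gradients of `v n` are locally summable in a connected open set, then so are the functions
`v n`, after subtraction of suitable constants. -/
lemma exists_const_locSummable {Ω : Set (Rd d)} (hΩ : IsOpen Ω) (hc : IsConnected Ω)
    {v : ℕ → Rd d → ℂ} {g : Fin d → ℕ → Rd d → ℂ} (hv : ∀ n, LocallyIntegrableOn (v n) Ω)
    (hvg : ∀ i n, IsWeakDeriv Ω (Pi.single i 1) (v n) (g i n)) (hg : ∀ i, LocSummable Ω (g i)) :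
    ∃ c : ℕ → ℂ, LocSummable Ω (fun n x => v n x - c n) := by
  obtain ⟨x₀, hx₀⟩ := hc.nonempty
  obtain ⟨R, hR, hRΩ⟩ := Metric.isOpen_iff.1 hΩ x₀ hx₀
  have hr : 0 < R / 4 := by positivity
  have hcb : Metric.closedBall x₀ (2 * (R / 4)) ⊆ Ω :=
    (Metric.closedBall_subset_ball (by linarith)).trans hRΩ
  set B := Metric.ball x₀ (R / 4) with hB
  have hBΩ : B ⊆ Ω := (Metric.ball_subset_ball (by linarith)).trans hRΩ
  have hBpos : volume B ≠ 0 := (Metric.measure_ball_pos _ _ hr).ne'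
  have hBtop : volume B ≠ ⊤ := measure_ball_lt_top.ne
  -- The constants are values `v n (x n)`, where `x n` is a point with at most average oscillation.
  have hex : ∀ n, ∃ x ∈ B, ∫⁻ y in B, ‖v n y - v n x‖ₑ ≤
      ⨍⁻ x in B, (∫⁻ y in B, ‖v n y - v n x‖ₑ) ∂volume := by
    intro n
    refine exists_le_setLAverage hBpos hBtop ?_
    have hm : AEMeasurable (v n) (volume.restrict B) :=
      ((hv n).aestronglyMeasurable.mono_measure (Measure.restrict_mono hBΩ le_rfl)).aemeasurable
    have : AEMeasurable (fun q : Rd d × Rd d => ‖v n q.2 - v n q.1‖ₑ)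
        ((volume.restrict B).prod (volume.restrict B)) :=
      (hm.comp_snd.sub hm.comp_fst).enorm
    exact this.lintegral_prod_right'
  choose x hxB hx using hex
  refine ⟨fun n => v n (x n), ?_⟩
  refine LocSummable.of_gradient hΩ hc.isPreconnected (g := g) (x₀ := x₀) (ρ₀ := R / 4)
    (fun n => (hv n).sub (locallyIntegrableOn_const _)) (fun i n => ?_) hg hx₀ hr ?_
  · have := (hvg i n).sub (isWeakDeriv_const_single i (v n (x n)))
    simpa using this
  · rw [inter_eq_self_of_subset_right hBΩ]
    have hle : ∀ n, ∫⁻ y in B, ‖v n y - v n (x n)‖ₑ ≤ (volume B)⁻¹ * (poincareConst d (R / 4) *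
        ∑ i, ∫⁻ x in Metric.ball x₀ (2 * (R / 4)), ‖g i n x‖ₑ) := by
      intro n
      refine (hx n).trans ?_
      rw [setLAverage_eq, ENNReal.div_eq_inv_mul]
      gcongr
      exact poincare_ball hr hcb (hv n) fun i => hvg i n
    refine ne_top_of_le_ne_top ?_ (ENNReal.tsum_le_tsum hle)
    rw [ENNReal.tsum_mul_left, ENNReal.tsum_mul_left,
      Summable.tsum_finsetSum fun i _ => ENNReal.summable]
    refine ENNReal.mul_ne_top (ENNReal.inv_ne_top.2 hBpos)
      (ENNReal.mul_ne_top (poincareConst_ne_top _) (ENNReal.sum_ne_top.2 fun i _ => ?_))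
    refine ne_top_of_le_ne_top ((hg i).compact (isCompact_closedBall x₀ (2 * (R / 4))) hcb) ?_
    exact ENNReal.tsum_le_tsum fun n => lintegral_mono_set Metric.ball_subset_closedBall

lemma contDiff_sum_monom (s : Finset (Fin d → ℕ)) (c : (Fin d → ℕ) → ℂ) :
    ContDiff ℝ ∞ (fun x => ∑ γ ∈ s, c γ * monom γ x) :=
  ContDiff.sum fun γ _ => contDiff_const.mul (contDiff_monom γ)

lemma mderiv_sum_monom (s : Finset (Fin d → ℕ)) (c : (Fin d → ℕ) → ℂ) (α : Fin d → ℕ) :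
    mderiv α (fun x => ∑ γ ∈ s, c γ * monom γ x) = fun x => ∑ γ ∈ s, c γ * mderiv α (monom γ) x := by
  classical
  induction s using Finset.induction_on with
  | empty => simp only [Finset.sum_empty]; exact mderiv_zero_fun α
  | insert γ s hγ ih =>
    simp only [Finset.sum_insert hγ]
    have h := mderiv_add α (contDiff_const.mul (contDiff_monom γ) : ContDiff ℝ ∞ fun x =>
      c γ * monom γ x) (contDiff_sum_monom s c)
    rw [mderiv_const_mul α (c γ) (contDiff_monom γ), ih] at h
    exact h

/-- If the weak derivatives of `w n` of orders `k, …, m` are locally summable in a connected open set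
`Ω`, then subtracting polynomials of degree less than `k` gives functions that have the same
derivatives of these orders, and whose derivatives of all orders up to `m` are locally summable. -/
lemma exists_locSummable_of_le {Ω : Set (Rd d)} (hΩ : IsOpen Ω) (hc : IsConnected Ω) {k m : ℕ}
    (hk : k ≤ m) {w : ℕ → Rd d → ℂ}
    (hw : ∀ n (α : Fin d → ℕ), ∑ i, α i ≤ m → ∃ g, IsWeakDeriv Ω α (w n) g)
    (hs : ∀ α : Fin d → ℕ, k ≤ ∑ i, α i → ∑ i, α i ≤ m →
      LocSummable Ω fun n => weakDeriv Ω α (w n)) :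
    ∃ w' : ℕ → Rd d → ℂ,
      (∀ n (α : Fin d → ℕ), ∑ i, α i ≤ m → ∃ g, IsWeakDeriv Ω α (w' n) g) ∧
      (∀ α : Fin d → ℕ, k ≤ ∑ i, α i → ∑ i, α i ≤ m → ∀ n,
        weakDeriv Ω α (w' n) =ᵐ[volume.restrict Ω] weakDeriv Ω α (w n)) ∧
      ∀ α : Fin d → ℕ, ∑ i, α i ≤ m → LocSummable Ω fun n => weakDeriv Ω α (w' n) := by
  induction k generalizing w with
  | zero => exact ⟨w, hw, fun α _ _ n => EventuallyEq.rfl, fun α hα => hs α (Nat.zero_le _) hα⟩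
  | succ k ih =>
    have hW : ∀ n (α : Fin d → ℕ), ∑ i, α i ≤ m → IsWeakDeriv Ω α (w n) (weakDeriv Ω α (w n)) :=
      fun n α hα => isWeakDeriv_weakDeriv (hw n α hα)
    have hex : ∀ γ : Fin d → ℕ, ∃ c : ℕ → ℂ, ∑ i, γ i = k →
        LocSummable Ω fun n x => weakDeriv Ω γ (w n) x - c n := by
      intro γ
      by_cases hγ : ∑ i, γ i = k
      · obtain ⟨c, hc⟩ := exists_const_locSummable hΩ hc
          (v := fun n => weakDeriv Ω γ (w n))
          (g := fun i n => weakDeriv Ω (γ + Pi.single i 1) (w n))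
          (fun n => (hW n γ (by omega)).2.1)
          (fun i n => (hW n γ (by omega)).single_of_add_single
            (hW n _ (by rw [sum_add_single]; omega)))
          (fun i => hs _ (by rw [sum_add_single]; omega) (by rw [sum_add_single]; omega))
        exact ⟨c, fun _ => hc⟩
      · exact ⟨0, fun h => absurd h hγ⟩
    choose c hcs using hex
    set s : Finset (Fin d → ℕ) := Finset.piAntidiag Finset.univ k
    -- Polynomials whose derivatives of order `k` are the constants `c γ n`.
    set P : ℕ → Rd d → ℂ := fun n x => ∑ γ ∈ s, c γ n * monom γ x with hP
    have hPs : ∀ n, ContDiff ℝ ∞ (P n) := fun n => contDiff_sum_monom s fun γ => c γ n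
    have hPk : ∀ n (α : Fin d → ℕ), ∑ i, α i = k → mderiv α (P n) = fun _ => c α n := by
      intro n α hα
      rw [hP, mderiv_sum_monom s (fun γ => c γ n) α]
      ext x
      rw [Finset.sum_eq_single α]
      · rw [mderiv_monom_of_eq rfl]; simp
      · intro γ hγ hne
        rw [mderiv_monom_of_eq, if_neg (Ne.symm hne), mul_zero]
        rw [hα]
        exact (Finset.mem_piAntidiag.1 hγ).1
      · intro h
        exact absurd (Finset.mem_piAntidiag.2 ⟨hα, fun i _ => Finset.mem_univ i⟩) h
    have hPk' : ∀ n (α : Fin d → ℕ), k < ∑ i, α i → mderiv α (P n) = fun _ => 0 := by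
      intro n α hα
      rw [hP, mderiv_sum_monom s (fun γ => c γ n) α]
      ext x
      refine Finset.sum_eq_zero fun γ hγ => ?_
      have h1 : ∑ i, γ i = k := (Finset.mem_piAntidiag.1 hγ).1
      rw [mderiv_monom_of_lt (by omega)]
      simp
    have hw' : ∀ n (α : Fin d → ℕ), ∑ i, α i ≤ m → IsWeakDeriv Ω α (fun x => w n x - P n x)
        (fun x => weakDeriv Ω α (w n) x - mderiv α (P n) x) := fun n α hα =>
      (hW n α hα).sub (isWeakDeriv_mderiv α (hPs n))
    have hsame : ∀ α : Fin d → ℕ, k + 1 ≤ ∑ i, α i → ∑ i, α i ≤ m → ∀ n,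
        weakDeriv Ω α (fun x => w n x - P n x) =ᵐ[volume.restrict Ω] weakDeriv Ω α (w n) := by
      intro α h1 h2 n
      have := (hw' n α h2).weakDeriv_ae_eq hΩ
      rw [hPk' n α (by omega)] at this
      simpa using this
    obtain ⟨w', h1, h2, h3⟩ := ih (by omega) (w := fun n x => w n x - P n x)
      (fun n α hα => ⟨_, hw' n α hα⟩) (by
        intro α hkα hαm
        rcases hkα.eq_or_lt with h | h
        · refine (hcs α h.symm).congr fun n => ?_
          have := (hw' n α hαm).weakDeriv_ae_eq hΩ
          rw [hPk n α h.symm] at this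
          exact this.symm
        · exact (hs α h hαm).congr fun n => (hsame α h hαm n).symm)
    refine ⟨w', h1, fun α hα hαm n => ?_, h3⟩
    exact (h2 α (by omega) hαm n).trans (hsame α hα hαm n)

/-- Completeness of Sobolev spaces modulo polynomials of degree less than `k`: if the series of
derivatives of `w n` of orders `k, …, m` are locally summable, then their sums are the derivatives of
one function. -/
lemma exists_weakDeriv_eq_tsum {Ω : Set (Rd d)} (hΩ : IsOpen Ω) (hc : IsConnected Ω) {k m : ℕ}
    (hk : k ≤ m) {w : ℕ → Rd d → ℂ}
    (hw : ∀ n (α : Fin d → ℕ), ∑ i, α i ≤ m → ∃ g, IsWeakDeriv Ω α (w n) g)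
    (hs : ∀ α : Fin d → ℕ, k ≤ ∑ i, α i → ∑ i, α i ≤ m →
      LocSummable Ω fun n => weakDeriv Ω α (w n)) :
    ∃ u : Rd d → ℂ, (∀ α : Fin d → ℕ, ∑ i, α i ≤ m → ∃ g, IsWeakDeriv Ω α u g) ∧
      ∀ α : Fin d → ℕ, k ≤ ∑ i, α i → ∑ i, α i ≤ m →
        weakDeriv Ω α u =ᵐ[volume.restrict Ω] fun x => ∑' n, weakDeriv Ω α (w n) x := by
  obtain ⟨w', h1, h2, h3⟩ := exists_locSummable_of_le hΩ hc hk hw hs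
  have h1' : ∀ n (α : Fin d → ℕ), ∑ i, α i ≤ m → IsWeakDeriv Ω α (w' n) (weakDeriv Ω α (w' n)) :=
    fun n α hα => isWeakDeriv_weakDeriv (h1 n α hα)
  have hw0 : LocSummable Ω w' := (h3 0 (by simp)).congr fun n =>
    (isWeakDeriv_zero (h1' n 0 (by simp)).1).weakDeriv_ae_eq hΩ
  have key : ∀ α : Fin d → ℕ, ∑ i, α i ≤ m → IsWeakDeriv Ω α (fun x => ∑' n, w' n x)
      (fun x => ∑' n, weakDeriv Ω α (w' n) x) := fun α hα =>
    IsWeakDeriv.tsum (fun n => h1' n α hα) hw0 (h3 α hα)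
  refine ⟨fun x => ∑' n, w' n x, fun α hα => ⟨_, key α hα⟩, fun α hkα hα => ?_⟩
  refine ((key α hα).weakDeriv_ae_eq hΩ).trans ?_
  filter_upwards [ae_all_iff.2 (h2 α hkα hα)] with x hx
  exact tsum_congr hx

/-! ### Coordinates adapted to a Lipschitz graph -/

lemma horiz_coe (e x : Rd d) (he : ‖e‖ = 1) : (horiz e x : Rd d) = x - inner ℝ e x • e := by
  have h1 : (horiz e x : Rd d) = (ℝ ∙ e)ᗮ.starProjection x := rfl
  rw [h1, Submodule.starProjection_orthogonal_val, Submodule.starProjection_unit_singleton ℝ he]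

lemma horiz_add_smul (e x : Rd d) (he : ‖e‖ = 1) : (horiz e x : Rd d) + (inner ℝ e x : ℝ) • e = x := by
  rw [horiz_coe e x he, sub_add_cancel]

lemma inner_coe_orthogonal (e : Rd d) (y : (ℝ ∙ e)ᗮ) : inner ℝ e (y : Rd d) = 0 :=
  (Submodule.mem_orthogonal_singleton_iff_inner_right.1 y.2)

lemma inner_add_smul (e : Rd d) (he : ‖e‖ = 1) (y : (ℝ ∙ e)ᗮ) (t : ℝ) :
    inner ℝ e ((y : Rd d) + t • e) = t := by
  rw [inner_add_right, inner_coe_orthogonal, inner_smul_right, real_inner_self_eq_norm_sq, he]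
  simp

lemma horiz_coe_add_smul (e : Rd d) (he : ‖e‖ = 1) (y : (ℝ ∙ e)ᗮ) (t : ℝ) :
    horiz e ((y : Rd d) + t • e) = y := by
  ext1
  rw [horiz_coe _ _ he, inner_add_smul e he, add_sub_cancel_right]

lemma norm_horiz_sub_le (e x y : Rd d) : ‖horiz e x - horiz e y‖ ≤ ‖x - y‖ := by
  have : horiz e x - horiz e y = (ℝ ∙ e)ᗮ.orthogonalProjectionOnto (x - y) := by
    simp [horiz]
  rw [this]
  exact Submodule.norm_orthogonalProjectionOnto_apply_le _ _

lemma lipschitzWith_horiz (e : Rd d) : LipschitzWith 1 (horiz e) :=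
  LipschitzWith.of_dist_le_mul fun x y => by
    rw [dist_eq_norm, dist_eq_norm]
    simpa using norm_horiz_sub_le e x y

lemma abs_inner_sub_le (e : Rd d) (he : ‖e‖ = 1) (x y : Rd d) :
    |inner ℝ e x - inner ℝ e y| ≤ ‖x - y‖ := by
  rw [← inner_sub_right]
  simpa [he] using abs_real_inner_le_norm e (x - y)

/-- The coordinates `x ↦ (x', t)` with `t`-axis spanned by the unit vector `e`. The product carries the
maximum norm, so this is a linear homeomorphism but not an isometry. -/
def graphCoord (e : Rd d) (he : ‖e‖ = 1) : Rd d ≃L[ℝ] (ℝ ∙ e)ᗮ × ℝ :=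
  LinearEquiv.toContinuousLinearEquiv
    { toFun := fun x => (horiz e x, inner ℝ e x)
      map_add' := fun x y => by simp [horiz, inner_add_right]
      map_smul' := fun c x => by simp [horiz, inner_smul_right]
      invFun := fun q => (q.1 : Rd d) + q.2 • e
      left_inv := fun x => horiz_add_smul e x he
      right_inv := fun q => Prod.ext (horiz_coe_add_smul e he q.1 q.2) (inner_add_smul e he q.1 q.2) }

/-- The surface measure on the hyperplane orthogonal to `e`, normalized as the `(d-1)`-dimensional
Hausdorff measure to make it comparable with the surface measure of `∂Ω`. -/
def hyperplaneMeasure (e : Rd d) : Measure (ℝ ∙ e)ᗮ := Measure.hausdorffMeasure ((d : ℝ) - 1)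

lemma isAddHaarMeasure_hyperplane (e : Rd d) (he : ‖e‖ = 1) :
    (hyperplaneMeasure e).IsAddHaarMeasure := by
  have he0 : e ≠ 0 := by rintro rfl; simp at he
  obtain ⟨n, rfl⟩ : ∃ n, d = n + 1 := by
    refine Nat.exists_eq_succ_of_ne_zero ?_
    rintro rfl
    exact he0 (Subsingleton.elim _ _)
  have : Fact (Module.finrank ℝ (Rd (n + 1)) = n + 1) := ⟨by simp⟩
  have h := Submodule.finrank_orthogonal_span_singleton (𝕜 := ℝ) (n := n) he0
  have h2 : (((n + 1 : ℕ) : ℝ) - 1) = (Module.finrank ℝ (ℝ ∙ e)ᗮ : ℝ) := by rw [h]; simp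
  rw [hyperplaneMeasure, h2]
  infer_instance

/-- Tonelli's theorem in graph coordinates. The factor `c` accounts for the normalization of the
Hausdorff measure. -/
lemma exists_lintegral_eq_graphCoord (e : Rd d) (he : ‖e‖ = 1) :
    ∃ c : ℝ≥0∞, c ≠ ⊤ ∧ ∀ f : Rd d → ℝ≥0∞, Measurable f → ∫⁻ x, f x =
      c * ∫⁻ y, (∫⁻ t : ℝ, f ((y : Rd d) + t • e)) ∂(hyperplaneMeasure e) := by
  have := isAddHaarMeasure_hyperplane e he
  set ν := hyperplaneMeasure e
  set T := graphCoord e he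
  have : (Measure.map T (volume : Measure (Rd d))).IsAddHaarMeasure :=
    T.isAddHaarMeasure_map volume
  obtain ⟨c, h⟩ : ∃ c : ℝ≥0, Measure.map T (volume : Measure (Rd d)) = c • ν.prod volume :=
    ⟨_, Measure.isAddLeftInvariant_eq_smul (Measure.map T (volume : Measure (Rd d)))
      (ν.prod volume)⟩
  refine ⟨c, ENNReal.coe_ne_top, fun f hf => ?_⟩
  have hT : Measurable T.symm := T.symm.continuous.measurable
  have h1 : ∫⁻ x, f x = ∫⁻ q, f (T.symm q) ∂(Measure.map T volume) := by
    rw [lintegral_map (f := fun q => f (T.symm q)) (hf.comp hT) T.continuous.measurable]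
    simp
  rw [h1, h, lintegral_smul_measure, lintegral_prod (fun q => f (T.symm q)) (hf.comp hT).aemeasurable]
  rfl

/-- Tonelli's theorem in the coordinates `t = ψ(y) + τ` that straighten a graph. -/
lemma exists_lintegral_eq_graph (e : Rd d) (he : ‖e‖ = 1) :
    ∃ c : ℝ≥0∞, c ≠ ⊤ ∧ ∀ (ψ : (ℝ ∙ e)ᗮ → ℝ) (f : Rd d → ℝ≥0∞), Measurable f → ∫⁻ x, f x =
      c * ∫⁻ y, (∫⁻ τ : ℝ, f ((y : Rd d) + (ψ y + τ) • e)) ∂(hyperplaneMeasure e) := by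
  obtain ⟨c, hc, h⟩ := exists_lintegral_eq_graphCoord e he
  refine ⟨c, hc, fun ψ f hf => ?_⟩
  rw [h f hf]
  congr 1
  refine lintegral_congr fun y => ?_
  exact (lintegral_add_left_eq_self (fun t => f ((y : Rd d) + t • e)) (ψ y)).symm

/-- Projection to the hyperplane decreases the surface measure of a graph. -/
lemma lintegral_graph_le {e : Rd d} (he : ‖e‖ = 1) {ψ : (ℝ ∙ e)ᗮ → ℝ} (hψ : Continuous ψ)
    {F : Rd d → ℝ≥0∞} (hF : Measurable F) :
    ∫⁻ y, F ((y : Rd d) + ψ y • e) ∂(hyperplaneMeasure e) ≤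
      ∫⁻ x in {x : Rd d | ψ (horiz e x) = inner ℝ e x}, F x
        ∂(Measure.hausdorffMeasure ((d : ℝ) - 1)) := by
  have hd : (0 : ℝ) ≤ (d : ℝ) - 1 := by
    have : d ≠ 0 := by
      rintro rfl
      have : e = 0 := Subsingleton.elim _ _
      simp [this] at he
    have : (1 : ℝ) ≤ d := by exact_mod_cast Nat.one_le_iff_ne_zero.2 this
    linarith
  set Γ := {x : Rd d | ψ (horiz e x) = inner ℝ e x} with hΓ
  have hhm : Measurable (horiz e) := (lipschitzWith_horiz e).continuous.measurable
  have hΓm : MeasurableSet Γ := by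
    refine (isClosed_eq (hψ.comp (lipschitzWith_horiz e).continuous) ?_).measurableSet
    fun_prop
  set p : (ℝ ∙ e)ᗮ → Rd d := fun y => (y : Rd d) + ψ y • e with hp
  have hpc : Continuous p := by fun_prop
  have hle : hyperplaneMeasure e ≤
      Measure.map (horiz e) ((Measure.hausdorffMeasure ((d : ℝ) - 1)).restrict Γ) := by
    refine Measure.le_iff.2 fun s hs => ?_
    rw [Measure.map_apply hhm hs, Measure.restrict_apply (hhm hs)]
    have h1 : s ⊆ horiz e '' (horiz e ⁻¹' s ∩ Γ) := by
      intro y hy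
      have h2 : horiz e (p y) = y := horiz_coe_add_smul e he y (ψ y)
      refine ⟨p y, ⟨?_, ?_⟩, h2⟩
      · rwa [mem_preimage, h2]
      · rw [hΓ, mem_ofPred_eq, h2, hp, inner_add_smul e he]
    refine (measure_mono h1).trans ?_
    have := (lipschitzWith_horiz e).hausdorffMeasure_image_le hd (horiz e ⁻¹' s ∩ Γ)
    simpa [hyperplaneMeasure] using this
  refine (lintegral_mono' hle le_rfl).trans ?_
  rw [lintegral_map (f := fun y : (ℝ ∙ e)ᗮ => F ((y : Rd d) + ψ y • e)) (hF.comp hpc.measurable) hhm]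
  refine le_of_eq (setLIntegral_congr_fun hΓm fun x hx => ?_)
  have : (horiz e x : Rd d) + ψ (horiz e x) • e = x := by
    rw [show ψ (horiz e x) = inner ℝ e x from hx]
    exact horiz_add_smul e x he
  simp only [this]

/-! ### Lipschitz domains near their boundary -/

lemma mem_frontier_congr {U V : Set (Rd d)} {x : Rd d} (h : ∀ᶠ y in 𝓝 x, y ∈ U ↔ y ∈ V) :
    x ∈ frontier U ↔ x ∈ frontier V := by
  simp only [frontier_eq_closure_inter_closure, mem_inter_iff, mem_closure_iff_frequently,
    mem_compl_iff]
  rw [frequently_congr h, frequently_congr (h.mono fun y hy => not_congr hy)]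

lemma mem_frontier_graph_iff {e : Rd d} (he : ‖e‖ = 1) {ψ : (ℝ ∙ e)ᗮ → ℝ} (hψ : Continuous ψ)
    {x : Rd d} : x ∈ frontier {x : Rd d | ψ (horiz e x) < inner ℝ e x} ↔
      ψ (horiz e x) = inner ℝ e x := by
  have hc1 : Continuous fun x : Rd d => ψ (horiz e x) := hψ.comp (lipschitzWith_horiz e).continuous
  have hc2 : Continuous fun x : Rd d => (inner ℝ e x : ℝ) := by fun_prop
  refine ⟨fun h => frontier_lt_subset_eq hc1 hc2 h, fun h => ?_⟩
  rw [frontier_eq_closure_inter_closure]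
  refine ⟨?_, subset_closure ?_⟩
  · have hx : Tendsto (fun t : ℝ => x + t • e) (𝓝[>] 0) (𝓝 x) := by
      have : Continuous fun t : ℝ => x + t • e := by fun_prop
      have h2 := (this.tendsto 0).mono_left (nhdsWithin_le_nhds (s := Ioi 0))
      simpa using h2
    refine mem_closure_of_tendsto hx (eventually_nhdsWithin_of_forall fun t ht => ?_)
    have e1 : x + t • e = (horiz e x : Rd d) + (inner ℝ e x + t : ℝ) • e := by
      rw [add_smul, ← add_assoc, horiz_add_smul e x he]
    rw [mem_ofPred_eq, e1, horiz_coe_add_smul e he, inner_add_smul e he, h]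
    exact lt_add_of_pos_right _ ht
  · rw [mem_compl_iff, mem_ofPred_eq, h]
    exact lt_irrefl _

lemma IsLipschitzDomain.frontier_nonempty {Ω : Set (Rd d)} (hΩ : IsLipschitzDomain Ω) :
    (frontier Ω).Nonempty := by
  obtain ⟨-, -, ⟨M, e, he, ψ, hψ, rfl⟩ | ⟨M, n, x, r, hn, hx, -⟩⟩ := hΩ
  · refine ⟨((0 : (ℝ ∙ e)ᗮ) : Rd d) + ψ 0 • e, ?_⟩
    rw [mem_frontier_graph_iff he hψ.continuous, horiz_coe_add_smul e he, inner_add_smul e he]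
  · exact ⟨_, hx ⟨0, hn⟩⟩

/-- In a ball around `x₀`, the set `Ω` is the region above the graph of `ψ`, a function on the
hyperplane orthogonal to `e` with Lipschitz constant `M`, and `∂Ω` is the graph. -/
structure IsGraphChart (Ω : Set (Rd d)) (x₀ e : Rd d) (M : ℝ≥0) (ψ : (ℝ ∙ e)ᗮ → ℝ) (ρ : ℝ) :
    Prop where
  norm_eq : ‖e‖ = 1
  lip : LipschitzWith M ψ
  pos : 0 < ρ
  mem_iff : ∀ x ∈ Metric.ball x₀ ρ, x ∈ Ω ↔ ψ (horiz e x) < inner ℝ e x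
  frontier_iff : ∀ x ∈ Metric.ball x₀ ρ, x ∈ frontier Ω ↔ ψ (horiz e x) = inner ℝ e x

lemma IsLipschitzDomain.exists_chart {Ω : Set (Rd d)} (hΩ : IsLipschitzDomain Ω) {x₀ : Rd d}
    (hx₀ : x₀ ∈ frontier Ω) : ∃ e M ψ ρ, IsGraphChart Ω x₀ e M ψ ρ := by
  obtain ⟨-, -, ⟨M, e, he, ψ, hψ, rfl⟩ | ⟨M, n, x, r, hn, hx, hr, hcov, hcyl⟩⟩ := hΩ
  · exact ⟨e, M, ψ, 1, he, hψ, one_pos, fun x _ => Iff.rfl,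
      fun x _ => mem_frontier_graph_iff he hψ.continuous⟩
  · obtain ⟨j, hj⟩ := mem_iUnion.1 (hcov hx₀)
    obtain ⟨e, V, ⟨he, ψ, hψ, rfl⟩, -, hV⟩ := hcyl j
    obtain ⟨ρ, hρ, hb⟩ := Metric.isOpen_iff.1 Metric.isOpen_ball x₀ hj
    have hsub : Metric.ball x₀ ρ ⊆ cylinder e (x j) (2 * r j) ((8 + 8 * M) * r j) := by
      intro y hy
      have h1 : ‖y - x j‖ < r j := by
        rw [← dist_eq_norm]; exact Metric.mem_ball.1 (hb hy)
      have h2 : ‖horiz e (y - x j)‖ ≤ ‖y - x j‖ := by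
        have := norm_horiz_sub_le e (y - x j) 0
        simpa [horiz] using this
      have h3 : |inner ℝ e (y - x j)| ≤ ‖y - x j‖ := by
        have := abs_inner_sub_le e he (y - x j) 0
        simpa using this
      have hM : 0 ≤ (M : ℝ) := M.2
      have hrj := hr j
      refine ⟨by linarith, ?_⟩
      nlinarith [mul_nonneg hM hrj.le]
    have hmem : ∀ y ∈ Metric.ball x₀ ρ, y ∈ Ω ↔ ψ (horiz e y) < inner ℝ e y := by
      intro y hy
      have := Set.ext_iff.1 hV y
      simp only [mem_inter_iff, hsub hy, true_and] at this
      exact this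
    refine ⟨e, M, ψ, ρ, he, hψ, hρ, hmem, fun y hy => ?_⟩
    rw [← mem_frontier_graph_iff he hψ.continuous]
    refine mem_frontier_congr ?_
    filter_upwards [Metric.isOpen_ball.mem_nhds hy] with z hz
    exact hmem z hz

lemma bdist_pos {Ω : Set (Rd d)} (hΩ : IsOpen Ω) (hf : (frontier Ω).Nonempty) {x : Rd d}
    (hx : x ∈ Ω) : 0 < bdist Ω x := by
  refine (isClosed_frontier.notMem_iff_infDist_pos hf).1 fun h => ?_
  rw [hΩ.frontier_eq] at h
  exact h.2 hx

/-- Near the boundary, the height above the graph is at most a multiple of the distance to the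
boundary. -/
lemma IsGraphChart.height_le {Ω : Set (Rd d)} {x₀ e : Rd d} {M : ℝ≥0} {ψ : (ℝ ∙ e)ᗮ → ℝ} {ρ : ℝ}
    (h : IsGraphChart Ω x₀ e M ψ ρ) (hx₀ : x₀ ∈ frontier Ω) {x : Rd d}
    (hx : x ∈ Metric.ball x₀ (ρ / 2)) :
    inner ℝ e x - ψ (horiz e x) ≤ (1 + M) * bdist Ω x := by
  obtain ⟨y, hy, hxy⟩ := isClosed_frontier.exists_infDist_eq_dist ⟨x₀, hx₀⟩ x
  have h1 : dist x y ≤ dist x x₀ := hxy ▸ Metric.infDist_le_dist_of_mem hx₀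
  have h2 : dist x x₀ < ρ / 2 := hx
  have hyb : y ∈ Metric.ball x₀ ρ := by
    have := dist_triangle_left y x₀ x
    exact Metric.mem_ball.2 (by linarith)
  have h3 := (h.frontier_iff y hyb).1 hy
  have h4 := (abs_le.1 (abs_inner_sub_le e h.norm_eq x y)).2
  have h5 : |ψ (horiz e y) - ψ (horiz e x)| ≤ M * ‖x - y‖ := by
    rw [← Real.dist_eq]
    refine (h.lip.dist_le_mul _ _).trans ?_
    gcongr
    rw [dist_comm, dist_eq_norm]
    exact norm_horiz_sub_le e x y
  have h6 := (abs_le.1 h5).2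
  rw [bdist, hxy, dist_eq_norm]
  linarith

lemma lintegral_rpow_neg_ne_top {a : ℝ} (ha1 : a < 1) (T : ℝ) (K : ℝ) (hK : 0 < K) :
    ∫⁻ τ in Ioc 0 T, ENNReal.ofReal (τ / K) ^ (-a) ≠ ⊤ := by
  rcases le_or_gt T 0 with hT | hT
  · simp [Ioc_eq_empty_of_le hT]
  have h1 : IntegrableOn (fun τ : ℝ => (1 / K) ^ (-a) * τ ^ (-a)) (Ioc 0 T) := by
    have := (intervalIntegral.intervalIntegrable_rpow' (a := 0) (b := T) (r := -a)
      (by linarith)).const_mul ((1 / K) ^ (-a))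
    rwa [intervalIntegrable_iff_integrableOn_Ioc_of_le hT.le] at this
  have h2 : ∫⁻ τ in Ioc 0 T, ENNReal.ofReal (τ / K) ^ (-a) =
      ∫⁻ τ in Ioc 0 T, ENNReal.ofReal ((1 / K) ^ (-a) * τ ^ (-a)) := by
    refine setLIntegral_congr_fun measurableSet_Ioc fun τ hτ => ?_
    have hτ0 : 0 < τ := hτ.1
    rw [ENNReal.ofReal_rpow_of_pos (by positivity), ← Real.mul_rpow (by positivity) hτ0.le]
    congr 2
    ring
  rw [h2]
  exact h1.lintegral_lt_top.ne

lemma hyperplaneMeasure_ball_lt_top {e : Rd d} (he : ‖e‖ = 1) (y : (ℝ ∙ e)ᗮ) (r : ℝ) :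
    hyperplaneMeasure e (Metric.ball y r) < ⊤ := by
  have := isAddHaarMeasure_hyperplane e he
  exact measure_ball_lt_top

lemma graph_height_lt {e x₀ : Rd d} (he : ‖e‖ = 1) {M : ℝ≥0} {ψ : (ℝ ∙ e)ᗮ → ℝ}
    (hψ : LipschitzWith M ψ) (hx₀ : ψ (horiz e x₀) = inner ℝ e x₀) {y : (ℝ ∙ e)ᗮ} {τ r : ℝ}
    (h : (y : Rd d) + (ψ y + τ) • e ∈ Metric.ball x₀ r) :
    y ∈ Metric.ball (horiz e x₀) r ∧ τ < (1 + M) * r := by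
  have h1 : ‖(y : Rd d) + (ψ y + τ) • e - x₀‖ < r := by
    rw [← dist_eq_norm]; exact h
  have h2 := norm_horiz_sub_le e ((y : Rd d) + (ψ y + τ) • e) x₀
  rw [horiz_coe_add_smul e he] at h2
  have h3 := (abs_le.1 (abs_inner_sub_le e he ((y : Rd d) + (ψ y + τ) • e) x₀)).2
  rw [inner_add_smul e he, ← hx₀] at h3
  have h4 : |ψ (horiz e x₀) - ψ y| ≤ M * ‖y - horiz e x₀‖ := by
    rw [← Real.dist_eq]
    refine (hψ.dist_le_mul _ _).trans (le_of_eq ?_)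
    rw [dist_comm, dist_eq_norm]
  have h5 := (abs_le.1 h4).2
  have hM : 0 ≤ (M : ℝ) := M.2
  refine ⟨by rw [Metric.mem_ball, dist_eq_norm]; linarith, ?_⟩
  nlinarith [mul_le_mul_of_nonneg_left (h2.trans h1.le) hM]

/-- Negative powers of order less than one of the distance to the boundary are integrable near
boundary points. -/
lemma IsGraphChart.lintegral_bdist_rpow {Ω : Set (Rd d)} {x₀ e : Rd d} {M : ℝ≥0}
    {ψ : (ℝ ∙ e)ᗮ → ℝ} {ρ : ℝ} (h : IsGraphChart Ω x₀ e M ψ ρ) (hx₀ : x₀ ∈ frontier Ω)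
    {a : ℝ} (ha : 0 ≤ a) (ha1 : a < 1) :
    ∫⁻ x in Ω ∩ Metric.ball x₀ (ρ / 2), ENNReal.ofReal (bdist Ω x) ^ (-a) ≠ ⊤ := by
  have he := h.norm_eq
  have hx₀' := (h.frontier_iff x₀ (Metric.mem_ball_self h.pos)).1 hx₀
  have hM : 0 ≤ (M : ℝ) := M.2
  obtain ⟨c, hc, hint⟩ := exists_lintegral_eq_graph e he
  set T := (1 + (M : ℝ)) * (ρ / 2) with hT
  set B := Metric.ball (horiz e x₀) (ρ / 2)
  set G : Rd d → ℝ≥0∞ := {x | horiz e x ∈ B ∧ inner ℝ e x - ψ (horiz e x) ∈ Ioc 0 T}.indicator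
    (fun x => ENNReal.ofReal ((inner ℝ e x - ψ (horiz e x)) / (1 + M)) ^ (-a)) with hG
  have hhm : Measurable (horiz e) := (lipschitzWith_horiz e).continuous.measurable
  have hsm : Measurable fun x : Rd d => inner ℝ e x - ψ (horiz e x) := by
    refine Measurable.sub ?_ (h.lip.continuous.measurable.comp hhm)
    fun_prop
  have hGm : Measurable G := by
    refine Measurable.indicator ?_ ?_
    · exact ((hsm.div_const _).ennreal_ofReal).pow_const _
    · exact (hhm Metric.isOpen_ball.measurableSet).inter (hsm measurableSet_Ioc)
  have hle : ∫⁻ x in Ω ∩ Metric.ball x₀ (ρ / 2), ENNReal.ofReal (bdist Ω x) ^ (-a) ≤ ∫⁻ x, G x := by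
    have hmeas : MeasurableSet {x | horiz e x ∈ B ∧ inner ℝ e x - ψ (horiz e x) ∈ Ioc 0 T} :=
      (hhm Metric.isOpen_ball.measurableSet).inter (hsm measurableSet_Ioc)
    rw [hG, lintegral_indicator hmeas]
    have hsub : Ω ∩ Metric.ball x₀ (ρ / 2) ⊆
        {x | horiz e x ∈ B ∧ inner ℝ e x - ψ (horiz e x) ∈ Ioc 0 T} := by
      rintro x ⟨hxΩ, hxb⟩
      have h1 := (h.mem_iff x (Metric.ball_subset_ball (by linarith [h.pos]) hxb)).1 hxΩ
      have h2 : x = (horiz e x : Rd d) + (ψ (horiz e x) + (inner ℝ e x - ψ (horiz e x))) • e := by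
        rw [add_sub_cancel, horiz_add_smul e x he]
      have h3 := graph_height_lt he h.lip hx₀' (h2 ▸ hxb)
      exact ⟨h3.1, by linarith, h3.2.le⟩
    have hΩm : NullMeasurableSet (Ω ∩ Metric.ball x₀ (ρ / 2)) := by
      have : Ω ∩ Metric.ball x₀ (ρ / 2) =
          {x | 0 < inner ℝ e x - ψ (horiz e x)} ∩ Metric.ball x₀ (ρ / 2) := by
        ext x
        simp only [mem_inter_iff, mem_ofPred_eq, sub_pos]
        refine and_congr_left fun hx => ?_
        exact h.mem_iff x (Metric.ball_subset_ball (by linarith [h.pos]) hx)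
      rw [this]
      exact ((hsm measurableSet_Ioi).inter Metric.isOpen_ball.measurableSet).nullMeasurableSet
    refine le_trans (lintegral_mono_ae ?_) (lintegral_mono_set hsub)
    refine (ae_restrict_iff'₀ hΩm).2 (Eventually.of_forall fun x hx => ?_)
    have h1 := h.height_le hx₀ hx.2
    have h2 : 0 < inner ℝ e x - ψ (horiz e x) := (hsub hx).2.1
    rw [ENNReal.rpow_neg, ENNReal.rpow_neg]
    refine ENNReal.inv_le_inv.2 (ENNReal.rpow_le_rpow (ENNReal.ofReal_le_ofReal ?_) ha)
    rw [div_le_iff₀ (by positivity)]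
    linarith
  refine ne_top_of_le_ne_top ?_ hle
  rw [hint ψ G hGm]
  refine ENNReal.mul_ne_top hc ?_
  have hinner : ∀ y : (ℝ ∙ e)ᗮ, ∫⁻ τ : ℝ, G ((y : Rd d) + (ψ y + τ) • e) ≤
      B.indicator (fun _ => ∫⁻ τ in Ioc 0 T, ENNReal.ofReal (τ / (1 + M)) ^ (-a)) y := by
    intro y
    have hGy : ∀ τ : ℝ, G ((y : Rd d) + (ψ y + τ) • e) =
        {τ : ℝ | y ∈ B ∧ τ ∈ Ioc 0 T}.indicator
          (fun τ => ENNReal.ofReal (τ / (1 + M)) ^ (-a)) τ := by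
      intro τ
      have hiff : (y : Rd d) + (ψ y + τ) • e ∈
          {x | horiz e x ∈ B ∧ inner ℝ e x - ψ (horiz e x) ∈ Ioc 0 T} ↔
          τ ∈ {τ : ℝ | y ∈ B ∧ τ ∈ Ioc 0 T} := by
        rw [mem_ofPred_eq, mem_ofPred_eq, horiz_coe_add_smul e he, inner_add_smul e he,
          add_sub_cancel_left]
      by_cases hτ : τ ∈ {τ : ℝ | y ∈ B ∧ τ ∈ Ioc 0 T}
      · rw [hG, indicator_of_mem (hiff.2 hτ), indicator_of_mem hτ, horiz_coe_add_smul e he,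
          inner_add_smul e he, add_sub_cancel_left]
      · rw [hG, indicator_of_notMem fun h => hτ (hiff.1 h), indicator_of_notMem hτ]
    simp_rw [hGy]
    by_cases hy : y ∈ B
    · simp only [hy, true_and]
      rw [indicator_of_mem hy]
      exact (lintegral_indicator measurableSet_Ioc _).le
    · simp [hy]
  refine ne_top_of_le_ne_top ?_ (lintegral_mono hinner)
  rw [lintegral_indicator Metric.isOpen_ball.measurableSet, setLIntegral_const]
  exact ENNReal.mul_ne_top (lintegral_rpow_neg_ne_top ha1 _ _ (by positivity))
    (hyperplaneMeasure_ball_lt_top he _ _).ne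

/-- A Poincaré inequality near the boundary: a smooth function is controlled near a boundary point by
its boundary values and its gradient. -/
lemma IsGraphChart.lintegral_le_boundary {Ω : Set (Rd d)} {x₀ e : Rd d} {M : ℝ≥0}
    {ψ : (ℝ ∙ e)ᗮ → ℝ} {ρ : ℝ} (h : IsGraphChart Ω x₀ e M ψ ρ) (hx₀ : x₀ ∈ frontier Ω)
    (hΩ : IsOpen Ω) :
    ∃ ρ' > 0, ∃ C : ℝ≥0∞, C ≠ ⊤ ∧ ∀ φ : Rd d → ℂ, ContDiff ℝ ∞ φ →
      ∫⁻ x in Ω ∩ Metric.ball x₀ ρ', ‖φ x‖ₑ ≤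
        C * ((∫⁻ x in frontier Ω ∩ Metric.ball x₀ ρ, ‖φ x‖ₑ
          ∂(Measure.hausdorffMeasure ((d : ℝ) - 1))) +
          ∫⁻ x in Ω ∩ Metric.ball x₀ ρ, ∑ i, ‖pderiv i φ x‖ₑ) := by
  have he := h.norm_eq
  have hx₀' := (h.frontier_iff x₀ (Metric.mem_ball_self h.pos)).1 hx₀
  have hM : 0 ≤ (M : ℝ) := M.2
  have hρ := h.pos
  obtain ⟨c, hc, hint⟩ := exists_lintegral_eq_graph e he
  -- The segment of length less than `(1 + M) ρ'` from a point of `B(x₀, ρ')` down to the graph stays in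
  -- `B(x₀, ρ)`.
  set ρ' := ρ / (2 + M) with hρ'
  have hρ'0 : 0 < ρ' := by positivity
  have hρρ' : (2 + M) * ρ' = ρ := by rw [hρ']; field_simp
  set T := (1 + (M : ℝ)) * ρ' with hT
  have hT0 : 0 < T := by positivity
  set Γ := {x : Rd d | ψ (horiz e x) = inner ℝ e x}
  refine ⟨ρ', hρ'0, ENNReal.ofReal T * (c + 1), ENNReal.mul_ne_top ENNReal.ofReal_ne_top
    (ENNReal.add_ne_top.2 ⟨hc, ENNReal.one_ne_top⟩), fun φ hφ => ?_⟩
  set b : Rd d → ℝ≥0∞ := (Metric.ball x₀ ρ).indicator fun x => ‖φ x‖ₑ with hb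
  set g : Rd d → ℝ≥0∞ := (Ω ∩ Metric.ball x₀ ρ).indicator fun x => ∑ i, ‖pderiv i φ x‖ₑ with hg
  set F : Rd d → ℝ≥0∞ := (Ω ∩ Metric.ball x₀ ρ').indicator fun x => ‖φ x‖ₑ with hF
  have hbm : Measurable b :=
    hφ.continuous.enorm.measurable.indicator Metric.isOpen_ball.measurableSet
  have hgm : Measurable g := (continuous_sum_enorm_pderiv hφ).measurable.indicator
    (hΩ.inter Metric.isOpen_ball).measurableSet
  have hFm : Measurable F := hφ.continuous.enorm.measurable.indicator
    (hΩ.inter Metric.isOpen_ball).measurableSet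
  have hb_int : ∫⁻ y, b ((y : Rd d) + ψ y • e) ∂(hyperplaneMeasure e) ≤
      ∫⁻ x in frontier Ω ∩ Metric.ball x₀ ρ, ‖φ x‖ₑ ∂(Measure.hausdorffMeasure ((d : ℝ) - 1)) := by
    refine (lintegral_graph_le he h.lip.continuous hbm).trans ?_
    rw [hb, setLIntegral_indicator Metric.isOpen_ball.measurableSet]
    refine lintegral_mono_set fun x hx => ⟨(h.frontier_iff x hx.1).2 hx.2, hx.1⟩
  -- The bound along a vertical segment that starts at the boundary.
  have hline : ∀ (y : (ℝ ∙ e)ᗮ) (τ : ℝ), F ((y : Rd d) + (ψ y + τ) • e) ≤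
      (Ioc 0 T).indicator (fun _ => b ((y : Rd d) + ψ y • e) +
        ∫⁻ s : ℝ, g ((y : Rd d) + (ψ y + s) • e)) τ := by
    intro y τ
    by_cases hmem : (y : Rd d) + (ψ y + τ) • e ∈ Ω ∩ Metric.ball x₀ ρ'
    · obtain ⟨hyb, hτT⟩ := graph_height_lt he h.lip hx₀' hmem.2
      have hsub : Metric.ball x₀ ρ' ⊆ Metric.ball x₀ ρ :=
        Metric.ball_subset_ball (by nlinarith)
      have hτ0 : 0 < τ := by
        have := (h.mem_iff _ (hsub hmem.2)).1 hmem.1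
        rw [horiz_coe_add_smul e he, inner_add_smul e he] at this
        linarith
      rw [indicator_of_mem (show τ ∈ Ioc 0 T from ⟨hτ0, hτT.le⟩), hF, indicator_of_mem hmem]
      have hball : ∀ s ∈ Icc 0 τ, (y : Rd d) + (ψ y + s) • e ∈ Metric.ball x₀ ρ := by
        intro s hs
        have h1 : dist ((y : Rd d) + (ψ y + s) • e) ((y : Rd d) + (ψ y + τ) • e) ≤ τ := by
          rw [dist_eq_norm]
          have : (y : Rd d) + (ψ y + s) • e - ((y : Rd d) + (ψ y + τ) • e) = (s - τ) • e := by
            module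
          rw [this, norm_smul, he, mul_one, Real.norm_eq_abs, abs_le]
          constructor <;> linarith [hs.1, hs.2]
        have h2 := Metric.mem_ball.1 hmem.2
        have h3 := dist_triangle ((y : Rd d) + (ψ y + s) • e) ((y : Rd d) + (ψ y + τ) • e) x₀
        refine Metric.mem_ball.2 ?_
        nlinarith
      have hb0 : b ((y : Rd d) + ψ y • e) = ‖φ ((y : Rd d) + ψ y • e)‖ₑ := by
        have := hball 0 ⟨le_rfl, hτ0.le⟩
        rw [add_zero] at this
        rw [hb, indicator_of_mem this]
      have hinc := enorm_add_sub_le hφ ((y : Rd d) + ψ y • e) (τ • e)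
      have e1 : (y : Rd d) + ψ y • e + τ • e = (y : Rd d) + (ψ y + τ) • e := by module
      have e2 : ‖τ • e‖ₑ = ENNReal.ofReal τ := by
        rw [← ofReal_norm, norm_smul, he, mul_one, Real.norm_of_nonneg hτ0.le]
      have e3 : ENNReal.ofReal τ * ∫⁻ t in Ioc (0 : ℝ) 1,
          ∑ i, ‖pderiv i φ ((y : Rd d) + ψ y • e + t • τ • e)‖ₑ ≤
          ∫⁻ s : ℝ, g ((y : Rd d) + (ψ y + s) • e) := by
        have h1 : ∫⁻ t in Ioc (0 : ℝ) 1,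
            ∑ i, ‖pderiv i φ ((y : Rd d) + ψ y • e + t • τ • e)‖ₑ ≤
            ∫⁻ t : ℝ, g ((y : Rd d) + (ψ y + t * τ) • e) := by
          refine le_trans (setLIntegral_mono' measurableSet_Ioc fun t ht => ?_)
            (setLIntegral_le_lintegral _ _)
          have hts : t * τ ∈ Icc 0 τ :=
            ⟨mul_nonneg ht.1.le hτ0.le, mul_le_of_le_one_left hτ0.le ht.2⟩
          have hin : (y : Rd d) + (ψ y + t * τ) • e ∈ Ω ∩ Metric.ball x₀ ρ := by
            refine ⟨(h.mem_iff _ (hball _ hts)).2 ?_, hball _ hts⟩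
            rw [horiz_coe_add_smul e he, inner_add_smul e he]
            linarith [mul_pos ht.1 hτ0]
          rw [hg, indicator_of_mem hin]
          have : (y : Rd d) + ψ y • e + t • τ • e = (y : Rd d) + (ψ y + t * τ) • e := by module
          rw [this]
        have hm : Measurable fun s : ℝ => g ((y : Rd d) + (ψ y + s) • e) :=
          hgm.comp (by fun_prop)
        have h2 : ∫⁻ t : ℝ, g ((y : Rd d) + (ψ y + t * τ) • e) =
            ENNReal.ofReal τ⁻¹ * ∫⁻ s : ℝ, g ((y : Rd d) + (ψ y + s) • e) := by
          have h3 := Real.map_volume_mul_right hτ0.ne'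
          have h4 : ∫⁻ s, g ((y : Rd d) + (ψ y + s) • e) ∂(Measure.map (· * τ) volume) =
              ∫⁻ t : ℝ, g ((y : Rd d) + (ψ y + t * τ) • e) :=
            lintegral_map hm (measurable_id.mul_const τ)
          rw [← h4, h3, lintegral_smul_measure, abs_of_pos (inv_pos.2 hτ0)]
          rfl
        refine (mul_le_mul_right h1 _).trans (le_of_eq ?_)
        rw [h2, ← mul_assoc, ← ENNReal.ofReal_mul hτ0.le, mul_inv_cancel₀ hτ0.ne']
        simp
      rw [e1, e2] at hinc
      calc ‖φ ((y : Rd d) + (ψ y + τ) • e)‖ₑ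
          = ‖φ ((y : Rd d) + ψ y • e) +
              (φ ((y : Rd d) + (ψ y + τ) • e) - φ ((y : Rd d) + ψ y • e))‖ₑ := by
            rw [add_sub_cancel]
        _ ≤ _ := enorm_add_le _ _
        _ ≤ _ := by
          rw [hb0]
          gcongr
          exact hinc.trans e3
    · rw [hF, indicator_of_notMem hmem]
      exact bot_le
  have hbm' : Measurable fun y : (ℝ ∙ e)ᗮ => b ((y : Rd d) + ψ y • e) := by
    have := h.lip.continuous
    exact hbm.comp (by fun_prop)
  calc ∫⁻ x in Ω ∩ Metric.ball x₀ ρ', ‖φ x‖ₑ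
      = ∫⁻ x, F x := (lintegral_indicator (hΩ.inter Metric.isOpen_ball).measurableSet _).symm
    _ = c * ∫⁻ y, (∫⁻ τ : ℝ, F ((y : Rd d) + (ψ y + τ) • e)) ∂(hyperplaneMeasure e) := hint ψ F hFm
    _ ≤ c * ∫⁻ y, (b ((y : Rd d) + ψ y • e) + ∫⁻ s : ℝ, g ((y : Rd d) + (ψ y + s) • e)) *
          ENNReal.ofReal T ∂(hyperplaneMeasure e) := by
        gcongr with y
        refine (lintegral_mono (hline y)).trans (le_of_eq ?_)
        rw [lintegral_indicator measurableSet_Ioc, setLIntegral_const, Real.volume_Ioc, sub_zero]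
    _ = ENNReal.ofReal T * (c * (∫⁻ y, b ((y : Rd d) + ψ y • e) ∂(hyperplaneMeasure e)) +
          c * ∫⁻ y, (∫⁻ s : ℝ, g ((y : Rd d) + (ψ y + s) • e)) ∂(hyperplaneMeasure e)) := by
        rw [lintegral_mul_const' _ _ ENNReal.ofReal_ne_top, lintegral_add_left hbm']
        ring
    _ ≤ ENNReal.ofReal T * ((c + 1) * (∫⁻ x in frontier Ω ∩ Metric.ball x₀ ρ, ‖φ x‖ₑ
          ∂(Measure.hausdorffMeasure ((d : ℝ) - 1))) +
          (c + 1) * ∫⁻ x in Ω ∩ Metric.ball x₀ ρ, ∑ i, ‖pderiv i φ x‖ₑ) := by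
        rw [← hint ψ g hgm, hg, lintegral_indicator (hΩ.inter Metric.isOpen_ball).measurableSet]
        gcongr
        · exact le_self_add
        · exact le_mul_of_one_le_left bot_le le_add_self
    _ = _ := by ring

/-! ### Summability up to the boundary and Sobolev traces -/

/-- The series `∑ f n` converges absolutely in `L^1(Ω ∩ B(0, R))` for every `R`. -/
structure BallSummable {E : Type*} [NormedAddCommGroup E] (Ω : Set (Rd d)) (f : ℕ → Rd d → E) :
    Prop where
  meas : ∀ n, AEStronglyMeasurable (f n) (volume.restrict Ω)
  bound : ∀ R : ℝ, ∑' n, ∫⁻ y in Ω ∩ Metric.ball 0 R, ‖f n y‖ₑ ≠ ⊤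

lemma ball_subset_ball_zero (x : Rd d) (ρ : ℝ) : Metric.ball x ρ ⊆ Metric.ball 0 (‖x‖ + ρ) := by
  intro y hy
  rw [mem_ball_zero_iff]
  have h1 : ‖y - x‖ < ρ := by rw [← dist_eq_norm]; exact hy
  have h2 := norm_add_le x (y - x)
  rw [add_sub_cancel] at h2
  linarith

lemma BallSummable.bound_ball {E : Type*} [NormedAddCommGroup E] {Ω : Set (Rd d)}
    {f : ℕ → Rd d → E} (h : BallSummable Ω f) (x : Rd d) (ρ : ℝ) :
    ∑' n, ∫⁻ y in Ω ∩ Metric.ball x ρ, ‖f n y‖ₑ ≠ ⊤ :=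
  ne_top_of_le_ne_top (h.bound (‖x‖ + ρ)) (ENNReal.tsum_le_tsum fun _ =>
    lintegral_mono_set (inter_subset_inter_right _ (ball_subset_ball_zero x ρ)))

lemma BallSummable.locSummable {Ω : Set (Rd d)} {f : ℕ → Rd d → ℂ} (h : BallSummable Ω f) :
    LocSummable Ω f :=
  ⟨h.meas, fun x _ => ⟨1, one_pos, h.bound_ball x 1⟩⟩

lemma BallSummable.congr {E : Type*} [NormedAddCommGroup E] {Ω : Set (Rd d)}
    {f g : ℕ → Rd d → E} (h : BallSummable Ω f)
    (hfg : ∀ n, f n =ᵐ[volume.restrict Ω] g n) : BallSummable Ω g := by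
  refine ⟨fun n => (h.meas n).congr (hfg n), fun R => ?_⟩
  convert h.bound R using 3 with n
  refine lintegral_congr_ae ?_
  filter_upwards [ae_mono (Measure.restrict_mono inter_subset_left le_rfl) (hfg n)] with y hy
  rw [hy]

/-- Integrals that are finite near each point of the closure of `Ω` are finite on bounded sets. -/
lemma tsum_lintegral_ball_ne_top {ι : Type*} {Ω : Set (Rd d)} {f : ι → Rd d → ℝ≥0∞}
    (h : ∀ x ∈ closure Ω, ∃ ρ > 0, ∑' n, ∫⁻ y in Ω ∩ Metric.ball x ρ, f n y ≠ ⊤) (R : ℝ) :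
    ∑' n, ∫⁻ y in Ω ∩ Metric.ball 0 R, f n y ≠ ⊤ := by
  have hK : IsCompact (closure Ω ∩ Metric.closedBall (0 : Rd d) R) :=
    (isCompact_closedBall 0 R).inter_left isClosed_closure
  refine ne_top_of_le_ne_top (tsum_lintegral_ne_top_of_isCompact (Ω := Ω) (f := f) hK
    fun x hx => h x hx.1) (ENNReal.tsum_le_tsum fun n => lintegral_mono_set ?_)
  exact fun x hx => ⟨hx.1, subset_closure hx.1, Metric.ball_subset_closedBall hx.2⟩

lemma mem_or_mem_frontier {Ω : Set (Rd d)} {x : Rd d} (hx : x ∈ closure Ω) :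
    x ∈ Ω ∨ x ∈ frontier Ω := by
  by_cases h : x ∈ Ω
  · exact Or.inl h
  · exact Or.inr ⟨hx, fun hi => h (interior_subset hi)⟩

lemma bdist_sub_le (Ω : Set (Rd d)) (x y : Rd d) : bdist Ω x ≤ bdist Ω y + dist x y :=
  Metric.infDist_le_infDist_add_dist

/-- Negative powers of order less than one of the distance to the boundary of a Lipschitz domain are
integrable on bounded subsets. -/
lemma IsLipschitzDomain.lintegral_bdist_rpow_ne_top {Ω : Set (Rd d)} (hΩ : IsLipschitzDomain Ω)
    {a : ℝ} (ha : 0 ≤ a) (ha1 : a < 1) (R : ℝ) :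
    ∫⁻ x in Ω ∩ Metric.ball 0 R, ENNReal.ofReal (bdist Ω x) ^ (-a) ≠ ⊤ := by
  have h := tsum_lintegral_ball_ne_top (ι := Unit) (Ω := Ω)
    (f := fun _ x => ENNReal.ofReal (bdist Ω x) ^ (-a)) ?_ R
  · simpa using h
  · intro x hx
    simp only [tsum_fintype, Finset.univ_unique, Finset.sum_const, Finset.card_singleton, one_smul]
    rcases mem_or_mem_frontier hx with hx | hx
    · have hpos := bdist_pos hΩ.1 hΩ.frontier_nonempty hx
      refine ⟨bdist Ω x / 2, by positivity, ?_⟩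
      have hle : ∀ y ∈ Ω ∩ Metric.ball x (bdist Ω x / 2), ENNReal.ofReal (bdist Ω y) ^ (-a) ≤
          ENNReal.ofReal (bdist Ω x / 2) ^ (-a) := by
        intro y hy
        rw [ENNReal.rpow_neg, ENNReal.rpow_neg]
        refine ENNReal.inv_le_inv.2 (ENNReal.rpow_le_rpow (ENNReal.ofReal_le_ofReal ?_) ha)
        have h1 := bdist_sub_le Ω x y
        have h2 := Metric.mem_ball'.1 hy.2
        linarith
      refine ne_top_of_le_ne_top ?_ (setLIntegral_mono'
        (hΩ.1.inter Metric.isOpen_ball).measurableSet hle)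
      rw [setLIntegral_const]
      refine ENNReal.mul_ne_top ?_ (ne_top_of_le_ne_top measure_ball_lt_top.ne
        (measure_mono inter_subset_right))
      exact ENNReal.rpow_ne_top_of_ne_zero (ENNReal.ofReal_pos.2 (by positivity)).ne'
        ENNReal.ofReal_ne_top
    · obtain ⟨e, M, ψ, ρ, hc⟩ := hΩ.exists_chart hx
      exact ⟨ρ / 2, half_pos hc.pos, hc.lintegral_bdist_rpow hx ha ha1⟩

/-- A Poincaré inequality near the boundary passes from smooth functions to functions with zero trace,
for which the boundary term disappears. -/
lemma HasTrace.lintegral_le {Ω : Set (Rd d)} {v : Rd d → ℂ} (hv : HasTrace Ω v 0) {x₀ : Rd d}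
    {ρ ρ' : ℝ} (hρ : ρ' ≤ ρ) {C : ℝ≥0∞} (hC : C ≠ ⊤)
    (h : ∀ φ : Rd d → ℂ, ContDiff ℝ ∞ φ → ∫⁻ x in Ω ∩ Metric.ball x₀ ρ', ‖φ x‖ₑ ≤
        C * ((∫⁻ x in frontier Ω ∩ Metric.ball x₀ ρ, ‖φ x‖ₑ
          ∂(Measure.hausdorffMeasure ((d : ℝ) - 1))) +
          ∫⁻ x in Ω ∩ Metric.ball x₀ ρ, ∑ i, ‖pderiv i φ x‖ₑ)) :
    ∫⁻ x in Ω ∩ Metric.ball x₀ ρ', ‖v x‖ₑ ≤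
      C * ∑ i, ∫⁻ x in Ω ∩ Metric.ball x₀ ρ, ‖weakDeriv Ω (Pi.single i 1) v x‖ₑ := by
  obtain ⟨hw, φ, hφ, hlim⟩ := hv
  set R := ‖x₀‖ + ρ
  obtain ⟨l1, l2, l3⟩ := hlim R
  have hsub : Metric.ball x₀ ρ ⊆ Metric.ball 0 R := ball_subset_ball_zero x₀ ρ
  have hsub' : Metric.ball x₀ ρ' ⊆ Metric.ball 0 R := (Metric.ball_subset_ball hρ).trans hsub
  set D := ∑ i, ∫⁻ x in Ω ∩ Metric.ball x₀ ρ, ‖weakDeriv Ω (Pi.single i 1) v x‖ₑ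
  have hk : ∀ k, ∫⁻ x in Ω ∩ Metric.ball x₀ ρ', ‖v x‖ₑ ≤
      C * ((∫⁻ x in frontier Ω ∩ Metric.ball 0 R, ‖φ k x - (0 : Rd d → ℂ) x‖ₑ
          ∂(Measure.hausdorffMeasure ((d : ℝ) - 1))) +
        (D + ∑ i, ∫⁻ x in Ω ∩ Metric.ball 0 R,
          ‖pderiv i (φ k) x - weakDeriv Ω (Pi.single i 1) v x‖ₑ)) +
        ∫⁻ x in Ω ∩ Metric.ball 0 R, ‖φ k x - v x‖ₑ := by
    intro k
    calc ∫⁻ x in Ω ∩ Metric.ball x₀ ρ', ‖v x‖ₑ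
        ≤ ∫⁻ x in Ω ∩ Metric.ball x₀ ρ', ‖φ k x‖ₑ + ‖φ k x - v x‖ₑ := by
          refine lintegral_mono fun x => ?_
          calc ‖v x‖ₑ = ‖φ k x - (φ k x - v x)‖ₑ := by rw [sub_sub_cancel]
            _ ≤ _ := enorm_sub_le
      _ = (∫⁻ x in Ω ∩ Metric.ball x₀ ρ', ‖φ k x‖ₑ) +
          ∫⁻ x in Ω ∩ Metric.ball x₀ ρ', ‖φ k x - v x‖ₑ :=
          lintegral_add_left (hφ k).continuous.enorm.measurable _
      _ ≤ _ := by
          refine add_le_add ((h (φ k) (hφ k)).trans (mul_le_mul_right (add_le_add ?_ ?_) _))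
            (lintegral_mono_set (inter_subset_inter_right _ hsub'))
          · simp only [Pi.zero_apply, sub_zero]
            exact lintegral_mono_set (inter_subset_inter_right _ hsub)
          · rw [lintegral_finsetSum _ fun i _ =>
              (contDiff_pderiv i (hφ k)).continuous.enorm.measurable, ← Finset.sum_add_distrib]
            refine Finset.sum_le_sum fun i _ => ?_
            have hm : AEMeasurable (fun x => ‖weakDeriv Ω (Pi.single i 1) v x‖ₑ)
                (volume.restrict (Ω ∩ Metric.ball x₀ ρ)) :=
              ((isWeakDeriv_weakDeriv (hw i)).2.1.aestronglyMeasurable.mono_measure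
                (Measure.restrict_mono inter_subset_left le_rfl)).enorm
            calc ∫⁻ x in Ω ∩ Metric.ball x₀ ρ, ‖pderiv i (φ k) x‖ₑ
                ≤ ∫⁻ x in Ω ∩ Metric.ball x₀ ρ, ‖weakDeriv Ω (Pi.single i 1) v x‖ₑ +
                    ‖pderiv i (φ k) x - weakDeriv Ω (Pi.single i 1) v x‖ₑ := by
                  refine lintegral_mono fun x => ?_
                  calc ‖pderiv i (φ k) x‖ₑ = ‖weakDeriv Ω (Pi.single i 1) v x +
                        (pderiv i (φ k) x - weakDeriv Ω (Pi.single i 1) v x)‖ₑ := by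
                        rw [add_sub_cancel]
                    _ ≤ _ := enorm_add_le _ _
              _ = _ := lintegral_add_left' hm _
              _ ≤ _ := by
                  gcongr
  refine ge_of_tendsto' (x := atTop) ?_ hk
  have h2 := tendsto_finsetSum Finset.univ fun i (_ : i ∈ Finset.univ) => l2 i
  have h3 := (ENNReal.Tendsto.const_mul (l3.add (h2.const_add D)) (Or.inr hC)).add l1
  simpa using h3

lemma pderiv_sum {ι : Type*} (s : Finset ι) (i : Fin d) {f : ι → Rd d → ℂ}
    (hf : ∀ n, ContDiff ℝ ∞ (f n)) (x : Rd d) :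
    pderiv i (fun x => ∑ n ∈ s, f n x) x = ∑ n ∈ s, pderiv i (f n) x := by
  simp only [pderiv]
  rw [fderiv_fun_sum fun n _ => ((hf n).differentiable (by simp)).differentiableAt]
  simp

lemma ae_summable_of_tsum_lintegral {E : Type*} [NormedAddCommGroup E] {μ : Measure (Rd d)}
    {f : ℕ → Rd d → E} (hf : ∀ n, AEStronglyMeasurable (f n) μ)
    (h : ∑' n, ∫⁻ x, ‖f n x‖ₑ ∂μ ≠ ⊤) : ∀ᵐ x ∂μ, Summable fun n => ‖f n x‖ := by
  rw [← lintegral_tsum fun n => (hf n).enorm] at h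
  filter_upwards [ae_lt_top' (AEMeasurable.tsum fun n => (hf n).enorm) h] with x hx
  exact tsum_enorm_ne_top_iff_summable_norm.1 hx.ne

/-- Diagonal sums of approximants of the terms of an absolutely convergent series converge to the sum
of the series. -/
lemma tendsto_lintegral_sum_sub_tsum {μ : Measure (Rd d)} {f : ℕ → Rd d → ℂ}
    {F : ℕ → ℕ → Rd d → ℂ} (hf : ∀ n, AEStronglyMeasurable (f n) μ)
    (hF : ∀ K n, AEStronglyMeasurable (F K n) μ) (hsum : ∑' n, ∫⁻ x, ‖f n x‖ₑ ∂μ ≠ ⊤)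
    {η : ℕ → ℝ≥0∞} (hη : Tendsto (fun K : ℕ => K * η K) atTop (𝓝 0))
    (hb : ∀ᶠ K in atTop, ∀ n < K, ∫⁻ x, ‖F K n x - f n x‖ₑ ∂μ ≤ η K) :
    Tendsto (fun K => ∫⁻ x, ‖(∑ n ∈ Finset.range K, F K n x) - ∑' n, f n x‖ₑ ∂μ) atTop (𝓝 0) := by
  have htail := ENNReal.tendsto_sum_nat_add (fun n => ∫⁻ x, ‖f n x‖ₑ ∂μ) hsum
  have hlim := hη.add htail
  rw [add_zero] at hlim
  refine tendsto_of_tendsto_of_tendsto_of_le_of_le' tendsto_const_nhds hlim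
    (Eventually.of_forall fun _ => bot_le) ?_
  filter_upwards [hb] with K hK
  calc ∫⁻ x, ‖(∑ n ∈ Finset.range K, F K n x) - ∑' n, f n x‖ₑ ∂μ
      ≤ ∫⁻ x, (∑ n ∈ Finset.range K, ‖F K n x - f n x‖ₑ) + ∑' n, ‖f (n + K) x‖ₑ ∂μ := by
        refine lintegral_mono_ae ?_
        filter_upwards [ae_summable_of_tsum_lintegral hf hsum] with x hx
        rw [← hx.of_norm.sum_add_tsum_nat_add K, ← sub_sub, ← Finset.sum_sub_distrib]
        refine enorm_sub_le.trans (add_le_add (enorm_sum_le _ _) enorm_tsum_le_tsum_enorm)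
    _ = (∑ n ∈ Finset.range K, ∫⁻ x, ‖F K n x - f n x‖ₑ ∂μ) +
          ∑' n, ∫⁻ x, ‖f (n + K) x‖ₑ ∂μ := by
        rw [lintegral_add_right', lintegral_finsetSum', lintegral_tsum]
        · exact fun n => (hf _).enorm
        · exact fun n _ => ((hF K n).sub (hf n)).enorm
        · exact AEMeasurable.tsum fun n => (hf _).enorm
    _ ≤ K * η K + ∑' n, ∫⁻ x, ‖f (n + K) x‖ₑ ∂μ := by
        gcongr
        refine (Finset.sum_le_card_nsmul _ _ (η K) fun n hn => hK n (Finset.mem_range.1 hn)).trans ?_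
        simp

/-- Zero traces are preserved under sums of series that converge in `W^{1,1}(Ω ∩ B(0, R))` for every
`R`: the approximants of the sum are diagonal sums of approximants of the terms. -/
lemma HasTrace.tsum {Ω : Set (Rd d)} (hΩ : IsOpen Ω) {v : ℕ → Rd d → ℂ}
    (hv : ∀ n, HasTrace Ω (v n) 0) (hs : BallSummable Ω v)
    (hg : ∀ i, BallSummable Ω fun n => weakDeriv Ω (Pi.single i 1) (v n)) :
    HasTrace Ω (fun x => ∑' n, v n x) 0 := by
  have hwd : ∀ i, IsWeakDeriv Ω (Pi.single i 1) (fun x => ∑' n, v n x)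
      (fun x => ∑' n, weakDeriv Ω (Pi.single i 1) (v n) x) := fun i =>
    IsWeakDeriv.tsum (fun n => isWeakDeriv_weakDeriv ((hv n).1 i)) hs.locSummable
      (hg i).locSummable
  refine ⟨fun i => ⟨_, hwd i⟩, ?_⟩
  choose φ hφ hlim using fun n => (hv n).2
  -- The `K`-th approximant is a sum of `K` terms, each with error at most `η K`; hence `K * η K` has to
  -- tend to zero.
  set η : ℕ → ℝ≥0∞ := fun K => ((K : ℝ≥0∞) + 1)⁻¹ * ((K : ℝ≥0∞) + 1)⁻¹ with hη_def
  have hη0 : ∀ K, 0 < η K := fun K => by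
    have h1 : (0 : ℝ≥0∞) < ((K : ℝ≥0∞) + 1)⁻¹ := ENNReal.inv_pos.2 (by simp)
    exact ENNReal.mul_pos h1.ne' h1.ne'
  have hη : Tendsto (fun K : ℕ => (K : ℝ≥0∞) * η K) atTop (𝓝 0) := by
    have h1 : Tendsto (fun K : ℕ => ((K : ℝ≥0∞) + 1)⁻¹) atTop (𝓝 0) := by
      have := (tendsto_add_atTop_iff_nat 1).2 ENNReal.tendsto_inv_nat_nhds_zero
      simpa using this
    refine tendsto_of_tendsto_of_tendsto_of_le_of_le tendsto_const_nhds h1 (fun _ => bot_le)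
      fun K => ?_
    simp only [hη_def]
    rw [← mul_assoc]
    refine mul_le_of_le_one_left bot_le ?_
    rw [← div_eq_mul_inv]
    exact ENNReal.div_le_of_le_mul (by simp)
  have hex : ∀ K n : ℕ, ∃ l, (∫⁻ x in Ω ∩ Metric.ball 0 K, ‖φ n l x - v n x‖ₑ) ≤ η K ∧
      (∀ i, (∫⁻ x in Ω ∩ Metric.ball 0 K,
        ‖pderiv i (φ n l) x - weakDeriv Ω (Pi.single i 1) (v n) x‖ₑ) ≤ η K) ∧
      (∫⁻ x in frontier Ω ∩ Metric.ball 0 K, ‖φ n l x - (0 : Rd d → ℂ) x‖ₑ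
        ∂(Measure.hausdorffMeasure ((d : ℝ) - 1))) ≤ η K := by
    intro K n
    obtain ⟨l1, l2, l3⟩ := hlim n K
    have h2 := eventually_all.2 fun i => (l2 i).eventually_le_const (hη0 K)
    obtain ⟨l, h1, h2, h3⟩ := ((l1.eventually_le_const (hη0 K)).and
      (h2.and (l3.eventually_le_const (hη0 K)))).exists
    exact ⟨l, h1, h2, h3⟩
  choose l h1 h2 h3 using hex
  refine ⟨fun K x => ∑ n ∈ Finset.range K, φ n (l K n) x,
    fun K => ContDiff.sum fun n _ => hφ n _, fun R => ?_⟩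
  obtain ⟨K₀, hK₀⟩ := exists_nat_ge R
  have hsub : ∀ K ≥ K₀, Metric.ball (0 : Rd d) R ⊆ Metric.ball 0 K := fun K hK =>
    Metric.ball_subset_ball (hK₀.trans (by exact_mod_cast hK))
  have hle : volume.restrict (Ω ∩ Metric.ball 0 R) ≤ volume.restrict Ω :=
    Measure.restrict_mono inter_subset_left le_rfl
  refine ⟨?_, fun i => ?_, ?_⟩
  · refine tendsto_lintegral_sum_sub_tsum (F := fun K n => φ n (l K n))
      (fun n => (hs.meas n).mono_measure hle)
      (fun K n => (hφ n _).continuous.aestronglyMeasurable) (hs.bound R) hη ?_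
    filter_upwards [eventually_ge_atTop K₀] with K hK n _
    exact (lintegral_mono_set (inter_subset_inter_right _ (hsub K hK))).trans (h1 K n)
  · have := tendsto_lintegral_sum_sub_tsum (F := fun K n => pderiv i (φ n (l K n)))
      (fun n => ((hg i).meas n).mono_measure hle)
      (fun K n => (contDiff_pderiv i (hφ n _)).continuous.aestronglyMeasurable)
      ((hg i).bound R) hη (by
        filter_upwards [eventually_ge_atTop K₀] with K hK n _
        exact (lintegral_mono_set (inter_subset_inter_right _ (hsub K hK))).trans (h2 K n i))
    refine this.congr fun K => lintegral_congr_ae ?_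
    filter_upwards [ae_mono hle ((hwd i).weakDeriv_ae_eq hΩ)] with x hx
    rw [hx, pderiv_sum _ i fun n => hφ n _]
  · have := tendsto_lintegral_sum_sub_tsum
      (μ := (Measure.hausdorffMeasure ((d : ℝ) - 1)).restrict (frontier Ω ∩ Metric.ball 0 R))
      (f := fun _ => 0) (F := fun K n => φ n (l K n))
      (fun n => aestronglyMeasurable_const)
      (fun K n => (hφ n _).continuous.aestronglyMeasurable) (by simp) hη (by
        filter_upwards [eventually_ge_atTop K₀] with K hK n _
        exact (lintegral_mono_set (inter_subset_inter_right _ (hsub K hK))).trans (h3 K n))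
    simpa using this

lemma HasTrace.congr {Ω : Set (Rd d)} (hΩ : IsOpen Ω) {v w f : Rd d → ℂ} (hv : HasTrace Ω v f)
    (h : v =ᵐ[volume.restrict Ω] w) : HasTrace Ω w f := by
  obtain ⟨hw, φ, hφ, hlim⟩ := hv
  have hd : ∀ i, IsWeakDeriv Ω (Pi.single i 1) w (weakDeriv Ω (Pi.single i 1) v) := fun i =>
    (isWeakDeriv_weakDeriv (hw i)).congr_left h
  have hle : ∀ R, volume.restrict (Ω ∩ Metric.ball 0 R) ≤ volume.restrict Ω := fun R =>
    Measure.restrict_mono inter_subset_left le_rfl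
  refine ⟨fun i => ⟨_, hd i⟩, φ, hφ, fun R => ?_⟩
  obtain ⟨l1, l2, l3⟩ := hlim R
  refine ⟨l1.congr fun k => lintegral_congr_ae ?_,
    fun i => (l2 i).congr fun k => lintegral_congr_ae ?_, l3⟩
  · filter_upwards [ae_mono (hle R) h] with x hx
    rw [hx]
  · filter_upwards [ae_mono (hle R) ((hd i).weakDeriv_ae_eq hΩ)] with x hx
    rw [hx]

/-- In a Lipschitz domain, functions with zero trace and summable gradients are summable: near the
boundary by the Poincaré inequality there, and from there in the whole connected set. -/
lemma IsLipschitzDomain.ballSummable_of_hasTrace {Ω : Set (Rd d)} (hΩ : IsLipschitzDomain Ω)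
    {v : ℕ → Rd d → ℂ} (hvi : ∀ n, LocallyIntegrableOn (v n) Ω) (hv : ∀ n, HasTrace Ω (v n) 0)
    (hg : ∀ i, BallSummable Ω fun n => weakDeriv Ω (Pi.single i 1) (v n)) :
    BallSummable Ω v := by
  have hbdry : ∀ x₀ ∈ frontier Ω, ∃ ρ > 0,
      ∑' n, ∫⁻ y in Ω ∩ Metric.ball x₀ ρ, ‖v n y‖ₑ ≠ ⊤ := by
    intro x₀ hx₀
    obtain ⟨e, M, ψ, ρ, hc⟩ := hΩ.exists_chart hx₀
    obtain ⟨ρ', hρ', C, hC, h⟩ := hc.lintegral_le_boundary hx₀ hΩ.1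
    refine ⟨min ρ' ρ, lt_min hρ' hc.pos, ?_⟩
    have hle : ∀ n, ∫⁻ y in Ω ∩ Metric.ball x₀ (min ρ' ρ), ‖v n y‖ₑ ≤
        C * ∑ i, ∫⁻ x in Ω ∩ Metric.ball x₀ ρ, ‖weakDeriv Ω (Pi.single i 1) (v n) x‖ₑ := by
      intro n
      refine (hv n).lintegral_le (min_le_right _ _) hC fun φ hφ => le_trans ?_ (h φ hφ)
      exact lintegral_mono_set
        (inter_subset_inter_right _ (Metric.ball_subset_ball (min_le_left _ _)))
    refine ne_top_of_le_ne_top ?_ (ENNReal.tsum_le_tsum hle)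
    rw [ENNReal.tsum_mul_left, Summable.tsum_finsetSum fun i _ => ENNReal.summable]
    exact ENNReal.mul_ne_top hC (ENNReal.sum_ne_top.2 fun i _ => (hg i).bound_ball x₀ ρ)
  have hloc : LocSummable Ω v := by
    obtain ⟨x₀, hx₀⟩ := hΩ.frontier_nonempty
    obtain ⟨ρ, hρ, hb⟩ := hbdry x₀ hx₀
    obtain ⟨x, hxb, hxΩ⟩ := mem_closure_iff.1 hx₀.1 _ Metric.isOpen_ball (Metric.mem_ball_self hρ)
    obtain ⟨r, hr, hsub⟩ := Metric.isOpen_iff.1 Metric.isOpen_ball x hxb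
    refine LocSummable.of_gradient hΩ.1 hΩ.2.1.isPreconnected hvi
      (g := fun i n => weakDeriv Ω (Pi.single i 1) (v n))
      (fun i n => isWeakDeriv_weakDeriv ((hv n).1 i)) (fun i => (hg i).locSummable) hxΩ hr ?_
    exact ne_top_of_le_ne_top hb (ENNReal.tsum_le_tsum fun n =>
      lintegral_mono_set (inter_subset_inter_right _ hsub))
  refine ⟨hloc.meas, tsum_lintegral_ball_ne_top fun x hx => ?_⟩
  rcases mem_or_mem_frontier hx with hx | hx
  · exact hloc.bound x hx
  · exact hbdry x hx

/-! ### Countable triangle inequalities -/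

lemma lintegral_Lp_sum_le {X : Type*} [MeasurableSpace X] {μ : Measure X} {p : ℝ} (hp : 1 ≤ p)
    {f : ℕ → X → ℝ≥0∞} (hf : ∀ n, AEMeasurable (f n) μ) (K : ℕ) :
    (∫⁻ x, (∑ n ∈ Finset.range K, f n x) ^ p ∂μ) ^ (1 / p) ≤
      ∑ n ∈ Finset.range K, (∫⁻ x, f n x ^ p ∂μ) ^ (1 / p) := by
  have hp0 : 0 < p := by linarith
  induction K with
  | zero => simp [hp0]
  | succ K ih =>
    simp only [Finset.sum_range_succ]
    refine le_trans ?_ (add_le_add_left ih _)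
    exact ENNReal.lintegral_Lp_add_le
      (Finset.aemeasurable_fun_sum _ fun n _ => hf n) (hf K) hp

lemma tendsto_sum_range_tsum (f : ℕ → ℝ≥0∞) :
    Tendsto (fun K => ∑ n ∈ Finset.range K, f n) atTop (𝓝 (∑' n, f n)) :=
  ENNReal.tendsto_nat_tsum f

/-- Minkowski's inequality for countable sums. -/
lemma lintegral_Lp_tsum_le {X : Type*} [MeasurableSpace X] {μ : Measure X} {p : ℝ} (hp : 1 ≤ p)
    {f : ℕ → X → ℝ≥0∞} (hf : ∀ n, AEMeasurable (f n) μ) :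
    (∫⁻ x, (∑' n, f n x) ^ p ∂μ) ^ (1 / p) ≤ ∑' n, (∫⁻ x, f n x ^ p ∂μ) ^ (1 / p) := by
  have hp0 : 0 < p := by linarith
  have h1 : Tendsto (fun K => ∫⁻ x, (∑ n ∈ Finset.range K, f n x) ^ p ∂μ) atTop
      (𝓝 (∫⁻ x, (∑' n, f n x) ^ p ∂μ)) := by
    refine lintegral_tendsto_of_tendsto_of_monotone
      (fun K => (Finset.aemeasurable_fun_sum _ fun n _ => hf n).pow_const p)
      (Eventually.of_forall fun x => ?_) (Eventually.of_forall fun x => ?_)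
    · intro K L hKL
      exact ENNReal.rpow_le_rpow (Finset.sum_le_sum_of_subset
        (Finset.range_mono hKL)) hp0.le
    · exact ((ENNReal.continuous_rpow_const).tendsto _).comp (tendsto_sum_range_tsum _)
  refine le_of_tendsto' (((ENNReal.continuous_rpow_const).tendsto _).comp h1) fun K => ?_
  exact (lintegral_Lp_sum_le hp hf K).trans (ENNReal.sum_le_tsum _)

lemma ennreal_tsum_rpow_le {p : ℝ} (hp0 : 0 < p) (hp : p ≤ 1) (a : ℕ → ℝ≥0∞) :
    (∑' n, a n) ^ p ≤ ∑' n, a n ^ p := by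
  refine le_of_tendsto' (((ENNReal.continuous_rpow_const).tendsto _).comp
    (tendsto_sum_range_tsum a)) fun K => ?_
  refine le_trans ?_ (ENNReal.sum_le_tsum (Finset.range K))
  simp only [Function.comp]
  induction K with
  | zero => simp [hp0]
  | succ K ih =>
    rw [Finset.sum_range_succ, Finset.sum_range_succ]
    exact (ENNReal.rpow_add_le_add_rpow _ _ hp0.le hp).trans (add_le_add_left ih _)

/-! ### The spaces of averaged functions -/

lemma ball_bdist_subset {Ω : Set (Rd d)} {x : Rd d} (hx : x ∈ Ω) :
    Metric.ball x (bdist Ω x) ⊆ Ω := by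
  rcases (Metric.infDist_nonneg : 0 ≤ bdist Ω x).eq_or_lt with h0 | hpos
  · have h0' : bdist Ω x = 0 := h0.symm
    rw [h0', Metric.ball_zero]
    exact empty_subset _
  have hf : ∀ z ∈ Metric.ball x (bdist Ω x), z ∉ frontier Ω := fun z hz hzf =>
    absurd (Metric.mem_ball'.1 hz) (not_lt.2 (Metric.infDist_le_dist_of_mem hzf))
  have hmem : ∀ z ∈ Metric.ball x (bdist Ω x), z ∈ closure Ω → z ∈ interior Ω := by
    intro z hz hzc
    by_contra hzi
    exact hf z hz ⟨hzc, hzi⟩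
  have hxb := Metric.mem_ball_self (x := x) hpos
  exact ((convex_ball x (bdist Ω x)).isPreconnected.subset_of_closure_inter_subset isOpen_interior
    ⟨x, hxb, hmem x hxb (subset_closure hx)⟩ fun z hz =>
      hmem z hz.2 (closure_mono interior_subset hz.1)).trans interior_subset

lemma ball_half_bdist_subset {Ω : Set (Rd d)} {x : Rd d} (hx : x ∈ Ω) :
    Metric.ball x (bdist Ω x / 2) ⊆ Ω :=
  (Metric.ball_subset_ball (half_le_self Metric.infDist_nonneg)).trans (ball_bdist_subset hx)

lemma continuous_bdist (Ω : Set (Rd d)) : Continuous (bdist Ω) := Metric.continuous_infDist_pt _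

/-- The `L^2` average of `H` over the ball `B(x, dist(x, ∂Ω) / 2)`. -/
def whitneyNorm (Ω : Set (Rd d)) (H : Rd d → Arr d N m) (x : Rd d) : ℝ≥0∞ :=
  whitneyAvg Ω H x ^ (1 / 2 : ℝ)

/-- The weight in the definition of the norm of `L^{p,s}_av(Ω)`, written as a factor of the `L^2`
average: the norm is that of `whitneyNorm * lavWeight` in `L^p(Ω)`. For `p = ∞` the convention
`(⊤ : ℝ≥0∞).toReal⁻¹ = 0` gives the right exponent `1 - s`. -/
def lavWeight (p : ℝ≥0∞) (s : ℝ) (Ω : Set (Rd d)) (x : Rd d) : ℝ≥0∞ :=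
  ENNReal.ofReal (bdist Ω x) ^ (1 - s - p.toReal⁻¹)

lemma LavNorm_top (s : ℝ) (Ω : Set (Rd d)) (H : Rd d → Arr d N m) :
    LavNorm ⊤ s Ω H =
      essSup (fun x => whitneyNorm Ω H x * lavWeight ⊤ s Ω x) (volume.restrict Ω) := by
  simp [LavNorm, whitneyNorm, lavWeight]

lemma LavNorm_of_ne_top {p : ℝ≥0∞} (hp0 : p ≠ 0) (hp : p ≠ ⊤) (s : ℝ) (Ω : Set (Rd d))
    (H : Rd d → Arr d N m) :
    LavNorm p s Ω H =
      (∫⁻ x in Ω, (whitneyNorm Ω H x * lavWeight p s Ω x) ^ p.toReal) ^ (1 / p.toReal) := by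
  have hpp : 0 < p.toReal := ENNReal.toReal_pos hp0 hp
  rw [LavNorm, if_neg hp]
  congr 1
  refine lintegral_congr fun x => ?_
  rw [ENNReal.mul_rpow_of_nonneg _ _ hpp.le, whitneyNorm, lavWeight, ← ENNReal.rpow_mul,
    ← ENNReal.rpow_mul]
  congr 2
  · ring
  · field_simp
    ring

/-- A description of the averages through the normalized measure on the ball. -/
lemma whitneyNorm_eq (Ω : Set (Rd d)) (H : Rd d → Arr d N m) (x : Rd d) :
    whitneyNorm Ω H x = (∫⁻ y, ‖H y‖ₑ ^ (2 : ℝ)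
      ∂((volume.restrict (Metric.ball x (bdist Ω x / 2)) univ)⁻¹ •
        volume.restrict (Metric.ball x (bdist Ω x / 2)))) ^ (1 / 2 : ℝ) := by
  rw [whitneyNorm, whitneyAvg, laverage_eq']
  simp

lemma ae_whitney {Ω : Set (Rd d)} {x : Rd d} (hx : x ∈ Ω) {P : Rd d → Prop}
    (h : ∀ᵐ y ∂(volume.restrict Ω), P y) :
    ∀ᵐ y ∂((volume.restrict (Metric.ball x (bdist Ω x / 2)) univ)⁻¹ •
        volume.restrict (Metric.ball x (bdist Ω x / 2))), P y :=
  Measure.ae_smul_measure (ae_mono (Measure.restrict_mono (ball_half_bdist_subset hx) le_rfl) h) _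

lemma whitneyNorm_le_mul {Ω : Set (Rd d)} {F G : Rd d → Arr d N m} {c : ℝ≥0∞}
    (h : ∀ᵐ y ∂(volume.restrict Ω), ‖F y‖ₑ ≤ c * ‖G y‖ₑ) (hc : c ≠ ⊤) {x : Rd d} (hx : x ∈ Ω) :
    whitneyNorm Ω F x ≤ c * whitneyNorm Ω G x := by
  rw [whitneyNorm_eq, whitneyNorm_eq]
  calc _ ≤ (∫⁻ y, c ^ (2 : ℝ) * ‖G y‖ₑ ^ (2 : ℝ)
      ∂((volume.restrict (Metric.ball x (bdist Ω x / 2)) univ)⁻¹ •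
        volume.restrict (Metric.ball x (bdist Ω x / 2)))) ^ (1 / 2 : ℝ) := by
        refine ENNReal.rpow_le_rpow (lintegral_mono_ae ?_) (by norm_num)
        filter_upwards [ae_whitney hx h] with y hy
        rw [← ENNReal.mul_rpow_of_nonneg _ _ (by norm_num)]
        exact ENNReal.rpow_le_rpow hy (by norm_num)
    _ = _ := by
        rw [lintegral_const_mul' _ _ (ENNReal.rpow_ne_top_of_nonneg (by norm_num) hc),
          ENNReal.mul_rpow_of_nonneg _ _ (by norm_num), ← ENNReal.rpow_mul]
        norm_num

lemma whitneyNorm_le_tsum {Ω : Set (Rd d)} {F : Rd d → Arr d N m} {f : ℕ → Rd d → Arr d N m}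
    (hf : ∀ n, AEStronglyMeasurable (f n) (volume.restrict Ω))
    (h : ∀ᵐ y ∂(volume.restrict Ω), ‖F y‖ₑ ≤ ∑' n, ‖f n y‖ₑ) {x : Rd d} (hx : x ∈ Ω) :
    whitneyNorm Ω F x ≤ ∑' n, whitneyNorm Ω (f n) x := by
  simp only [whitneyNorm_eq]
  refine le_trans (ENNReal.rpow_le_rpow (lintegral_mono_ae ?_) (by norm_num))
    (lintegral_Lp_tsum_le (p := 2) (f := fun n y => ‖f n y‖ₑ) (by norm_num) fun n => ?_)
  · filter_upwards [ae_whitney hx h] with y hy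
    exact ENNReal.rpow_le_rpow hy (by norm_num)
  · exact ((hf n).mono_measure
      (Measure.restrict_mono (ball_half_bdist_subset hx) le_rfl)).enorm.smul_measure _

lemma whitneyNorm_congr {Ω : Set (Rd d)} {F G : Rd d → Arr d N m}
    (h : F =ᵐ[volume.restrict Ω] G) {x : Rd d} (hx : x ∈ Ω) :
    whitneyNorm Ω F x = whitneyNorm Ω G x := by
  rw [whitneyNorm_eq, whitneyNorm_eq]
  congr 1
  refine lintegral_congr_ae ?_
  filter_upwards [ae_whitney hx h] with y hy
  rw [hy]

lemma measurable_lintegral_ball {Ω : Set (Rd d)} {G : Rd d → ℝ≥0∞} (hG : Measurable G) (c : ℝ) :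
    Measurable fun x => ∫⁻ y in Metric.ball x (c * bdist Ω x), G y := by
  have h1 : MeasurableSet {q : Rd d × Rd d | dist q.2 q.1 < c * bdist Ω q.1} := by
    refine (isOpen_lt ?_ ?_).measurableSet
    · fun_prop
    · exact continuous_const.mul ((continuous_bdist Ω).comp continuous_fst)
  have h2 : Measurable fun x => ∫⁻ y, {q : Rd d × Rd d | dist q.2 q.1 < c * bdist Ω q.1}.indicator
      (fun q => G q.2) (x, y) :=
    ((hG.comp measurable_snd).indicator h1).lintegral_prod_right'
  convert h2 using 2 with x
  rw [← lintegral_indicator Metric.isOpen_ball.measurableSet]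
  rfl

lemma aemeasurable_whitneyNorm {Ω : Set (Rd d)} (hΩ : IsOpen Ω) {H : Rd d → Arr d N m}
    (hH : AEStronglyMeasurable H (volume.restrict Ω)) :
    AEMeasurable (whitneyNorm Ω H) (volume.restrict Ω) := by
  obtain ⟨H', hH'm, hH'⟩ := hH
  refine AEMeasurable.congr (f := whitneyNorm Ω H') ?_ ?_
  · refine Measurable.aemeasurable (Measurable.pow_const ?_ _)
    have h1 : Measurable fun x => ∫⁻ y in Metric.ball x (1 / 2 * bdist Ω x), ‖H' y‖ₑ ^ 2 :=
      measurable_lintegral_ball (hH'm.measurable.enorm.pow_const 2) _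
    have h2 : Measurable fun x => ∫⁻ y in Metric.ball x (1 / 2 * bdist Ω x), (1 : ℝ≥0∞) :=
      measurable_lintegral_ball measurable_const _
    have e : whitneyAvg Ω H' = fun x => (∫⁻ y in Metric.ball x (1 / 2 * bdist Ω x), ‖H' y‖ₑ ^ 2) /
        ∫⁻ y in Metric.ball x (1 / 2 * bdist Ω x), (1 : ℝ≥0∞) := by
      funext x
      rw [setLIntegral_one, one_div_mul_eq_div]
      exact setLAverage_eq _ _ _
    rw [e]
    exact h1.div h2
  · refine (ae_restrict_iff' hΩ.measurableSet).2 (Eventually.of_forall fun x hx => ?_)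
    exact whitneyNorm_congr hH'.symm hx

lemma measurable_lavWeight (p : ℝ≥0∞) (s : ℝ) (Ω : Set (Rd d)) : Measurable (lavWeight p s Ω) :=
  ((continuous_bdist Ω).measurable.ennreal_ofReal).pow_const _

lemma LavNorm_le_mul {Ω : Set (Rd d)} (hΩ : IsOpen Ω) {p : ℝ≥0∞} (hp0 : p ≠ 0) (s : ℝ)
    {F G : Rd d → Arr d N m} {c : ℝ≥0∞}
    (h : ∀ᵐ y ∂(volume.restrict Ω), ‖F y‖ₑ ≤ c * ‖G y‖ₑ) (hc : c ≠ ⊤) :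
    LavNorm p s Ω F ≤ c * LavNorm p s Ω G := by
  by_cases hp : p = ⊤
  · subst hp
    rw [LavNorm_top, LavNorm_top, ← ENNReal.essSup_const_mul]
    refine essSup_mono_ae ((ae_restrict_iff' hΩ.measurableSet).2 (Eventually.of_forall fun x hx => ?_))
    simp only
    rw [← mul_assoc]
    exact mul_le_mul_left (whitneyNorm_le_mul h hc hx) _
  · have hpp : 0 < p.toReal := ENNReal.toReal_pos hp0 hp
    rw [LavNorm_of_ne_top hp0 hp, LavNorm_of_ne_top hp0 hp]
    calc _ ≤ (∫⁻ x in Ω, c ^ p.toReal *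
          (whitneyNorm Ω G x * lavWeight p s Ω x) ^ p.toReal) ^ (1 / p.toReal) := by
          refine ENNReal.rpow_le_rpow (setLIntegral_mono' hΩ.measurableSet fun x hx => ?_)
            (by positivity)
          rw [← ENNReal.mul_rpow_of_nonneg _ _ hpp.le, ← mul_assoc]
          exact ENNReal.rpow_le_rpow (mul_le_mul_left (whitneyNorm_le_mul h hc hx) _) hpp.le
      _ = _ := by
          rw [lintegral_const_mul' _ _ (ENNReal.rpow_ne_top_of_nonneg hpp.le hc),
            ENNReal.mul_rpow_of_nonneg _ _ (by positivity), ← ENNReal.rpow_mul,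
            mul_one_div_cancel hpp.ne', ENNReal.rpow_one]

lemma LavNorm_congr {Ω : Set (Rd d)} (hΩ : IsOpen Ω) {p : ℝ≥0∞} (hp0 : p ≠ 0) (s : ℝ)
    {F G : Rd d → Arr d N m} (h : F =ᵐ[volume.restrict Ω] G) :
    LavNorm p s Ω F = LavNorm p s Ω G := by
  refine le_antisymm ?_ ?_
  · simpa using LavNorm_le_mul hΩ hp0 s (c := 1) (h.mono fun x hx => by simp [hx]) (by simp)
  · simpa using LavNorm_le_mul hΩ hp0 s (c := 1) (h.mono fun x hx => by simp [hx]) (by simp)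

/-- The triangle inequality in `L^{p,s}_av(Ω)` for `p ≥ 1`. -/
lemma LavNorm_le_tsum {Ω : Set (Rd d)} (hΩ : IsOpen Ω) {p : ℝ≥0∞} (hp1 : 1 ≤ p) (s : ℝ)
    {F : Rd d → Arr d N m} {f : ℕ → Rd d → Arr d N m}
    (hf : ∀ n, AEStronglyMeasurable (f n) (volume.restrict Ω))
    (h : ∀ᵐ y ∂(volume.restrict Ω), ‖F y‖ₑ ≤ ∑' n, ‖f n y‖ₑ) :
    LavNorm p s Ω F ≤ ∑' n, LavNorm p s Ω (f n) := by
  have hp0 : p ≠ 0 := (zero_lt_one.trans_le hp1).ne'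
  by_cases hp : p = ⊤
  · subst hp
    simp only [LavNorm_top]
    refine essSup_le_of_ae_le _ ?_
    have h1 := ae_all_iff.2 fun n => ENNReal.ae_le_essSup (μ := volume.restrict Ω)
      (fun x => whitneyNorm Ω (f n) x * lavWeight ⊤ s Ω x)
    filter_upwards [h1, ae_restrict_mem hΩ.measurableSet] with x hx hxΩ
    refine (mul_le_mul_left (whitneyNorm_le_tsum hf h hxΩ) _).trans ?_
    rw [← ENNReal.tsum_mul_right]
    exact ENNReal.tsum_le_tsum hx
  · have hpp : 0 < p.toReal := ENNReal.toReal_pos hp0 hp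
    have hpp1 : 1 ≤ p.toReal := by
      rw [← ENNReal.toReal_one]
      exact (ENNReal.toReal_le_toReal ENNReal.one_ne_top hp).2 hp1
    simp only [LavNorm_of_ne_top hp0 hp]
    refine le_trans (ENNReal.rpow_le_rpow (setLIntegral_mono' hΩ.measurableSet fun x hx => ?_)
      (by positivity)) (lintegral_Lp_tsum_le hpp1 fun n =>
        (aemeasurable_whitneyNorm hΩ (hf n)).mul (measurable_lavWeight p s Ω).aemeasurable)
    refine ENNReal.rpow_le_rpow ?_ hpp.le
    rw [ENNReal.tsum_mul_right]
    exact mul_le_mul_left (whitneyNorm_le_tsum hf h hx) _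

/-- The `p`-triangle inequality in `L^{p,s}_av(Ω)` for `p ≤ 1`. -/
lemma LavNorm_rpow_le_tsum {Ω : Set (Rd d)} (hΩ : IsOpen Ω) {p : ℝ≥0∞} (hp0 : p ≠ 0) (hp1 : p ≤ 1)
    (s : ℝ) {F : Rd d → Arr d N m} {f : ℕ → Rd d → Arr d N m}
    (hf : ∀ n, AEStronglyMeasurable (f n) (volume.restrict Ω))
    (h : ∀ᵐ y ∂(volume.restrict Ω), ‖F y‖ₑ ≤ ∑' n, ‖f n y‖ₑ) :
    LavNorm p s Ω F ^ p.toReal ≤ ∑' n, LavNorm p s Ω (f n) ^ p.toReal := by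
  have hp : p ≠ ⊤ := ne_top_of_le_ne_top ENNReal.one_ne_top hp1
  have hpp : 0 < p.toReal := ENNReal.toReal_pos hp0 hp
  have hpp1 : p.toReal ≤ 1 := by
    rw [← ENNReal.toReal_one]
    exact (ENNReal.toReal_le_toReal hp ENNReal.one_ne_top).2 hp1
  simp only [LavNorm_of_ne_top hp0 hp, ← ENNReal.rpow_mul, one_div_mul_cancel hpp.ne',
    ENNReal.rpow_one]
  have hm : ∀ n, AEMeasurable (fun x => (whitneyNorm Ω (f n) x * lavWeight p s Ω x) ^ p.toReal)
      (volume.restrict Ω) := fun n => ((aemeasurable_whitneyNorm hΩ (hf n)).mul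
    (measurable_lavWeight p s Ω).aemeasurable).pow_const _
  rw [← lintegral_tsum hm]
  refine setLIntegral_mono' hΩ.measurableSet fun x hx => ?_
  refine le_trans (ENNReal.rpow_le_rpow ?_ hpp.le) (ennreal_tsum_rpow_le hpp hpp1 _)
  rw [ENNReal.tsum_mul_right]
  exact mul_le_mul_left (whitneyNorm_le_tsum hf h hx) _

/-! ### Integrability up to the boundary -/

lemma IsLipschitzDomain.bdist_pos {Ω : Set (Rd d)} (hΩ : IsLipschitzDomain Ω) {x : Rd d}
    (hx : x ∈ Ω) : 0 < bdist Ω x :=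
  EllipticBVP.bdist_pos hΩ.1 hΩ.frontier_nonempty hx

lemma bdist_le_of_mem_ball_zero {Ω : Set (Rd d)} {R : ℝ} {x : Rd d} (hx : x ∈ Metric.ball 0 R) :
    bdist Ω x ≤ bdist Ω 0 + R :=
  (bdist_sub_le Ω x 0).trans (add_le_add le_rfl (Metric.mem_ball.1 hx).le)

/-- The weight `bdist ^ (-a)` is integrable on bounded subsets for every `a < 1`, whatever the
sign of `a`. -/
lemma IsLipschitzDomain.lintegral_bdist_rpow_ne_top' {Ω : Set (Rd d)} (hΩ : IsLipschitzDomain Ω)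
    {a : ℝ} (ha1 : a < 1) (R : ℝ) :
    ∫⁻ x in Ω ∩ Metric.ball 0 R, ENNReal.ofReal (bdist Ω x) ^ (-a) ≠ ⊤ := by
  rcases le_or_gt 0 a with ha | ha
  · exact hΩ.lintegral_bdist_rpow_ne_top ha ha1 R
  · refine ne_top_of_le_ne_top (b := ENNReal.ofReal (bdist Ω 0 + R) ^ (-a) *
      volume (Metric.ball (0 : Rd d) R)) (ENNReal.mul_ne_top (ENNReal.rpow_ne_top_of_nonneg
        (by linarith) ENNReal.ofReal_ne_top) measure_ball_lt_top.ne) ?_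
    refine (lintegral_mono_set inter_subset_right).trans ?_
    rw [← setLIntegral_const]
    refine setLIntegral_mono' Metric.isOpen_ball.measurableSet fun x hx => ?_
    exact ENNReal.rpow_le_rpow (ENNReal.ofReal_le_ofReal (bdist_le_of_mem_ball_zero hx))
      (by linarith)

/-- The integral of `G` over the ball of radius `bdist Ω x / 8`, divided by the volume of the ball of
radius `bdist Ω x`. For `G = |H|` it is dominated by `whitneyNorm Ω H` at all points of a ball around
`x` (`smallMean_le_whitneyNorm`), and so can be bounded pointwise by the norm of `H` even if
`p < 1`. -/
def smallMean (Ω : Set (Rd d)) (G : Rd d → ℝ≥0∞) (x : Rd d) : ℝ≥0∞ :=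
  (volume (Metric.ball x (1 * bdist Ω x)))⁻¹ * ∫⁻ y in Metric.ball x (1 / 8 * bdist Ω x), G y

lemma measurable_volume_ball (Ω : Set (Rd d)) (c : ℝ) :
    Measurable fun x => volume (Metric.ball x (c * bdist Ω x)) := by
  simpa using measurable_lintegral_ball (Ω := Ω) (G := fun _ => 1) measurable_const c

lemma volume_ball_center (x y : Rd d) (r : ℝ) :
    volume (Metric.ball x r) = volume (Metric.ball y r) := by
  rw [Measure.addHaar_ball_center, Measure.addHaar_ball_center volume y]

lemma lintegral_le_rpow_half {X : Type*} [MeasurableSpace X] {μ : Measure X}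
    [IsProbabilityMeasure μ] {g : X → ℝ≥0∞} (hg : AEMeasurable g μ) :
    ∫⁻ x, g x ∂μ ≤ (∫⁻ x, g x ^ (2 : ℝ) ∂μ) ^ (1 / 2 : ℝ) := by
  have h := ENNReal.lintegral_mul_le_Lp_mul_Lq μ (Real.HolderConjugate.two_two) hg
    (aemeasurable_const (b := (1 : ℝ≥0∞)))
  simpa using h

lemma setLIntegral_le_mul_whitneyNorm {Ω : Set (Rd d)} {H : Rd d → Arr d N m}
    (hH : AEStronglyMeasurable H (volume.restrict Ω)) {z : Rd d} (hz : z ∈ Ω)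
    (hpos : 0 < bdist Ω z) :
    ∫⁻ y in Metric.ball z (bdist Ω z / 2), ‖H y‖ₑ ≤
      volume (Metric.ball z (bdist Ω z / 2)) * whitneyNorm Ω H z := by
  set B := Metric.ball z (bdist Ω z / 2) with hB
  have h0 : volume B ≠ 0 := (Metric.measure_ball_pos volume z (by positivity)).ne'
  have ht : volume B ≠ ⊤ := measure_ball_lt_top.ne
  have hu : volume.restrict B univ = volume B := by simp
  have hp : IsProbabilityMeasure ((volume.restrict B univ)⁻¹ • volume.restrict B) := by
    constructor
    rw [hu, Measure.smul_apply, hu, smul_eq_mul, ENNReal.inv_mul_cancel h0 ht]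
  have hm : AEMeasurable (fun y => ‖H y‖ₑ) ((volume.restrict B univ)⁻¹ • volume.restrict B) :=
    ((hH.mono_measure (Measure.restrict_mono (ball_half_bdist_subset hz) le_rfl)).enorm).smul_measure
      _
  have h := lintegral_le_rpow_half hm
  rw [← whitneyNorm_eq] at h
  refine le_trans (le_of_eq ?_) (mul_le_mul_right h _)
  rw [lintegral_smul_measure, hu, smul_eq_mul, ← mul_assoc, ENNReal.mul_inv_cancel h0 ht, one_mul]

lemma smallMean_le_whitneyNorm {Ω : Set (Rd d)} {H : Rd d → Arr d N m}
    (hH : AEStronglyMeasurable H (volume.restrict Ω)) {x z : Rd d} (hx : x ∈ Ω)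
    (hpos : 0 < bdist Ω x) (hz : z ∈ Metric.ball x (1 / 8 * bdist Ω x)) :
    smallMean Ω (fun y => ‖H y‖ₑ) x ≤ whitneyNorm Ω H z := by
  have hzx : dist z x < 1 / 8 * bdist Ω x := hz
  have h1 := bdist_sub_le Ω x z
  have h2 := bdist_sub_le Ω z x
  rw [dist_comm] at h1
  have hzΩ : z ∈ Ω := ball_bdist_subset hx (Metric.mem_ball.2 (by linarith))
  have hsub : Metric.ball x (1 / 8 * bdist Ω x) ⊆ Metric.ball z (bdist Ω z / 2) := by
    refine Metric.ball_subset_ball' ?_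
    rw [dist_comm]
    linarith
  have hvol : volume (Metric.ball z (bdist Ω z / 2)) ≤ volume (Metric.ball x (1 * bdist Ω x)) := by
    rw [volume_ball_center x z]
    exact measure_mono (Metric.ball_subset_ball (by linarith))
  rw [smallMean, mul_comm, ← div_eq_mul_inv]
  refine ENNReal.div_le_of_le_mul' ?_
  exact (lintegral_mono_set hsub).trans ((setLIntegral_le_mul_whitneyNorm hH hzΩ
    (by linarith)).trans (mul_le_mul_left hvol _))

lemma volume_ball_mul (x : Rd d) {c r : ℝ} (hc : 0 < c) :
    volume (Metric.ball x (c * r)) = ENNReal.ofReal (c ^ d) * volume (Metric.ball x r) := by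
  have h := Measure.addHaar_ball_mul_of_pos (volume : Measure (Rd d)) x hc r
  rw [h, volume_ball_center x 0, finrank_euclideanSpace_fin]

/-- By Tonelli's theorem, an integral over a bounded subset of `Ω` is controlled by that of averages
over small balls. A ball of radius `2 * bdist Ω y` has `32 ^ d` times the volume of one of radius
`bdist Ω y / 16`. -/
lemma lintegral_le_smallMean {Ω : Set (Rd d)} (hΩ : IsLipschitzDomain Ω) {G : Rd d → ℝ≥0∞}
    (hG : Measurable G) (R : ℝ) :
    ∫⁻ y in Ω ∩ Metric.ball 0 R, G y ≤ ENNReal.ofReal (32 ^ d) *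
      ∫⁻ x in Ω ∩ Metric.ball 0 (2 * R + bdist Ω 0), smallMean Ω G x := by
  set R' := 2 * R + bdist Ω 0 with hR'
  set S : Set (Rd d × Rd d) := {q | q.1 ∈ Ω ∩ Metric.ball 0 R' ∧
    dist q.2 q.1 < 1 / 8 * bdist Ω q.1} with hS
  have hO : IsOpen (Ω ∩ Metric.ball (0 : Rd d) R') := hΩ.1.inter Metric.isOpen_ball
  have hSm : MeasurableSet S := by
    refine ((hO.preimage continuous_fst).inter (isOpen_lt
      (f := fun q : Rd d × Rd d => dist q.2 q.1)
      (g := fun q : Rd d × Rd d => 1 / 8 * bdist Ω q.1) ?_ ?_)).measurableSet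
    · fun_prop
    · exact continuous_const.mul ((continuous_bdist Ω).comp continuous_fst)
  set k : Rd d × Rd d → ℝ≥0∞ := S.indicator fun q =>
    (volume (Metric.ball q.1 (1 * bdist Ω q.1)))⁻¹ * G q.2 with hk
  have hkm : Measurable k := by
    refine Measurable.indicator (Measurable.mul ?_ (hG.comp measurable_snd)) hSm
    exact ((measurable_volume_ball Ω 1).comp measurable_fst).inv
  have h1 : ∫⁻ x in Ω ∩ Metric.ball 0 R', smallMean Ω G x = ∫⁻ x, ∫⁻ y, k (x, y) := by
    rw [← lintegral_indicator hO.measurableSet]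
    refine lintegral_congr fun x => ?_
    by_cases hx : x ∈ Ω ∩ Metric.ball 0 R'
    · rw [indicator_of_mem hx, smallMean, ← lintegral_const_mul _ hG,
        ← lintegral_indicator Metric.isOpen_ball.measurableSet]
      refine lintegral_congr fun y => ?_
      by_cases hy : y ∈ Metric.ball x (1 / 8 * bdist Ω x)
      · rw [indicator_of_mem hy, hk, indicator_of_mem (show (x, y) ∈ S from ⟨hx, hy⟩)]
      · rw [indicator_of_notMem hy, hk, indicator_of_notMem fun h => hy h.2]
    · rw [indicator_of_notMem hx]
      symm
      rw [← lintegral_zero (μ := (volume : Measure (Rd d)))]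
      refine lintegral_congr fun y => ?_
      rw [hk, indicator_of_notMem fun h => hx h.1]
  rw [h1, lintegral_lintegral_swap (f := fun x y => k (x, y)) hkm.aemeasurable]
  have hc : ENNReal.ofReal (32 ^ d) ≠ 0 := by simp
  have hkm' : Measurable fun y => ∫⁻ x, k (x, y) := hkm.lintegral_prod_left'
  rw [← lintegral_const_mul _ hkm']
  refine le_trans ?_ (setLIntegral_le_lintegral (Ω ∩ Metric.ball 0 R) _)
  refine setLIntegral_mono' (hΩ.1.inter Metric.isOpen_ball).measurableSet fun y hy => ?_
  have hpos := hΩ.bdist_pos hy.1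
  have hlow : ∫⁻ x in Metric.ball y (1 / 16 * bdist Ω y),
      (ENNReal.ofReal (32 ^ d) * volume (Metric.ball y (1 / 16 * bdist Ω y)))⁻¹ * G y ≤
      ∫⁻ x, k (x, y) := by
    refine le_trans ?_ (setLIntegral_le_lintegral (Metric.ball y (1 / 16 * bdist Ω y)) _)
    refine setLIntegral_mono' Metric.isOpen_ball.measurableSet fun x hx => ?_
    have hxy : dist x y < 1 / 16 * bdist Ω y := hx
    have e1 := bdist_sub_le Ω x y
    have e2 := bdist_sub_le Ω y x
    rw [dist_comm] at e2
    have e3 := bdist_le_of_mem_ball_zero (Ω := Ω) hy.2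
    have hxS : (x, y) ∈ S := by
      refine ⟨⟨ball_bdist_subset hy.1 (Metric.mem_ball.2 (by linarith)), ?_⟩, ?_⟩
      · have e4 := dist_triangle x y 0
        have e5 : dist y 0 < R := hy.2
        have e6 : 0 ≤ dist y 0 := dist_nonneg
        have e7 : 0 ≤ bdist Ω 0 := Metric.infDist_nonneg
        rw [Metric.mem_ball]
        linarith
      · change dist y x < 1 / 8 * bdist Ω x
        rw [dist_comm]
        linarith
    rw [hk, indicator_of_mem hxS]
    refine mul_le_mul_left (ENNReal.inv_le_inv.2 ?_) _
    rw [← volume_ball_mul _ (by norm_num), volume_ball_center y x]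
    exact measure_mono (Metric.ball_subset_ball (by linarith))
  have hv0 : volume (Metric.ball y (1 / 16 * bdist Ω y)) ≠ 0 :=
    (Metric.measure_ball_pos volume y (by positivity)).ne'
  have hvt : volume (Metric.ball y (1 / 16 * bdist Ω y)) ≠ ⊤ := measure_ball_lt_top.ne
  refine le_trans (le_of_eq ?_) (mul_le_mul_right hlow _)
  rw [setLIntegral_const, ENNReal.mul_inv (Or.inl hc) (Or.inl ENNReal.ofReal_ne_top)]
  generalize volume (Metric.ball y (1 / 16 * bdist Ω y)) = v at hv0 hvt
  calc G y = (ENNReal.ofReal (32 ^ d) * (ENNReal.ofReal (32 ^ d))⁻¹) * (v⁻¹ * v) * G y := by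
        rw [ENNReal.mul_inv_cancel hc ENNReal.ofReal_ne_top, ENNReal.inv_mul_cancel hv0 hvt]
        simp
    _ = _ := by ring

lemma lavWeight_ne_zero {Ω : Set (Rd d)} {x : Rd d} (h : 0 < bdist Ω x) (p : ℝ≥0∞) (s : ℝ) :
    lavWeight p s Ω x ≠ 0 :=
  (ENNReal.rpow_pos (ENNReal.ofReal_pos.2 h) ENNReal.ofReal_ne_top).ne'

lemma lavWeight_ne_top {Ω : Set (Rd d)} {x : Rd d} (h : 0 < bdist Ω x) (p : ℝ≥0∞) (s : ℝ) :
    lavWeight p s Ω x ≠ ⊤ :=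
  ENNReal.rpow_ne_top_of_ne_zero (ENNReal.ofReal_pos.2 h).ne' ENNReal.ofReal_ne_top

lemma pmin_lt_toReal {s : ℝ} {p : ℝ≥0∞} (hs0 : 0 < s) (hs1 : s < 1) (hp : pmin d s < p)
    (hp1 : p ≤ 1) : 0 < p.toReal ∧ (d : ℝ) - 1 ≤ p.toReal * ((d : ℝ) - 1 + s) := by
  have hpt : p ≠ ⊤ := ne_top_of_le_ne_top ENNReal.one_ne_top hp1
  have hpp : 0 < p.toReal := ENNReal.toReal_pos (ne_bot_of_gt hp) hpt
  refine ⟨hpp, ?_⟩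
  have h := (ENNReal.ofReal_lt_ofReal_iff hpp).1 (hp.trans_eq (ENNReal.ofReal_toReal hpt).symm)
  rcases Nat.eq_zero_or_pos d with rfl | hd
  · have h1 : p.toReal ≤ 1 := by
      rw [← ENNReal.toReal_one]
      exact (ENNReal.toReal_le_toReal hpt ENNReal.one_ne_top).2 hp1
    push_cast at h ⊢
    nlinarith
  · have hd' : (1 : ℝ) ≤ d := by exact_mod_cast hd
    exact ((div_lt_iff₀ (by linarith)).1 h).le

lemma lintegral_whitneyNorm_top {Ω : Set (Rd d)} (hΩ : IsLipschitzDomain Ω) {s : ℝ} (hs0 : 0 < s)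
    (R : ℝ) : ∃ C : ℝ≥0∞, C ≠ ⊤ ∧ ∀ H : Rd d → Arr d N m,
      ∫⁻ x in Ω ∩ Metric.ball 0 R, whitneyNorm Ω H x ≤ C * LavNorm ⊤ s Ω H := by
  refine ⟨_, hΩ.lintegral_bdist_rpow_ne_top' (a := 1 - s) (by linarith) R, fun H => ?_⟩
  have hm : Measurable fun x => ENNReal.ofReal (bdist Ω x) ^ (-(1 - s)) :=
    ((continuous_bdist Ω).measurable.ennreal_ofReal).pow_const _
  rw [← lintegral_mul_const _ hm]
  refine lintegral_mono_ae ?_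
  have h1 := ENNReal.ae_le_essSup (μ := volume.restrict Ω)
      (fun x => whitneyNorm Ω H x * lavWeight ⊤ s Ω x)
  rw [← LavNorm_top] at h1
  have h2 := ae_mono (Measure.restrict_mono (μ := volume)
    (inter_subset_left (s := Ω) (t := Metric.ball 0 R)) le_rfl) h1
  filter_upwards [h2, ae_restrict_mem (hΩ.1.inter Metric.isOpen_ball).measurableSet] with x hx hxΩ
  have hpos := hΩ.bdist_pos hxΩ.1
  have h3 := (ENNReal.le_div_iff_mul_le (Or.inl (lavWeight_ne_zero hpos ⊤ s))
    (Or.inl (lavWeight_ne_top hpos ⊤ s))).2 hx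
  refine h3.trans (le_of_eq ?_)
  rw [ENNReal.div_eq_inv_mul, lavWeight, ← ENNReal.rpow_neg]
  simp

lemma lintegral_whitneyNorm_of_one_lt {Ω : Set (Rd d)} (hΩ : IsLipschitzDomain Ω) {p : ℝ≥0∞}
    {s : ℝ} (hs0 : 0 < s) (hp1 : 1 < p) (hp : p ≠ ⊤) (R : ℝ) :
    ∃ C : ℝ≥0∞, C ≠ ⊤ ∧ ∀ H : Rd d → Arr d N m, AEStronglyMeasurable H (volume.restrict Ω) →
      ∫⁻ x in Ω ∩ Metric.ball 0 R, whitneyNorm Ω H x ≤ C * LavNorm p s Ω H := by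
  have hp0 : p ≠ 0 := (zero_lt_one.trans hp1).ne'
  have hpp : 1 < p.toReal := by
    rw [← ENNReal.toReal_one]
    exact (ENNReal.toReal_lt_toReal ENNReal.one_ne_top hp).2 hp1
  have hq := Real.HolderConjugate.conjExponent hpp
  set q := p.toReal.conjExponent with hqdef
  have hq0 : 0 < q := hq.symm.pos
  have hqe : q = p.toReal / (p.toReal - 1) := rfl
  have hlt : (1 - s - p.toReal⁻¹) * q < 1 := by
    have e : (1 - s - p.toReal⁻¹) * q = 1 - s * q := by
      rw [hqe]
      have : p.toReal - 1 ≠ 0 := by linarith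
      have : p.toReal ≠ 0 := by linarith
      field_simp
      ring
    rw [e]
    nlinarith
  refine ⟨(∫⁻ x in Ω ∩ Metric.ball 0 R, ENNReal.ofReal (bdist Ω x) ^
    (-((1 - s - p.toReal⁻¹) * q))) ^ (1 / q), ENNReal.rpow_ne_top_of_nonneg (by positivity)
      (hΩ.lintegral_bdist_rpow_ne_top' hlt R), fun H hH => ?_⟩
  have hle : volume.restrict (Ω ∩ Metric.ball 0 R) ≤ volume.restrict Ω :=
    Measure.restrict_mono inter_subset_left le_rfl
  have hW : AEMeasurable (fun x => whitneyNorm Ω H x * lavWeight p s Ω x)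
      (volume.restrict (Ω ∩ Metric.ball 0 R)) :=
    ((aemeasurable_whitneyNorm hΩ.1 hH).mono_measure hle).mul
      (measurable_lavWeight p s Ω).aemeasurable
  have h := ENNReal.lintegral_mul_le_Lp_mul_Lq (volume.restrict (Ω ∩ Metric.ball 0 R)) hq hW
    (measurable_lavWeight p s Ω).inv.aemeasurable
  rw [mul_comm]
  refine le_trans (le_of_eq ?_) (h.trans (mul_le_mul' ?_ (le_of_eq ?_)))
  · refine setLIntegral_congr_fun (hΩ.1.inter Metric.isOpen_ball).measurableSet fun x hx => ?_
    have hpos := hΩ.bdist_pos hx.1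
    simp only [Pi.mul_apply, Pi.inv_apply]
    rw [mul_assoc, ENNReal.mul_inv_cancel (lavWeight_ne_zero hpos p s)
      (lavWeight_ne_top hpos p s), mul_one]
  · rw [LavNorm_of_ne_top hp0 hp]
    exact ENNReal.rpow_le_rpow (lintegral_mono' hle le_rfl) (by positivity)
  · congr 1
    refine lintegral_congr fun x => ?_
    rw [Pi.inv_apply, lavWeight, ← ENNReal.rpow_neg, ← ENNReal.rpow_mul]
    congr 1
    ring

/-- The quasinorm controls `smallMean` pointwise, because `whitneyNorm` dominates `smallMean x` on a
whole ball around `x`. -/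
lemma smallMean_rpow_le {Ω : Set (Rd d)} (hΩ : IsLipschitzDomain Ω) {p : ℝ≥0∞} {s : ℝ}
    (hs0 : 0 < s) (hp0 : p ≠ 0) (hp1 : p ≤ 1) :
    ∃ κ : ℝ≥0∞, κ ≠ 0 ∧ κ ≠ ⊤ ∧ ∀ H : Rd d → Arr d N m,
      AEStronglyMeasurable H (volume.restrict Ω) → ∀ x ∈ Ω,
      smallMean Ω (fun y => ‖H y‖ₑ) x ^ p.toReal *
        (κ * ENNReal.ofReal (bdist Ω x) ^ (p.toReal - 1 - p.toReal * s + d)) ≤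
          LavNorm p s Ω H ^ p.toReal := by
  have hp : p ≠ ⊤ := ne_top_of_le_ne_top ENNReal.one_ne_top hp1
  have hpp : 0 < p.toReal := ENNReal.toReal_pos hp0 hp
  have hpp1 : p.toReal ≤ 1 := by
    rw [← ENNReal.toReal_one]
    exact (ENNReal.toReal_le_toReal hp ENNReal.one_ne_top).2 hp1
  set σ := p.toReal - 1 - p.toReal * s with hσ
  have hσ0 : σ ≤ 0 := by nlinarith
  have h2 : (2 : ℝ≥0∞) ^ σ ≠ 0 := (ENNReal.rpow_pos (by norm_num) (by norm_num)).ne'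
  have h2t : (2 : ℝ≥0∞) ^ σ ≠ ⊤ := ENNReal.rpow_ne_top_of_ne_zero (by norm_num) (by norm_num)
  have hb : volume (Metric.ball (0 : Rd d) 1) ≠ 0 := (Metric.measure_ball_pos _ _ one_pos).ne'
  have hbt : volume (Metric.ball (0 : Rd d) 1) ≠ ⊤ := measure_ball_lt_top.ne
  have h8 : ENNReal.ofReal ((1 / 8) ^ d) ≠ 0 := by
    rw [Ne, ENNReal.ofReal_eq_zero, not_le]
    positivity
  refine ⟨2 ^ σ * (ENNReal.ofReal ((1 / 8) ^ d) * volume (Metric.ball (0 : Rd d) 1)),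
    mul_ne_zero h2 (mul_ne_zero h8 hb),
    ENNReal.mul_ne_top h2t (ENNReal.mul_ne_top ENNReal.ofReal_ne_top hbt), fun H hH x hx => ?_⟩
  have hpos := hΩ.bdist_pos hx
  have hr0 : ENNReal.ofReal (bdist Ω x) ≠ 0 := (ENNReal.ofReal_pos.2 hpos).ne'
  have hsub : Metric.ball x (1 / 8 * bdist Ω x) ⊆ Ω :=
    (Metric.ball_subset_ball (by linarith)).trans (ball_bdist_subset hx)
  have hvol : volume (Metric.ball x (1 / 8 * bdist Ω x)) = ENNReal.ofReal ((1 / 8) ^ d) *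
      (ENNReal.ofReal (bdist Ω x) ^ (d : ℝ) * volume (Metric.ball (0 : Rd d) 1)) := by
    rw [volume_ball_mul x (by norm_num), volume_ball_center x 0]
    have := volume_ball_mul (0 : Rd d) (r := 1) hpos
    rw [mul_one] at this
    rw [this, ENNReal.rpow_natCast, ENNReal.ofReal_pow hpos.le]
  rw [LavNorm_of_ne_top hp0 hp, ← ENNReal.rpow_mul, one_div_mul_cancel hpp.ne', ENNReal.rpow_one]
  refine le_trans ?_ (lintegral_mono_set hsub)
  have hle : ∀ z ∈ Metric.ball x (1 / 8 * bdist Ω x),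
      smallMean Ω (fun y => ‖H y‖ₑ) x ^ p.toReal * (2 ^ σ * ENNReal.ofReal (bdist Ω x) ^ σ) ≤
        (whitneyNorm Ω H z * lavWeight p s Ω z) ^ p.toReal := by
    intro z hz
    have hzx : dist z x < 1 / 8 * bdist Ω x := hz
    have hz2 := bdist_sub_le Ω z x
    rw [ENNReal.mul_rpow_of_nonneg _ _ hpp.le]
    refine mul_le_mul' (ENNReal.rpow_le_rpow (smallMean_le_whitneyNorm hH hx hpos hz) hpp.le) ?_
    have e : lavWeight p s Ω z ^ p.toReal = ENNReal.ofReal (bdist Ω z) ^ σ := by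
      rw [lavWeight, ← ENNReal.rpow_mul]
      congr 1
      rw [hσ]
      field_simp
      ring
    rw [e, ← ENNReal.mul_rpow_of_ne_top (by norm_num) ENNReal.ofReal_ne_top]
    rw [← neg_neg σ, ENNReal.rpow_neg _ (-σ), ENNReal.rpow_neg _ (-σ)]
    refine ENNReal.inv_le_inv.2 (ENNReal.rpow_le_rpow ?_ (by linarith))
    have : (2 : ℝ≥0∞) = ENNReal.ofReal 2 := by simp
    rw [this, ← ENNReal.ofReal_mul (by norm_num)]
    exact ENNReal.ofReal_le_ofReal (by linarith)
  refine le_trans (le_of_eq ?_) (setLIntegral_mono' Metric.isOpen_ball.measurableSet hle)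
  rw [setLIntegral_const, hvol, ENNReal.rpow_add _ _ hr0 ENNReal.ofReal_ne_top]
  ring

lemma lintegral_smallMean_of_le_one {Ω : Set (Rd d)} (hΩ : IsLipschitzDomain Ω) {p : ℝ≥0∞}
    {s : ℝ} (hs0 : 0 < s) (hs1 : s < 1) (hpm : pmin d s < p) (hp1 : p ≤ 1) (R : ℝ) :
    ∃ C : ℝ≥0∞, C ≠ ⊤ ∧ ∀ H : Rd d → Arr d N m, AEStronglyMeasurable H (volume.restrict Ω) →
      ∫⁻ x in Ω ∩ Metric.ball 0 R, smallMean Ω (fun y => ‖H y‖ₑ) x ≤ C * LavNorm p s Ω H := by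
  have hp0 : p ≠ 0 := ne_bot_of_gt hpm
  have hp : p ≠ ⊤ := ne_top_of_le_ne_top ENNReal.one_ne_top hp1
  obtain ⟨hpp, hpd⟩ := pmin_lt_toReal hs0 hs1 hpm hp1
  have hpp1 : p.toReal ≤ 1 := by
    rw [← ENNReal.toReal_one]
    exact (ENNReal.toReal_le_toReal hp ENNReal.one_ne_top).2 hp1
  obtain ⟨κ, hκ0, hκt, hκ⟩ := smallMean_rpow_le (N := N) (m := m) hΩ hs0 hp0 hp1
  set t := p.toReal with ht
  set σ := t - 1 - t * s with hσ
  set q := (1 - t) / t with hq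
  have hq0 : 0 ≤ q := div_nonneg (by linarith) hpp.le
  have htq : t * q = 1 - t := by rw [hq]; field_simp
  -- The exponent of the distance that remains; `0 ≤ β` is the lower bound on `p`.
  set β := -σ - (σ + d) * q with hβ
  have hβ0 : 0 ≤ β := by
    have e : β = (t * ((d : ℝ) - 1 + s) - ((d : ℝ) - 1)) / t := by
      rw [hβ, hq, hσ]
      field_simp
      ring
    rw [e]
    exact div_nonneg (by linarith) hpp.le
  -- Write `smallMean = smallMean ^ t * smallMean ^ (1 - t)`, bound the second factor pointwise by
  -- `smallMean_rpow_le`, and integrate the first.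
  refine ⟨κ ^ (-q) * ENNReal.ofReal (bdist Ω 0 + R) ^ β, ENNReal.mul_ne_top
    (ENNReal.rpow_ne_top_of_ne_zero hκ0 hκt) (ENNReal.rpow_ne_top_of_nonneg hβ0
      ENNReal.ofReal_ne_top), fun H hH => ?_⟩
  set n := LavNorm p s Ω H with hn
  have hpt : ∀ x ∈ Ω ∩ Metric.ball 0 R, smallMean Ω (fun y => ‖H y‖ₑ) x ≤
      (κ ^ (-q) * ENNReal.ofReal (bdist Ω 0 + R) ^ β * n ^ (1 - t)) *
        (whitneyNorm Ω H x * lavWeight p s Ω x) ^ t := by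
    intro x hx
    have hpos := hΩ.bdist_pos hx.1
    set r := ENNReal.ofReal (bdist Ω x) with hr
    have hr0 : r ≠ 0 := (ENNReal.ofReal_pos.2 hpos).ne'
    have hrt : r ≠ ⊤ := ENNReal.ofReal_ne_top
    set J := smallMean Ω (fun y => ‖H y‖ₑ) x with hJ
    have h1 : J ^ (1 - t) ≤ n ^ (1 - t) * (κ ^ (-q) * r ^ (-((σ + d) * q))) := by
      have h2 : J ^ t ≤ n ^ t * (κ * r ^ (σ + d))⁻¹ := by
        rw [← div_eq_mul_inv]
        refine (ENNReal.le_div_iff_mul_le (Or.inl (mul_ne_zero hκ0 ?_)) (Or.inl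
          (ENNReal.mul_ne_top hκt ?_))).2 (hκ H hH x hx.1)
        · exact (ENNReal.rpow_pos (pos_iff_ne_zero.2 hr0) hrt).ne'
        · exact ENNReal.rpow_ne_top_of_ne_zero hr0 hrt
      have h3 := ENNReal.rpow_le_rpow h2 hq0
      rw [← ENNReal.rpow_mul, htq, ENNReal.mul_rpow_of_nonneg _ _ hq0, ← ENNReal.rpow_mul, htq,
        ← ENNReal.rpow_neg_one, ← ENNReal.rpow_mul, ENNReal.mul_rpow_of_ne_top hκt
          (ENNReal.rpow_ne_top_of_ne_zero hr0 hrt), ← ENNReal.rpow_mul] at h3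
      refine h3.trans (le_of_eq ?_)
      congr 3 <;> ring
    have h4 : J ^ t ≤ (whitneyNorm Ω H x * lavWeight p s Ω x) ^ t * r ^ (-σ) := by
      have e : lavWeight p s Ω x ^ t = r ^ σ := by
        rw [lavWeight, ← ENNReal.rpow_mul, ← ht]
        congr 1
        rw [hσ]
        field_simp
        ring
      rw [ENNReal.mul_rpow_of_nonneg _ _ hpp.le, e, mul_assoc, ← ENNReal.rpow_add _ _ hr0 hrt,
        add_neg_cancel, ENNReal.rpow_zero, mul_one]
      exact ENNReal.rpow_le_rpow (smallMean_le_whitneyNorm hH hx.1 hpos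
        (Metric.mem_ball_self (by positivity))) hpp.le
    have h5 : J = J ^ t * J ^ (1 - t) := by
      rw [← ENNReal.rpow_add_of_nonneg _ _ hpp.le (by linarith), add_sub_cancel, ENNReal.rpow_one]
    rw [h5]
    refine (mul_le_mul' h4 h1).trans ?_
    have h6 : r ^ (-σ) * r ^ (-((σ + d) * q)) ≤ ENNReal.ofReal (bdist Ω 0 + R) ^ β := by
      rw [← ENNReal.rpow_add _ _ hr0 hrt, ← sub_eq_add_neg]
      exact ENNReal.rpow_le_rpow (ENNReal.ofReal_le_ofReal (bdist_le_of_mem_ball_zero hx.2)) hβ0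
    calc _ = (whitneyNorm Ω H x * lavWeight p s Ω x) ^ t * n ^ (1 - t) * κ ^ (-q) *
          (r ^ (-σ) * r ^ (-((σ + d) * q))) := by ring
      _ ≤ _ := mul_le_mul_right h6 _
      _ = _ := by ring
  have hle : volume.restrict (Ω ∩ Metric.ball 0 R) ≤ volume.restrict Ω :=
    Measure.restrict_mono inter_subset_left le_rfl
  have hW : AEMeasurable (fun x => (whitneyNorm Ω H x * lavWeight p s Ω x) ^ t)
      (volume.restrict (Ω ∩ Metric.ball 0 R)) :=
    (((aemeasurable_whitneyNorm hΩ.1 hH).mono_measure hle).mul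
      (measurable_lavWeight p s Ω).aemeasurable).pow_const _
  refine (setLIntegral_mono' (hΩ.1.inter Metric.isOpen_ball).measurableSet hpt).trans ?_
  rw [lintegral_const_mul'' _ hW, mul_assoc]
  refine mul_le_mul_right ?_ _
  have h7 : ∫⁻ x in Ω ∩ Metric.ball 0 R, (whitneyNorm Ω H x * lavWeight p s Ω x) ^ t ≤ n ^ t := by
    rw [hn, LavNorm_of_ne_top hp0 hp, ← ENNReal.rpow_mul, one_div_mul_cancel hpp.ne',
      ENNReal.rpow_one]
    exact lintegral_mono' hle le_rfl
  refine (mul_le_mul_right h7 _).trans (le_of_eq ?_)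
  rw [← ENNReal.rpow_add_of_nonneg _ _ (by linarith) hpp.le, sub_add_cancel, ENNReal.rpow_one]

/-- The embedding of `L^{p,s}_av(Ω)` into the functions that are integrable on bounded subsets of
`Ω`. This is where the restrictions on `p` and `s` are used. -/
lemma exists_lintegral_le_LavNorm {Ω : Set (Rd d)} (hΩ : IsLipschitzDomain Ω) {p : ℝ≥0∞}
    {s : ℝ} (hs0 : 0 < s) (hs1 : s < 1) (hpm : pmin d s < p) (R : ℝ) :
    ∃ C : ℝ≥0∞, C ≠ ⊤ ∧ ∀ H : Rd d → Arr d N m, AEStronglyMeasurable H (volume.restrict Ω) →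
      ∫⁻ x in Ω ∩ Metric.ball 0 R, ‖H x‖ₑ ≤ C * LavNorm p s Ω H := by
  set R' := 2 * R + bdist Ω 0 with hR'
  obtain ⟨C, hC, h⟩ : ∃ C : ℝ≥0∞, C ≠ ⊤ ∧ ∀ H : Rd d → Arr d N m, StronglyMeasurable H →
      ∫⁻ x in Ω ∩ Metric.ball 0 R', smallMean Ω (fun y => ‖H y‖ₑ) x ≤ C * LavNorm p s Ω H := by
    rcases le_or_gt p 1 with hp1 | hp1
    · obtain ⟨C, hC, h⟩ := lintegral_smallMean_of_le_one (N := N) (m := m) hΩ hs0 hs1 hpm hp1 R'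
      exact ⟨C, hC, fun H hH => h H hH.aestronglyMeasurable⟩
    · obtain ⟨C, hC, h⟩ : ∃ C : ℝ≥0∞, C ≠ ⊤ ∧ ∀ H : Rd d → Arr d N m,
          AEStronglyMeasurable H (volume.restrict Ω) →
          ∫⁻ x in Ω ∩ Metric.ball 0 R', whitneyNorm Ω H x ≤ C * LavNorm p s Ω H := by
        by_cases hp : p = ⊤
        · subst hp
          obtain ⟨C, hC, h⟩ := lintegral_whitneyNorm_top (N := N) (m := m) hΩ hs0 R'
          exact ⟨C, hC, fun H _ => h H⟩
        · exact lintegral_whitneyNorm_of_one_lt hΩ hs0 hp1 hp R'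
      refine ⟨C, hC, fun H hH => le_trans ?_ (h H hH.aestronglyMeasurable)⟩
      refine setLIntegral_mono' (hΩ.1.inter Metric.isOpen_ball).measurableSet fun x hx => ?_
      have hpos := hΩ.bdist_pos hx.1
      exact smallMean_le_whitneyNorm hH.aestronglyMeasurable hx.1 hpos
        (Metric.mem_ball_self (by positivity))
  refine ⟨ENNReal.ofReal (32 ^ d) * C, ENNReal.mul_ne_top ENNReal.ofReal_ne_top hC,
    fun H ⟨H', hH'm, hH'⟩ => ?_⟩
  have e : ∫⁻ x in Ω ∩ Metric.ball 0 R, ‖H x‖ₑ = ∫⁻ x in Ω ∩ Metric.ball 0 R, ‖H' x‖ₑ := by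
    refine lintegral_congr_ae ?_
    filter_upwards [ae_mono (Measure.restrict_mono inter_subset_left le_rfl) hH'] with x hx
    rw [hx]
  rw [e, LavNorm_congr hΩ.1 (ne_bot_of_gt hpm) s hH', mul_assoc]
  exact (lintegral_le_smallMean hΩ hH'm.measurable.enorm R).trans (mul_le_mul_right (h H' hH'm) _)

/-! ### Multiplication by coefficients -/

/-- The array `A F`, for coefficients `A` and an array-valued function `F`. -/
def mulCoeff (A : Coeff d N m) (F : Rd d → Arr d N m) (x : Rd d) : Arr d N m :=
  Matrix.toEuclideanCLM (𝕜 := ℂ) (A x) (F x)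

lemma aestronglyMeasurable_mulCoeff {Ω : Set (Rd d)} {A : Coeff d N m} (hA : MeasurableCoeff A)
    {F : Rd d → Arr d N m} (hF : AEStronglyMeasurable F (volume.restrict Ω)) :
    AEStronglyMeasurable (mulCoeff A F) (volume.restrict Ω) := by
  have h : AEMeasurable (fun x => (mulCoeff A F x).ofLp) (volume.restrict Ω) := by
    refine aemeasurable_pi_iff.2 fun i => ?_
    simp only [mulCoeff, Matrix.ofLp_toEuclideanCLM, Matrix.mulVec, dotProduct]
    refine Finset.aemeasurable_fun_sum _ fun j _ => ((hA i j).restrict).mul ?_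
    exact ((EuclideanSpace.proj (𝕜 := ℂ) j).continuous.comp_aestronglyMeasurable hF).aemeasurable
  exact (PiLp.continuous_toLp 2 fun _ : Fin N × MultiIndex d m => ℂ).comp_aestronglyMeasurable
    h.aestronglyMeasurable

lemma ae_enorm_mulCoeff_le (A : Coeff d N m) (Ω : Set (Rd d)) (F : Rd d → Arr d N m) :
    ∀ᵐ x ∂(volume.restrict Ω), ‖mulCoeff A F x‖ₑ ≤ coeffNorm A * ‖F x‖ₑ := by
  refine ae_restrict_of_ae ?_
  filter_upwards [ENNReal.ae_le_essSup (μ := volume)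
    fun x => ‖Matrix.toEuclideanCLM (𝕜 := ℂ) (A x)‖ₑ] with x hx
  exact (ContinuousLinearMap.le_opENorm _ _).trans (mul_le_mul_left hx _)

lemma mulCoeff_sub (A B : Coeff d N m) (F : Rd d → Arr d N m) (x : Rd d) :
    mulCoeff (A - B) F x = mulCoeff A F x - mulCoeff B F x := by
  simp [mulCoeff]

lemma LavNorm_mulCoeff_le {Ω : Set (Rd d)} (hΩ : IsOpen Ω) {p : ℝ≥0∞} (hp0 : p ≠ 0) (s : ℝ)
    {A : Coeff d N m} (hA : coeffNorm A ≠ ⊤) (F : Rd d → Arr d N m) :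
    LavNorm p s Ω (mulCoeff A F) ≤ coeffNorm A * LavNorm p s Ω F :=
  LavNorm_le_mul hΩ hp0 s (ae_enorm_mulCoeff_le A Ω F) hA

lemma MemLav.mulCoeff {Ω : Set (Rd d)} (hΩ : IsOpen Ω) {p : ℝ≥0∞} (hp0 : p ≠ 0) {s : ℝ}
    {A : Coeff d N m} (hAm : MeasurableCoeff A) (hA : coeffNorm A ≠ ⊤) {F : Rd d → Arr d N m}
    (hF : MemLav p s Ω F) : MemLav p s Ω (mulCoeff A F) :=
  ⟨aestronglyMeasurable_mulCoeff hAm hF.1,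
    (LavNorm_mulCoeff_le hΩ hp0 s hA F).trans_lt (ENNReal.mul_lt_top hA.lt_top hF.2)⟩

/-! ### Pairings with test functions -/

lemma contDiff_component {φ : Rd d → Fin N → ℂ} (hφ : ContDiff ℝ ∞ φ) (j : Fin N) :
    ContDiff ℝ ∞ fun y => φ y j := contDiff_pi.1 hφ j

lemma continuous_mgrad (m : ℕ) {φ : Rd d → Fin N → ℂ} (hφ : ContDiff ℝ ∞ φ) :
    Continuous (mgrad m φ) :=
  (PiLp.continuous_toLp 2 fun _ : Fin N × MultiIndex d m => ℂ).comp
    (continuous_pi fun i => (contDiff_mderiv i.2.1 (contDiff_component hφ i.1)).continuous)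

lemma hasCompactSupport_mgrad (m : ℕ) {φ : Rd d → Fin N → ℂ} (hφ : ContDiff ℝ ∞ φ)
    (hc : HasCompactSupport φ) : HasCompactSupport (mgrad m φ) := by
  refine HasCompactSupport.intro hc fun x hx => ?_
  ext i
  have h1 : tsupport (fun y => φ y i.1) ⊆ tsupport φ :=
    closure_mono fun y (hy : φ y i.1 ≠ 0) (h0 : φ y = 0) => hy (by simp [h0])
  have h2 := (tsupport_mderiv_subset i.2.1 (contDiff_component hφ i.1)).trans h1
  exact image_eq_zero_of_notMem_tsupport (f := mderiv i.2.1 fun y => φ y i.1) fun h => hx (h2 h)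

lemma exists_enorm_inner_le {g : Rd d → Arr d N m} (hg : Continuous g) (hc : HasCompactSupport g) :
    ∃ (M : ℝ≥0∞) (R : ℝ), M ≠ ⊤ ∧ ∀ (E : Rd d → Arr d N m) x,
      ‖inner ℂ (g x) (E x)‖ₑ ≤ (Metric.ball 0 R).indicator (fun x => M * ‖E x‖ₑ) x := by
  obtain ⟨M, hM⟩ := hg.bounded_above_of_compact_support hc
  obtain ⟨R, hR⟩ := hc.isBounded.subset_ball 0
  refine ⟨ENNReal.ofReal M, R, ENNReal.ofReal_ne_top, fun E x => ?_⟩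
  by_cases hx : x ∈ Metric.ball 0 R
  · rw [indicator_of_mem hx]
    have h1 : ‖g x‖ₑ ≤ ENNReal.ofReal M := by
      rw [← ofReal_norm]
      exact ENNReal.ofReal_le_ofReal (hM x)
    refine le_trans ?_ (mul_le_mul_left h1 _)
    rw [← ofReal_norm, ← ofReal_norm, ← ofReal_norm, ← ENNReal.ofReal_mul (norm_nonneg _)]
    exact ENNReal.ofReal_le_ofReal (norm_inner_le_norm _ _)
  · have : g x = 0 := image_eq_zero_of_notMem_tsupport fun h => hx (hR h)
    simp [this]

lemma integrable_inner {Ω : Set (Rd d)} {g E : Rd d → Arr d N m} (hg : Continuous g)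
    (hc : HasCompactSupport g) (hE : AEStronglyMeasurable E (volume.restrict Ω))
    (hb : ∀ R : ℝ, ∫⁻ x in Ω ∩ Metric.ball 0 R, ‖E x‖ₑ ≠ ⊤) :
    Integrable (fun x => inner ℂ (g x) (E x)) (volume.restrict Ω) := by
  obtain ⟨M, R, hM, h⟩ := exists_enorm_inner_le hg hc
  refine ⟨hg.aestronglyMeasurable.inner hE, ?_⟩
  refine (lintegral_mono fun x => h E x).trans_lt ?_
  rw [lintegral_indicator Metric.isOpen_ball.measurableSet,
    Measure.restrict_restrict Metric.isOpen_ball.measurableSet, inter_comm,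
    lintegral_const_mul' _ _ hM]
  exact ENNReal.mul_lt_top hM.lt_top (hb R).lt_top

/-- Pairing with a test function commutes with locally absolutely convergent sums. -/
lemma integral_inner_tsum_eq_zero {Ω : Set (Rd d)} {g : Rd d → Arr d N m}
    {E : ℕ → Rd d → Arr d N m} (hg : Continuous g) (hc : HasCompactSupport g)
    (hE : BallSummable Ω E) (hz : ∀ n, ∫ x in Ω, inner ℂ (g x) (E n x) = 0)
    {F : Rd d → Arr d N m} (hF : ∀ᵐ x ∂(volume.restrict Ω), HasSum (fun n => E n x) (F x)) :
    ∫ x in Ω, inner ℂ (g x) (F x) = 0 := by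
  obtain ⟨M, R, hM, h⟩ := exists_enorm_inner_le hg hc
  have h1 : ∑' n, ∫⁻ x in Ω, ‖inner ℂ (g x) (E n x)‖ₑ ≠ ⊤ := by
    refine ne_top_of_le_ne_top (ENNReal.mul_ne_top hM (hE.bound R)) ?_
    rw [← ENNReal.tsum_mul_left]
    refine ENNReal.tsum_le_tsum fun n => (lintegral_mono fun x => h (E n) x).trans (le_of_eq ?_)
    rw [lintegral_indicator Metric.isOpen_ball.measurableSet,
      Measure.restrict_restrict Metric.isOpen_ball.measurableSet, inter_comm,
      lintegral_const_mul' _ _ hM]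
  have h2 := integral_tsum (fun n => hg.aestronglyMeasurable.inner (𝕜 := ℂ) (hE.meas n)) h1
  simp only [hz, tsum_zero] at h2
  rw [← h2]
  refine integral_congr_ae ?_
  filter_upwards [hF] with x hx
  exact ((innerSL ℂ (g x)).hasSum hx).tsum_eq.symm

lemma BallSummable.sub {E : Type*} [NormedAddCommGroup E] {Ω : Set (Rd d)}
    {f g : ℕ → Rd d → E} (hf : BallSummable Ω f) (hg : BallSummable Ω g) :
    BallSummable Ω fun n x => f n x - g n x := by
  refine ⟨fun n => (hf.meas n).sub (hg.meas n), fun R => ?_⟩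
  refine ne_top_of_le_ne_top (ENNReal.add_ne_top.2 ⟨hf.bound R, hg.bound R⟩) ?_
  rw [← ENNReal.tsum_add]
  refine ENNReal.tsum_le_tsum fun n => ?_
  have hm := ((hf.meas n).mono_measure (Measure.restrict_mono (μ := volume)
    (inter_subset_left (s := Ω) (t := Metric.ball 0 R)) le_rfl)).enorm
  rw [← lintegral_add_left' hm]
  exact lintegral_mono fun x => enorm_sub_le

lemma BallSummable.ae_summable {E : Type*} [NormedAddCommGroup E] {Ω : Set (Rd d)}
    {f : ℕ → Rd d → E} (hf : BallSummable Ω f) :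
    ∀ᵐ x ∂(volume.restrict Ω), Summable fun n => ‖f n x‖ := by
  have h : ∀ k : ℕ, ∀ᵐ x ∂(volume.restrict (Ω ∩ Metric.ball 0 k)), Summable fun n => ‖f n x‖ :=
    fun k => ae_summable_of_tsum_lintegral (fun n => (hf.meas n).mono_measure
      (Measure.restrict_mono inter_subset_left le_rfl)) (hf.bound k)
  have e : Ω = ⋃ k : ℕ, Ω ∩ Metric.ball (0 : Rd d) k := by
    rw [← inter_iUnion, Metric.iUnion_ball_nat, inter_univ]
  rw [e]
  exact (ae_restrict_iUnion_iff _ _).2 h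

lemma ballSummable_of_tsum_LavNorm {Ω : Set (Rd d)} (hΩ : IsLipschitzDomain Ω) {p : ℝ≥0∞}
    {s : ℝ} (hs0 : 0 < s) (hs1 : s < 1) (hpm : pmin d s < p) {f : ℕ → Rd d → Arr d N m}
    (hf : ∀ n, AEStronglyMeasurable (f n) (volume.restrict Ω))
    (h : ∑' n, LavNorm p s Ω (f n) ≠ ⊤) : BallSummable Ω f := by
  refine ⟨hf, fun R => ?_⟩
  obtain ⟨C, hC, hle⟩ := exists_lintegral_le_LavNorm (N := N) (m := m) hΩ hs0 hs1 hpm R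
  refine ne_top_of_le_ne_top (ENNReal.mul_ne_top hC h) ?_
  rw [← ENNReal.tsum_mul_left]
  exact ENNReal.tsum_le_tsum fun n => hle _ (hf n)

lemma MemLav.lintegral_ne_top {Ω : Set (Rd d)} (hΩ : IsLipschitzDomain Ω) {p : ℝ≥0∞}
    {s : ℝ} (hs0 : 0 < s) (hs1 : s < 1) (hpm : pmin d s < p) {H : Rd d → Arr d N m}
    (hH : MemLav p s Ω H) (R : ℝ) : ∫⁻ x in Ω ∩ Metric.ball 0 R, ‖H x‖ₑ ≠ ⊤ := by
  obtain ⟨C, hC, hle⟩ := exists_lintegral_le_LavNorm (N := N) (m := m) hΩ hs0 hs1 hpm R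
  exact ne_top_of_le_ne_top (ENNReal.mul_ne_top hC hH.2.ne) (hle _ hH.1)

lemma energy_eq_pairing_iff {Ω : Set (Rd d)} (hΩ : IsLipschitzDomain Ω) {p : ℝ≥0∞}
    {s : ℝ} (hs0 : 0 < s) (hs1 : s < 1) (hpm : pmin d s < p) {A : Coeff d N m}
    (hAm : MeasurableCoeff A) (hA : coeffNorm A ≠ ⊤) {H : Rd d → Arr d N m}
    (hH : MemLav p s Ω H) {u : Rd d → Fin N → ℂ} (hu : MemWav m p s Ω u)
    {φ : Rd d → Fin N → ℂ} (hφ : ContDiff ℝ ∞ φ) (hc : HasCompactSupport φ) :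
    energy Ω A φ u = pairing Ω φ H ↔
      ∫ x in Ω, inner ℂ (mgrad m φ x) (mulCoeff A (weakGrad m Ω u) x - H x) = 0 := by
  have hAu := hu.2.mulCoeff hΩ.1 (ne_bot_of_gt hpm) hAm hA
  have i1 := integrable_inner (continuous_mgrad m hφ) (hasCompactSupport_mgrad m hφ hc) hAu.1
    fun R => hAu.lintegral_ne_top hΩ hs0 hs1 hpm R
  have i2 := integrable_inner (continuous_mgrad m hφ) (hasCompactSupport_mgrad m hφ hc) hH.1
    fun R => hH.lintegral_ne_top hΩ hs0 hs1 hpm R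
  simp only [inner_sub_right]
  rw [integral_sub i1 i2, sub_eq_zero]
  rfl

/-! ### The Neumann series -/

lemma mem_multiIndex_iff {k : ℕ} {α : Fin d → ℕ} :
    α ∈ Finset.piAntidiag Finset.univ k ↔ ∑ i, α i = k := by
  simp [Finset.mem_piAntidiag]

lemma tsum_ofReal_geometric {c r : ℝ} (hc : 0 ≤ c) (hr : 0 ≤ r) (hr1 : r < 1) :
    ∑' n : ℕ, ENNReal.ofReal (c * r ^ n) = ENNReal.ofReal (c / (1 - r)) := by
  rw [← ENNReal.ofReal_tsum_of_nonneg (fun n => by positivity)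
    ((summable_geometric_of_lt_one hr hr1).mul_left c), tsum_mul_left,
    tsum_geometric_of_lt_one hr hr1, div_eq_mul_inv]

/-- The constant `perturbConst` is what a geometric series gives: by the triangle inequality if
`1 ≤ p`, and by the `p`-triangle inequality if `p ≤ 1`. -/
lemma LavNorm_le_perturbConst {Ω : Set (Rd d)} (hΩ : IsOpen Ω) {p : ℝ≥0∞} (hp0 : p ≠ 0) (s : ℝ)
    {C ε : ℝ} (hC : 0 < C) (hε : 0 ≤ ε) (hCε : C * ε < 1) {F H : Rd d → Arr d N m}
    {f : ℕ → Rd d → Arr d N m} (hf : ∀ n, AEStronglyMeasurable (f n) (volume.restrict Ω))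
    (h : ∀ᵐ y ∂(volume.restrict Ω), ‖F y‖ₑ ≤ ∑' n, ‖f n y‖ₑ)
    (hb : ∀ n, LavNorm p s Ω (f n) ≤ ENNReal.ofReal (C * (C * ε) ^ n) * LavNorm p s Ω H) :
    LavNorm p s Ω F ≤ ENNReal.ofReal (perturbConst C p ε) * LavNorm p s Ω H := by
  have hCε0 : 0 ≤ C * ε := by positivity
  by_cases hp1 : 1 ≤ p
  · rw [perturbConst, if_pos hp1, ← tsum_ofReal_geometric hC.le hCε0 hCε, ← ENNReal.tsum_mul_right]
    exact (LavNorm_le_tsum hΩ hp1 s hf h).trans (ENNReal.tsum_le_tsum hb)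
  · have hp1' : p ≤ 1 := (not_le.1 hp1).le
    have hpp : 0 < p.toReal := ENNReal.toReal_pos hp0 (ne_top_of_le_ne_top ENNReal.one_ne_top hp1')
    rw [perturbConst, if_neg hp1]
    set t := p.toReal with ht
    have hr0 : 0 ≤ (C * ε) ^ t := Real.rpow_nonneg hCε0 t
    have hr1 : (C * ε) ^ t < 1 := Real.rpow_lt_one hCε0 hCε hpp
    rw [← Real.mul_rpow hC.le hε, ← ENNReal.ofReal_rpow_of_nonneg
      (div_nonneg (Real.rpow_nonneg hC.le t) (by linarith)) (by positivity)]
    refine (ENNReal.rpow_le_rpow_iff hpp).1 ?_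
    rw [ENNReal.mul_rpow_of_nonneg _ _ hpp.le, ← ENNReal.rpow_mul, one_div_mul_cancel hpp.ne',
      ENNReal.rpow_one, ← tsum_ofReal_geometric (Real.rpow_nonneg hC.le t) hr0 hr1,
      ← ENNReal.tsum_mul_right]
    refine (LavNorm_rpow_le_tsum hΩ hp0 hp1' s hf h).trans (ENNReal.tsum_le_tsum fun n => ?_)
    refine (ENNReal.rpow_le_rpow (hb n) hpp.le).trans (le_of_eq ?_)
    rw [ENNReal.mul_rpow_of_nonneg _ _ hpp.le, ENNReal.ofReal_rpow_of_nonneg (by positivity) hpp.le,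
      Real.mul_rpow hC.le (by positivity), Real.rpow_pow_comm hCε0]

lemma MemSobolevLoc.aestronglyMeasurable_weakGrad {Ω : Set (Rd d)}
    {u : Rd d → Fin N → ℂ} (hu : MemSobolevLoc m Ω u) :
    AEStronglyMeasurable (weakGrad m Ω u) (volume.restrict Ω) := by
  have h : AEMeasurable (fun x => (weakGrad m Ω u x).ofLp) (volume.restrict Ω) := by
    refine aemeasurable_pi_iff.2 fun i => ?_
    have hw := isWeakDeriv_weakDeriv (hu i.1 i.2.1 (mem_multiIndex_iff.1 i.2.2).le)
    exact hw.2.1.aestronglyMeasurable.aemeasurable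
  exact (PiLp.continuous_toLp 2 fun _ : Fin N × MultiIndex d m => ℂ).comp_aestronglyMeasurable
    h.aestronglyMeasurable

lemma BallSummable.weakDeriv {Ω : Set (Rd d)} {u : ℕ → Rd d → Fin N → ℂ}
    (h : BallSummable Ω fun n => weakGrad m Ω (u n)) (j : Fin N) {α : Fin d → ℕ}
    (hα : ∑ i, α i = m) : BallSummable Ω fun n => EllipticBVP.weakDeriv Ω α fun y => u n y j := by
  set i : Fin N × MultiIndex d m := (j, ⟨α, mem_multiIndex_iff.2 hα⟩) with hi
  refine ⟨fun n => (EuclideanSpace.proj (𝕜 := ℂ) i).continuous.comp_aestronglyMeasurable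
    (h.meas n), fun R => ne_top_of_le_ne_top (h.bound R) (ENNReal.tsum_le_tsum fun n =>
      lintegral_mono fun x => ?_)⟩
  rw [← ofReal_norm, ← ofReal_norm]
  exact ENNReal.ofReal_le_ofReal (PiLp.norm_apply_le (weakGrad m Ω (u n) x) i)

/-- The derivatives of order `m - 1` of functions with zero Dirichlet data form a convergent series
if the gradients of order `m` do. -/
lemma ballSummable_of_dirichletZero {Ω : Set (Rd d)} (hΩ : IsLipschitzDomain Ω)
    {u : ℕ → Rd d → Fin N → ℂ} (hu : ∀ n, MemSobolevLoc m Ω (u n))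
    (h : BallSummable Ω fun n => weakGrad m Ω (u n)) (hz : ∀ n, DirichletZero m Ω (u n))
    (j : Fin N) {γ : Fin d → ℕ} (hγ : ∑ i, γ i + 1 = m) :
    BallSummable Ω (fun n => weakDeriv Ω γ fun y => u n y j) ∧
      ∀ i, BallSummable Ω fun n => weakDeriv Ω (Pi.single i 1) (weakDeriv Ω γ fun y => u n y j) := by
  have hw := fun n => isWeakDeriv_weakDeriv (hu n j γ (by lia))
  have hg : ∀ i, BallSummable Ω fun n =>
      weakDeriv Ω (Pi.single i 1) (weakDeriv Ω γ fun y => u n y j) := by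
    intro i
    have hs : ∑ l, (γ + Pi.single i 1 : Fin d → ℕ) l = m := by rw [sum_add_single, hγ]
    refine (h.weakDeriv j hs).congr fun n => ?_
    exact (((hw n).single_of_add_single
      (isWeakDeriv_weakDeriv (hu n j _ hs.le))).weakDeriv_ae_eq hΩ.1).symm
  exact ⟨hΩ.ballSummable_of_hasTrace (fun n => (hw n).2.1) (fun n => hz n j γ hγ) hg, hg⟩

/-- Completeness: a series of Sobolev functions whose gradients of order `m` converge absolutely has
a sum, up to polynomials, and zero Dirichlet data are preserved. -/
lemma exists_weakGrad_hasSum {Ω : Set (Rd d)} (hΩ : IsLipschitzDomain Ω) (hm : 1 ≤ m)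
    {u : ℕ → Rd d → Fin N → ℂ} (hu : ∀ n, MemSobolevLoc m Ω (u n))
    (h : BallSummable Ω fun n => weakGrad m Ω (u n)) :
    ∃ v : Rd d → Fin N → ℂ, MemSobolevLoc m Ω v ∧
      (∀ᵐ x ∂(volume.restrict Ω), HasSum (fun n => weakGrad m Ω (u n) x) (weakGrad m Ω v x)) ∧
      ((∀ n, DirichletZero m Ω (u n)) → DirichletZero m Ω v) := by
  have key : ∃ v : Rd d → Fin N → ℂ, MemSobolevLoc m Ω v ∧
      (∀ (j : Fin N) (α : Fin d → ℕ), ∑ i, α i = m → weakDeriv Ω α (fun y => v y j)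
        =ᵐ[volume.restrict Ω] fun x => ∑' n, weakDeriv Ω α (fun y => u n y j) x) ∧
      ((∀ n, DirichletZero m Ω (u n)) → DirichletZero m Ω v) := by
    by_cases hz : ∀ n, DirichletZero m Ω (u n)
    · -- With zero traces, the derivatives of order `m - 1` converge as well, without correction.
      have hex := fun j : Fin N => exists_weakDeriv_eq_tsum hΩ.1 hΩ.2.1 (Nat.sub_le m 1)
        (w := fun n y => u n y j) (fun n α hα => hu n j α hα) (fun α h1 h2 => by
          rcases Nat.lt_or_ge (∑ i, α i) m with h3 | h3
          · exact (ballSummable_of_dirichletZero hΩ hu h hz j (by lia)).1.locSummable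
          · exact (h.weakDeriv j (le_antisymm h2 h3)).locSummable)
      choose v hv1 hv2 using hex
      refine ⟨fun x j => v j x, fun j α hα => hv1 j α hα,
        fun j α hα => hv2 j α (by lia) hα.le, fun _ j γ hγ => ?_⟩
      have hb := ballSummable_of_dirichletZero hΩ hu h hz j hγ
      exact (HasTrace.tsum hΩ.1 (fun n => hz n j γ hγ) hb.1 hb.2).congr hΩ.1
        (hv2 j γ (by lia) (by lia)).symm
    · have hex := fun j : Fin N => exists_weakDeriv_eq_tsum hΩ.1 hΩ.2.1 (le_refl m)
        (w := fun n y => u n y j) (fun n α hα => hu n j α hα)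
        (fun α h1 h2 => (h.weakDeriv j (le_antisymm h2 h1)).locSummable)
      choose v hv1 hv2 using hex
      exact ⟨fun x j => v j x, fun j α hα => hv1 j α hα,
        fun j α hα => hv2 j α hα.ge hα.le, fun hz' => absurd hz' hz⟩
  obtain ⟨v, hv, hsum, hdir⟩ := key
  refine ⟨v, hv, ?_, hdir⟩
  have hall := ae_all_iff.2 fun i : Fin N × MultiIndex d m =>
    hsum i.1 i.2.1 (mem_multiIndex_iff.1 i.2.2)
  filter_upwards [hall, h.ae_summable] with x hx hs
  have hs' := hs.of_norm.hasSum
  have e : weakGrad m Ω v x = ∑' n, weakGrad m Ω (u n) x := PiLp.ext fun i =>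
    (hx i).trans ((EuclideanSpace.proj (𝕜 := ℂ) i).hasSum hs').tsum_eq
  rw [e]
  exact hs'

lemma coeffNorm_le_add (A B : Coeff d N m) : coeffNorm B ≤ coeffNorm A + coeffNorm (A - B) := by
  refine essSup_le_of_ae_le _ ?_
  filter_upwards [ENNReal.ae_le_essSup (μ := volume)
    fun x => ‖Matrix.toEuclideanCLM (𝕜 := ℂ) (A x)‖ₑ, ENNReal.ae_le_essSup (μ := volume)
    fun x => ‖Matrix.toEuclideanCLM (𝕜 := ℂ) ((A - B) x)‖ₑ] with x h1 h2
  have e : Matrix.toEuclideanCLM (𝕜 := ℂ) (B x) =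
      Matrix.toEuclideanCLM (𝕜 := ℂ) (A x) - Matrix.toEuclideanCLM (𝕜 := ℂ) ((A - B) x) := by
    simp
  rw [e]
  exact enorm_sub_le.trans (add_le_add h1 h2)

lemma MeasurableCoeff.sub {A B : Coeff d N m} (hA : MeasurableCoeff A) (hB : MeasurableCoeff B) :
    MeasurableCoeff (A - B) := fun i j => (hA i j).sub (hB i j)

/-- Simultaneous solvability in a family of spaces is stable under small perturbations of the
coefficients. The solution is the sum of `u 0, u 1, …`, where `u 0` solves the problem for `A` with
data `H`, and `u (n + 1)` the problem for `A` with data `(A - B) ∇^m (u n)`. -/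
lemma exists_solves_perturbed {ι : Type*} [Nonempty ι] (hm : 1 ≤ m) {Ω : Set (Rd d)}
    (hΩ : IsLipschitzDomain Ω) {A B : Coeff d N m} (hA : MeasurableCoeff A)
    (hB : MeasurableCoeff B) (hA_bdd : coeffNorm A < ⊤) {ε : ℝ} (hε_nonneg : 0 ≤ ε)
    (hε : coeffNorm (A - B) = ENNReal.ofReal ε) (b : BVP) {p : ι → ℝ≥0∞} {s C : ι → ℝ}
    (hs0 : ∀ i, 0 < s i) (hs1 : ∀ i, s i < 1) (hpm : ∀ i, pmin d (s i) < p i) (hC : ∀ i, 0 < C i)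
    (hCε : ∀ i, ε < 1 / C i)
    (hsol : ∀ H : Rd d → Arr d N m, (∀ i, MemLav (p i) (s i) Ω H) → ∃ u : Rd d → Fin N → ℂ,
      ∀ i, Solves b Ω A (p i) (s i) H u ∧ NormBound Ω (p i) (s i) (C i) H u)
    {H : Rd d → Arr d N m} (hH : ∀ i, MemLav (p i) (s i) Ω H) :
    ∃ u : Rd d → Fin N → ℂ, ∀ i, Solves b Ω B (p i) (s i) H u ∧
      NormBound Ω (p i) (s i) (perturbConst (C i) (p i) ε) H u := by
  have hp0 : ∀ i, p i ≠ 0 := fun i => ne_bot_of_gt (hpm i)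
  have hD : coeffNorm (A - B) ≠ ⊤ := by rw [hε]; exact ENNReal.ofReal_ne_top
  have hB_bdd : coeffNorm B ≠ ⊤ := ne_top_of_le_ne_top (ENNReal.add_ne_top.2 ⟨hA_bdd.ne, hD⟩)
    (coeffNorm_le_add A B)
  have hCε0 : ∀ i, 0 ≤ C i * ε := fun i => mul_nonneg (hC i).le hε_nonneg
  have hCε1 : ∀ i, C i * ε < 1 := fun i => by
    have := (lt_div_iff₀ (hC i)).1 (hCε i)
    rwa [mul_comm]
  obtain ⟨u, G, hG0, hGs, hG, hu⟩ : ∃ (u : ℕ → Rd d → Fin N → ℂ) (G : ℕ → Rd d → Arr d N m),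
      G 0 = H ∧ (∀ n, G (n + 1) = mulCoeff (A - B) (weakGrad m Ω (u n))) ∧
      (∀ n i, MemLav (p i) (s i) Ω (G n)) ∧ ∀ n i, Solves b Ω A (p i) (s i) (G n) (u n) ∧
        NormBound Ω (p i) (s i) (C i) (G n) (u n) := by
    choose S hS using hsol
    let step : {H : Rd d → Arr d N m // ∀ i, MemLav (p i) (s i) Ω H} →
        {H : Rd d → Arr d N m // ∀ i, MemLav (p i) (s i) Ω H} := fun G =>
      ⟨mulCoeff (A - B) (weakGrad m Ω (S G.1 G.2)), fun i =>
        (hS G.1 G.2 i).1.1.2.mulCoeff hΩ.1 (hp0 i) (hA.sub hB) hD⟩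
    refine ⟨fun n => S (step^[n] ⟨H, hH⟩).1 (step^[n] ⟨H, hH⟩).2, fun n => (step^[n] ⟨H, hH⟩).1,
      rfl, fun n => ?_, fun n => (step^[n] ⟨H, hH⟩).2, fun n => hS _ _⟩
    simp only [Function.iterate_succ_apply']
    rfl
  have hbF : ∀ n i, LavNorm (p i) (s i) Ω (weakGrad m Ω (u n)) ≤
      ENNReal.ofReal (C i) * LavNorm (p i) (s i) Ω (G n) := fun n i => (hu n i).2
  have hbG : ∀ n i, LavNorm (p i) (s i) Ω (G n) ≤
      ENNReal.ofReal ((C i * ε) ^ n) * LavNorm (p i) (s i) Ω H := by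
    intro n i
    induction n with
    | zero => simp [hG0]
    | succ n ih =>
      rw [hGs]
      refine (LavNorm_mulCoeff_le hΩ.1 (hp0 i) (s i) hD _).trans ?_
      rw [hε]
      refine (mul_le_mul_right ((hbF n i).trans (mul_le_mul_right ih _)) _).trans (le_of_eq ?_)
      rw [← mul_assoc, ← mul_assoc, ← ENNReal.ofReal_mul hε_nonneg,
        ← ENNReal.ofReal_mul (mul_nonneg hε_nonneg (hC i).le)]
      congr 2
      ring
  have hbF' : ∀ n i, LavNorm (p i) (s i) Ω (weakGrad m Ω (u n)) ≤
      ENNReal.ofReal (C i * (C i * ε) ^ n) * LavNorm (p i) (s i) Ω H := by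
    intro n i
    rw [ENNReal.ofReal_mul (hC i).le, mul_assoc]
    exact (hbF n i).trans (mul_le_mul_right (hbG n i) _)
  obtain ⟨i₀⟩ : Nonempty ι := inferInstance
  have hFm : ∀ n, AEStronglyMeasurable (weakGrad m Ω (u n)) (volume.restrict Ω) :=
    fun n => (hu n i₀).1.1.2.1
  have hsumF : ∑' n, LavNorm (p i₀) (s i₀) Ω (weakGrad m Ω (u n)) ≠ ⊤ := by
    refine ne_top_of_le_ne_top ?_ (ENNReal.tsum_le_tsum fun n => hbF' n i₀)
    rw [ENNReal.tsum_mul_right, tsum_ofReal_geometric (hC i₀).le (hCε0 i₀) (hCε1 i₀)]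
    exact ENNReal.mul_ne_top ENNReal.ofReal_ne_top (hH i₀).2.ne
  have hF : BallSummable Ω fun n => weakGrad m Ω (u n) :=
    ballSummable_of_tsum_LavNorm hΩ (hs0 i₀) (hs1 i₀) (hpm i₀) hFm hsumF
  have hGsum : BallSummable Ω G := by
    refine ballSummable_of_tsum_LavNorm hΩ (hs0 i₀) (hs1 i₀) (hpm i₀) (fun n => (hG n i₀).1) ?_
    refine ne_top_of_le_ne_top ?_ (ENNReal.tsum_le_tsum fun n => hbG n i₀)
    have hgeo := tsum_ofReal_geometric (c := 1) zero_le_one (hCε0 i₀) (hCε1 i₀)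
    simp only [one_mul] at hgeo
    rw [ENNReal.tsum_mul_right, hgeo]
    exact ENNReal.mul_ne_top ENNReal.ofReal_ne_top (hH i₀).2.ne
  have hAF : BallSummable Ω fun n => mulCoeff A (weakGrad m Ω (u n)) := by
    refine ballSummable_of_tsum_LavNorm hΩ (hs0 i₀) (hs1 i₀) (hpm i₀)
      (fun n => aestronglyMeasurable_mulCoeff hA (hFm n)) ?_
    refine ne_top_of_le_ne_top (ENNReal.mul_ne_top hA_bdd.ne hsumF) ?_
    rw [← ENNReal.tsum_mul_left]
    exact ENNReal.tsum_le_tsum fun n => LavNorm_mulCoeff_le hΩ.1 (hp0 i₀) (s i₀) hA_bdd.ne _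
  obtain ⟨v, hv, hvsum, hvdir⟩ := exists_weakGrad_hasSum hΩ hm (fun n => (hu n i₀).1.1.1) hF
  have hvle : ∀ᵐ x ∂(volume.restrict Ω), ‖weakGrad m Ω v x‖ₑ ≤ ∑' n, ‖weakGrad m Ω (u n) x‖ₑ := by
    filter_upwards [hvsum] with x hx
    rw [← hx.tsum_eq]
    exact enorm_tsum_le_tsum_enorm
  have hbound : ∀ i, NormBound Ω (p i) (s i) (perturbConst (C i) (p i) ε) H v := fun i =>
    LavNorm_le_perturbConst hΩ.1 (hp0 i) (s i) (hC i) hε_nonneg (hCε1 i) hFm hvle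
      fun n => hbF' n i
  have hmem : ∀ i, MemWav m (p i) (s i) Ω v := fun i =>
    ⟨hv, hv.aestronglyMeasurable_weakGrad,
      (hbound i).trans_lt (ENNReal.mul_lt_top ENNReal.ofReal_lt_top (hH i).2)⟩
  -- The residuals `A ∇^m (u n) - G n` telescope to `B ∇^m v - H`.
  have hres : ∀ᵐ x ∂(volume.restrict Ω),
      HasSum (fun n => mulCoeff A (weakGrad m Ω (u n)) x - G n x)
        (mulCoeff B (weakGrad m Ω v) x - H x) := by
    filter_upwards [hvsum] with x hx
    have h1 : HasSum (fun n => mulCoeff A (weakGrad m Ω (u n)) x) (mulCoeff A (weakGrad m Ω v) x) :=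
      (Matrix.toEuclideanCLM (𝕜 := ℂ) (A x)).hasSum hx
    have h2 : HasSum (fun n => G (n + 1) x) (mulCoeff (A - B) (weakGrad m Ω v) x) := by
      simp only [hGs]
      exact (Matrix.toEuclideanCLM (𝕜 := ℂ) ((A - B) x)).hasSum hx
    have h3 := h1.sub (HasSum.zero_add (f := fun n => G n x) h2)
    rw [mulCoeff_sub, hG0] at h3
    convert h3 using 1
    abel
  have hpair : ∀ φ : Rd d → Fin N → ℂ, ContDiff ℝ ∞ φ → HasCompactSupport φ →
      (∀ n, ∫ x in Ω, inner ℂ (mgrad m φ x) (mulCoeff A (weakGrad m Ω (u n)) x - G n x) = 0) →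
      ∫ x in Ω, inner ℂ (mgrad m φ x) (mulCoeff B (weakGrad m Ω v) x - H x) = 0 :=
    fun φ hφ hc hz => integral_inner_tsum_eq_zero (continuous_mgrad m hφ)
      (hasCompactSupport_mgrad m hφ hc) (hAF.sub hGsum) hz hres
  have hweak : WeakEq Ω B H v := fun φ hφ hc hsupp =>
    (energy_eq_pairing_iff hΩ (hs0 i₀) (hs1 i₀) (hpm i₀) hB hB_bdd (hH i₀) (hmem i₀) hφ hc).2
      (hpair φ hφ hc fun n => (energy_eq_pairing_iff hΩ (hs0 i₀) (hs1 i₀) (hpm i₀) hA hA_bdd.ne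
        (hG n i₀) (hu n i₀).1.1 hφ hc).1 ((hu n i₀).1.2.1 φ hφ hc hsupp))
  have hzero : ZeroBoundary b Ω B H v := by
    have hun := fun n => (hu n i₀).1.2.2
    cases b with
    | dirichlet => exact hvdir hun
    | neumann => exact fun φ hφ hc => hpair φ hφ hc fun n => hun n φ hφ hc
  exact ⟨v, fun i => ⟨⟨hmem i, hweak, hzero⟩, hbound i⟩⟩

end EllipticBVP

end

open EllipticBVP
theorem theorem4p2 {d N m : ℕ} (hm : 1 ≤ m) (Ω : Set (Rd d)) (hΩ : IsLipschitzDomain Ω)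
    (A B : Coeff d N m) (hA : MeasurableCoeff A) (hB : MeasurableCoeff B)
    (hA_bdd : coeffNorm A < ⊤) (ε : ℝ) (hε_nonneg : 0 ≤ ε)
    (hε : coeffNorm (A - B) = ENNReal.ofReal ε) (b : BVP) :
    (∀ (p : ℝ≥0∞) (s C₀ : ℝ), 0 < s → s < 1 → pmin d s < p → 0 < C₀ →
      Solvable b Ω A p s C₀ → ε < 1 / C₀ →
        Solvable b Ω B p s (perturbConst C₀ p ε)) ∧
    (∀ (p₀ p₁ : ℝ≥0∞) (s₀ s₁ C₀ C₁ : ℝ),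
      0 < s₀ → s₀ < 1 → pmin d s₀ < p₀ → 0 < s₁ → s₁ < 1 → pmin d s₁ < p₁ →
      0 < C₀ → 0 < C₁ → CompatiblyWellPosed b Ω A p₀ s₀ C₀ p₁ s₁ C₁ →
      ε < min (1 / C₀) (1 / C₁) →
        ∀ H : Rd d → Arr d N m, MemLav p₀ s₀ Ω H → MemLav p₁ s₁ Ω H →
          ∃ u : Rd d → Fin N → ℂ, Solves b Ω B p₀ s₀ H u ∧ Solves b Ω B p₁ s₁ H u ∧
            NormBound Ω p₀ s₀ (perturbConst C₀ p₀ ε) H u ∧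
            NormBound Ω p₁ s₁ (perturbConst C₁ p₁ ε) H u) := by
  refine ⟨fun p s C₀ hs0 hs1 hpm hC hsol hε' H hH => ?_, ?_⟩
  · obtain ⟨u, hu⟩ := exists_solves_perturbed (ι := Unit) hm hΩ hA hB hA_bdd hε_nonneg hε b
      (fun _ => hs0) (fun _ => hs1) (fun _ => hpm) (fun _ => hC) (fun _ => hε')
      (fun G hG => (hsol G (hG ())).imp fun u hu _ => hu) (fun _ => hH)
    exact ⟨u, hu ()⟩
  · intro p₀ p₁ s₀ s₁ C₀ C₁ hs00 hs01 hpm0 hs10 hs11 hpm1 hC0 hC1 hsol hε' H hH0 hH1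
    obtain ⟨hw0, hw1, hcomp⟩ := hsol
    obtain ⟨hε0, hε1⟩ := lt_min_iff.1 hε'
    obtain ⟨u, hu⟩ := exists_solves_perturbed (ι := Bool) hm hΩ hA hB hA_bdd hε_nonneg hε b
      (p := fun i => cond i p₁ p₀) (s := fun i => cond i s₁ s₀) (C := fun i => cond i C₁ C₀)
      (Bool.forall_bool.2 ⟨hs00, hs10⟩) (Bool.forall_bool.2 ⟨hs01, hs11⟩)
      (Bool.forall_bool.2 ⟨hpm0, hpm1⟩) (Bool.forall_bool.2 ⟨hC0, hC1⟩)
      (Bool.forall_bool.2 ⟨hε0, hε1⟩) (fun G hG => by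
        obtain ⟨u, h0, h1⟩ := hcomp G (hG false) (hG true)
        exact ⟨u, Bool.forall_bool.2 ⟨⟨h0, (hw0 G (hG false)).2.1 u h0⟩,
          ⟨h1, (hw1 G (hG true)).2.1 u h1⟩⟩⟩) (Bool.forall_bool.2 ⟨hH0, hH1⟩)
    exact ⟨u, (hu false).1, (hu true).1, (hu false).2, (hu true).2⟩
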